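/- Let $N$ be a non-negative integer. Let $\mathrm{Y}(\mathfrak{gl}_N)$ be the Yangian: the unital associative $\mathbb{C}$-algebra generated by $T_{ij}^{(r)}$ ($r\ge 1$, $1\le i,j\le N$) with relations $$[T^{(r+1)}_{ij},T^{(s)}_{kl}]-[T^{(r)}_{ij},T^{(s+1)}_{kl}]=T^{(r)}_{kj}T^{(s)}_{il}-T^{(s)}_{kj}T^{(r)}_{il}\qquad(r,s\ge 0,\ T^{(0)}_{ij}=\delta_{ij}),$$ and put $T_{ij}(u)=\sum_{r\ge 0}T_{ij}^{(r)}u^{-r}$. Let $\mathrm{Y}^\ast(\mathfrak{gl}_N)$ be the dual Yangian: the unital associative $\mathbb{C}$-algebra generated by $T_{ij}^{(-r)}$ ($r\ge 1$) with relations $$(u-v)\,[T^\ast_{ij}(u),T^\ast_{kl}(v)]=T^\ast_{il}(u)T^\ast_{kj}(v)-T^\ast_{il}(v)T^\ast_{kj}(u),\qquad T^\ast_{ij}(v)=\delta_{ij}+\sum_{r\ge 1}T_{ij}^{(-r)}v^{r-1}.$$ Both are bialgebras, with comultiplications $T_{ij}(u)\mapsto\sum_k T_{ik}(u)\otimes T_{kj}(u)$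 and $T^\ast_{ij}(v)\mapsto\sum_k T^\ast_{ik}(v)\otimes T^\ast_{kj}(v)$, and counits $T_{ij}(u)\mapsto\delta_{ij}$ and $T^\ast_{ij}(v)\mapsto\delta_{ij}$. Let $T_a(u)$ and $T^\ast_b(v)$ be the matrices with entries $T_{ij}(u)$ and $T^\ast_{ij}(v)$ acting in the $a$-th and $b$-th tensor factor respectively, and let $R(u)=1-Pu^{-1}$, where $P=\sum_{i,j}e_{ij}\otimes e_{ji}$. Then the following hold. (1) There is a unique bilinear pairing $\langle\,,\rangle:\mathrm{Y}(\mathfrak{gl}_N)\times\mathrm{Y}^\ast(\mathfrak{gl}_N)\to\mathbb{C}$ such that for all $m,n\ge 0$ the induced map sends $$T_1(u_1)\cdots T_m(u_m)\otimes T^\ast_1(v_1)\cdots T^\ast_n(v_n)\ \mapsto\ \prod_{1\le a\le m}^{\rightarrow}\ \prod_{1\le b\le n}^{\rightarrow}R_{a,b+m}(u_a-v_b)\in(\mathrm{End}\,\mathbb{C}^N)^{\otimes(m+n)}[[u_1^{-1},\dots,u_m^{-1},v_1,\dots,v_n]],$$ where $(u_a-v_b)^{-1}$ is expanded as $\sum_{r\ge1}u_a^{-r}v_b^{r-1}$.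 (2) The pairing is non-degenerate: for every $X\ne 0$ there is a $Z$ with $\langle X,Z\rangle\ne 0$, and for every $Z\ne0$ there is an $X$ with $\langle X,Z\rangle\neq 0$. (3) It is a bialgebra pairing: with $\langle X\otimes Y,Z\otimes W\rangle=\langle X,Z\rangle\langle Y,W\rangle$, for all $X,Y\in \mathrm{Y}(\mathfrak{gl}_N)$ and $Z,W\in\mathrm{Y}^\ast(\mathfrak{gl}_N)$, $$\langle X,ZW\rangle=\langle\Delta(X),Z\otimes W\rangle,\quad\langle XY,Z\rangle=\langle X\otimes Y,\Delta(Z)\rangle,\quad\langle X,1\rangle=\varepsilon(X),\quad\langle 1,Z\rangle=\varepsilon(Z).$$ (4) Let $\mathrm{gr}_s\mathrm{Y}(\mathfrak{gl}_N)$ and $\mathrm{gr}_s\mathrm{Y}^\ast(\mathfrak{gl}_N)$, $s\ge 0$, be the graded components for the ascending filtration with $\deg T_{ij}^{(r)}=r$ and the descending filtration with $\deg T_{ij}^{(-r)}=r$ ($r\geq 1$), respectively. For every $s$ the pairing induces a unique well-defined bilinear pairing $\mathrm{gr}_s\mathrm{Y}(\mathfrak{gl}_N)\times\mathrm{gr}_s\mathrm{Y}^\ast(\mathfrak{gl}_N)\to\mathbb{C}$,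 and the induced pairing is non-degenerate. For each multiset of triples $(r_1,i_1,j_1),\dots,(r_m,i_m,j_m)$ with $r_a\ge1$ and $r_1+\dots+r_m=s$ choose any ordering with $r_1\ge\dots\ge r_m$. Then the images of the monomials $T_{i_1j_1}^{(r_1)}\cdots T_{i_mj_m}^{(r_m)}$ form a basis of $\mathrm{gr}_s\mathrm{Y}(\mathfrak{gl}_N)$, the images of the corresponding monomials $T_{j_1i_1}^{(-r_1)}\cdots T_{j_mi_m}^{(-r_m)}$ form a basis of $\mathrm{gr}_s\mathrm{Y}^\ast(\mathfrak{gl}_N)$, and the matrix of the induced pairing in these bases is lower triangular with non-zero diagonal entries, for any linear ordering of the multisets subordinate to the inverse lexicographical ordering of the partitions $(r_1,\dots,r_m)$ of $s$. (There, of two different partitions of $s$, the one with the smaller part comes first at the first place where they differ when both are read from the smallest part to the largest.) -/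

import Mathlib

open scoped TensorProduct

noncomputable section

/-! ## Matrices of formal series -/

/-- Coefficients of a product of matrices of series: if `t r i j` and `t' r i j` are the
coefficients at the `r`-th power of the variable of the entries of two `N × N` matrices of power
series, then `seriesMul t t' r i j` are those of the product of the two matrices. -/
def seriesMul {N : ℕ} {A : Type*} [Ring A] (t t' : ℕ → Fin N → Fin N → A) :
    ℕ → Fin N → Fin N → A :=
  fun r i j => ∑ k, ∑ p ∈ Finset.HasAntidiagonal.antidiagonal r, t p.1 i k * t' p.2 k j

/-- The coefficients of the series multiplied by the variable. -/
def seriesShift {N : ℕ} {A : Type*} [Ring A] (t : ℕ → Fin N → Fin N → A) :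
    ℕ → Fin N → Fin N → A
  | 0 => 0
  | r + 1 => t r

/-- The relations `(u - v) [T_ij(u), T_kl(v)] = T_kj(u) T_il(v) - T_kj(v) T_il(u)` for the series
`T_ij(u) = ∑ r, t r i j u⁻ʳ`, compared at `u⁻ʳ v⁻ˢ` (at the powers with `u¹` or `v¹` they hold
automatically when `t 0 i j = δ_ij`). -/
def IsYangianSeries {N : ℕ} {A : Type*} [Ring A] (t : ℕ → Fin N → Fin N → A) : Prop :=
  ∀ (r s : ℕ) (i j k l : Fin N),
    ⁅t (r + 1) i j, t s k l⁆ - ⁅t r i j, t (s + 1) k l⁆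
      = t r k j * t s i l - t s k j * t r i l

/-- The relations `(u - v) [T_ij(u), T_kl(v)] = T_il(u) T_kj(v) - T_il(v) T_kj(u)` for the series
`T_ij(v) = ∑ r, t r i j vʳ`, compared at `uʳ vˢ`. -/
def IsDualYangianSeries {N : ℕ} {A : Type*} [Ring A] (t : ℕ → Fin N → Fin N → A) : Prop :=
  ∀ (r s : ℕ) (i j k l : Fin N),
    ⁅seriesShift t r i j, t s k l⁆ - ⁅t r i j, seriesShift t s k l⁆
      = t r i l * t s k j - t s i l * t r k j

section SeriesLemmas

variable {N : ℕ} {A B : Type*} [Ring A] [Ring B]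

/-- The matrix of power series with given coefficients. -/
def seriesMatrix (t : ℕ → Fin N → Fin N → A) : Matrix (Fin N) (Fin N) (PowerSeries A) :=
  Matrix.of fun i j => PowerSeries.mk fun r => t r i j

theorem seriesMatrix_mul (t t' : ℕ → Fin N → Fin N → A) :
    seriesMatrix (seriesMul t t') = seriesMatrix t * seriesMatrix t' := by
  ext i j r
  simp [seriesMatrix, seriesMul, Matrix.mul_apply, PowerSeries.coeff_mul]

theorem seriesMatrix_injective {t t' : ℕ → Fin N → Fin N → A}
    (h : seriesMatrix t = seriesMatrix t') : t = t' := by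
  funext r i j
  have := congrArg (fun M => PowerSeries.coeff r (M i j)) h
  simpa [seriesMatrix] using this

theorem seriesMul_assoc (t t' t'' : ℕ → Fin N → Fin N → A) :
    seriesMul (seriesMul t t') t'' = seriesMul t (seriesMul t' t'') := by
  apply seriesMatrix_injective
  simp only [seriesMatrix_mul, Matrix.mul_assoc]

/-- The coefficients of the identity matrix. -/
def seriesOne : ℕ → Fin N → Fin N → A := fun r i j => if r = 0 ∧ i = j then 1 else 0

theorem seriesMatrix_one : seriesMatrix (seriesOne : ℕ → Fin N → Fin N → A) = 1 := by
  ext i j r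
  by_cases h : i = j <;> by_cases hr : r = 0 <;>
    simp [seriesMatrix, seriesOne, Matrix.one_apply, PowerSeries.coeff_one, h, hr]

theorem seriesMul_one (t : ℕ → Fin N → Fin N → A) : seriesMul t seriesOne = t := by
  apply seriesMatrix_injective
  simp [seriesMatrix_mul, seriesMatrix_one]

theorem one_seriesMul (t : ℕ → Fin N → Fin N → A) : seriesMul seriesOne t = t := by
  apply seriesMatrix_injective
  simp [seriesMatrix_mul, seriesMatrix_one]

theorem seriesMul_map {F : Type*} [FunLike F A B] [RingHomClass F A B] (f : F)
    (t t' : ℕ → Fin N → Fin N → A) (r : ℕ) (i j : Fin N) :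
    f (seriesMul t t' r i j)
      = seriesMul (fun r i j => f (t r i j)) (fun r i j => f (t' r i j)) r i j := by
  simp [seriesMul, map_sum, map_mul]

end SeriesLemmas

section TwoVariables

open PowerSeries

variable {N : ℕ} {A : Type*} [Ring A]

/-- The series in the first of two variables. -/
def fstVar (f : A⟦X⟧) : A⟦X⟧⟦X⟧ := C f

/-- The series in the second of two variables. -/
def sndVar (f : A⟦X⟧) : A⟦X⟧⟦X⟧ := PowerSeries.map C f

theorem coeff_fst_mul_snd (f g : A⟦X⟧) (r s : ℕ) :
    coeff r (coeff s (fstVar f * sndVar g)) = coeff r f * coeff s g := by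
  simp [fstVar, sndVar, coeff_C_mul, coeff_mul_C]

theorem coeff_snd_mul_fst (f g : A⟦X⟧) (r s : ℕ) :
    coeff r (coeff s (sndVar g * fstVar f)) = coeff s g * coeff r f := by
  simp [fstVar, sndVar, coeff_C_mul, coeff_mul_C]

theorem ext_two {f g : A⟦X⟧⟦X⟧} (h : ∀ r s, coeff r (coeff s f) = coeff r (coeff s g)) : f = g := by
  ext s r
  exact h r s

/-- The first variable. -/
def varFst : A⟦X⟧⟦X⟧ := C X

/-- The second variable. -/
def varSnd : A⟦X⟧⟦X⟧ := X

theorem commute_varFst (f : A⟦X⟧⟦X⟧) : Commute varFst f := by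
  apply PowerSeries.ext
  intro s
  simp only [varFst, coeff_C_mul, coeff_mul_C]
  exact (commute_X _).symm

theorem commute_varSnd (f : A⟦X⟧⟦X⟧) : Commute varSnd f := (commute_X f).symm

theorem coeff_varFst_zero (f : A⟦X⟧⟦X⟧) (s : ℕ) : coeff 0 (coeff s (varFst * f)) = 0 := by
  simp [varFst, coeff_C_mul]

theorem coeff_varFst_succ (f : A⟦X⟧⟦X⟧) (r s : ℕ) :
    coeff (r + 1) (coeff s (varFst * f)) = coeff r (coeff s f) := by
  simp [varFst, coeff_C_mul, coeff_succ_X_mul]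

theorem coeff_varSnd_zero (f : A⟦X⟧⟦X⟧) (r : ℕ) : coeff r (coeff 0 (varSnd * f)) = 0 := by
  simp [varSnd]

theorem coeff_varSnd_succ (f : A⟦X⟧⟦X⟧) (r s : ℕ) :
    coeff r (coeff (s + 1) (varSnd * f)) = coeff r (coeff s f) := by
  simp [varSnd, coeff_succ_X_mul]

theorem isYangianSeries_iff {t : ℕ → Fin N → Fin N → A}
    (h0 : ∀ i j, t 0 i j = if i = j then 1 else 0) :
    IsYangianSeries t ↔ ∀ i j k l,
      (varSnd - varFst) * (fstVar (seriesMatrix t i j) * sndVar (seriesMatrix t k l)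
          - sndVar (seriesMatrix t k l) * fstVar (seriesMatrix t i j))
        = varFst * varSnd * (fstVar (seriesMatrix t k j) * sndVar (seriesMatrix t i l)
          - sndVar (seriesMatrix t k j) * fstVar (seriesMatrix t i l)) := by
  constructor
  · intro h i j k l
    apply ext_two
    intro r s
    rcases r with _ | r <;> rcases s with _ | s
    · simp [-coeff_zero_eq_constantCoeff, sub_mul, mul_assoc, coeff_varFst_zero, coeff_varSnd_zero]
    · simp [-coeff_zero_eq_constantCoeff, sub_mul, mul_assoc, coeff_varFst_zero, coeff_varSnd_succ, coeff_fst_mul_snd,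
        coeff_snd_mul_fst, seriesMatrix, h0]
    · simp [-coeff_zero_eq_constantCoeff, sub_mul, mul_assoc, coeff_varFst_succ, coeff_varSnd_zero, coeff_fst_mul_snd,
        coeff_snd_mul_fst, seriesMatrix, h0]
    · have := h r s i j k l
      simpa [-coeff_zero_eq_constantCoeff, sub_mul, mul_assoc, coeff_varFst_succ, coeff_varSnd_succ, coeff_fst_mul_snd,
        coeff_snd_mul_fst, seriesMatrix, Ring.lie_def] using this
  · intro h r s i j k l
    have := congrArg (fun f => coeff (r + 1) (coeff (s + 1) f)) (h i j k l)
    simpa [-coeff_zero_eq_constantCoeff, sub_mul, mul_assoc, coeff_varFst_succ, coeff_varSnd_succ, coeff_fst_mul_snd,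
      coeff_snd_mul_fst, seriesMatrix, Ring.lie_def] using this

theorem isDualYangianSeries_iff {t : ℕ → Fin N → Fin N → A} :
    IsDualYangianSeries t ↔ ∀ i j k l,
      (varFst - varSnd) * (fstVar (seriesMatrix t i j) * sndVar (seriesMatrix t k l)
          - sndVar (seriesMatrix t k l) * fstVar (seriesMatrix t i j))
        = fstVar (seriesMatrix t i l) * sndVar (seriesMatrix t k j)
          - sndVar (seriesMatrix t i l) * fstVar (seriesMatrix t k j) := by
  have key : ∀ r s i j k l, coeff r (coeff s ((varFst - varSnd) *
      (fstVar (seriesMatrix t i j) * sndVar (seriesMatrix t k l)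
          - sndVar (seriesMatrix t k l) * fstVar (seriesMatrix t i j))))
        = ⁅seriesShift t r i j, t s k l⁆ - ⁅t r i j, seriesShift t s k l⁆ := by
    intro r s i j k l
    rcases r with _ | r <;> rcases s with _ | s <;>
    simp [-coeff_zero_eq_constantCoeff, sub_mul, coeff_varFst_zero, coeff_varSnd_zero, coeff_varFst_succ, coeff_varSnd_succ,
      coeff_fst_mul_snd, coeff_snd_mul_fst, seriesMatrix, seriesShift, Ring.lie_def]
  constructor
  · intro h i j k l
    apply ext_two
    intro r s
    rw [key, h]
    simp [coeff_fst_mul_snd, coeff_snd_mul_fst, seriesMatrix]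
  · intro h r s i j k l
    rw [← key, h]
    simp [coeff_fst_mul_snd, coeff_snd_mul_fst, seriesMatrix]

end TwoVariables

section Products

variable {N : ℕ}

theorem relation_mul {B : Type*} [Ring B] {w c : B} (hw : ∀ x, Commute w x)
    (hc : ∀ x, Commute c x) {a b a' b' : Fin N → Fin N → B}
    (h : ∀ i j k l, w * (a i j * b k l - b k l * a i j) = c * (a k j * b i l - b k j * a i l))
    (h' : ∀ i j k l,
      w * (a' i j * b' k l - b' k l * a' i j) = c * (a' k j * b' i l - b' k j * a' i l))
    (hab : ∀ i j k l, Commute (a' i j) (b k l)) (hba : ∀ i j k l, Commute (b' i j) (a k l))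
    (i j k l : Fin N) :
    w * ((∑ p, a i p * a' p j) * (∑ q, b k q * b' q l)
        - (∑ q, b k q * b' q l) * (∑ p, a i p * a' p j))
      = c * ((∑ p, a k p * a' p j) * (∑ q, b i q * b' q l)
        - (∑ p, b k p * b' p j) * (∑ q, a i q * a' q l)) := by
  have e1 : ∀ p q, w * (a i p * a' p j * (b k q * b' q l) - b k q * b' q l * (a i p * a' p j))
      = c * (a k p * a' p j * (b i q * b' q l)) - c * (b k p * a i q * (a' p j * b' q l))
        + (c * (b k q * a i p * (a' q j * b' p l)) - c * (b k q * b' q j * (a i p * a' p l))) := by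
    intro p q
    have s1 : a i p * a' p j * (b k q * b' q l) = a i p * b k q * (a' p j * b' q l) := by
      rw [mul_assoc, ← mul_assoc (a' p j), (hab p j k q).eq]; simp only [mul_assoc]
    have s2 : b k q * b' q l * (a i p * a' p j) = b k q * a i p * (b' q l * a' p j) := by
      rw [mul_assoc, ← mul_assoc (b' q l), (hba q l i p).eq]; simp only [mul_assoc]
    have s3 : a k p * a' p j * (b i q * b' q l) = a k p * b i q * (a' p j * b' q l) := by
      rw [mul_assoc, ← mul_assoc (a' p j), (hab p j i q).eq]; simp only [mul_assoc]
    have s4 : b k q * b' q j * (a i p * a' p l) = b k q * a i p * (b' q j * a' p l) := by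
      rw [mul_assoc, ← mul_assoc (b' q j), (hba q j i p).eq]; simp only [mul_assoc]
    rw [s1, s2, s3, s4]
    have t1 := congrArg (· * (a' p j * b' q l)) (h i p k q)
    have t2 := congrArg (b k q * a i p * ·) (h' p j q l)
    simp only [← mul_assoc] at t2
    rw [← (hw (b k q * a i p)).eq, ← (hc (b k q * a i p)).eq] at t2
    simp only [sub_mul, mul_sub, mul_assoc] at t1 t2 ⊢
    rw [← sub_add_sub_cancel _ (w * (b k q * (a i p * (a' p j * b' q l)))) _, t1, t2]
  have e2 : w * ((∑ p, a i p * a' p j) * (∑ q, b k q * b' q l)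
        - (∑ q, b k q * b' q l) * (∑ p, a i p * a' p j))
      = ∑ p, ∑ q,
        w * (a i p * a' p j * (b k q * b' q l) - b k q * b' q l * (a i p * a' p j)) := by
    rw [Finset.sum_mul_sum, Finset.sum_mul_sum, Finset.sum_comm (γ := Fin N)
      (f := fun q p => b k q * b' q l * (a i p * a' p j))]
    simp only [← Finset.sum_sub_distrib, Finset.mul_sum]
  rw [e2]
  simp only [e1, Finset.sum_add_distrib, Finset.sum_sub_distrib, mul_sub]
  rw [Finset.sum_mul_sum, Finset.sum_mul_sum]
  simp only [Finset.mul_sum]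
  rw [Finset.sum_comm (f := fun p q => c * (b k q * a i p * (a' q j * b' p l))),
    Finset.sum_comm (f := fun p q => c * (b k q * b' q j * (a i p * a' p l)))]
  abel

theorem dualRelation_mul {B : Type*} [Ring B] {w : B} (hw : ∀ x, Commute w x)
    {a b a' b' : Fin N → Fin N → B}
    (h : ∀ i j k l, w * (a i j * b k l - b k l * a i j) = a i l * b k j - b i l * a k j)
    (h' : ∀ i j k l,
      w * (a' i j * b' k l - b' k l * a' i j) = a' i l * b' k j - b' i l * a' k j)
    (hab : ∀ i j k l, Commute (a' i j) (b k l)) (hba : ∀ i j k l, Commute (b' i j) (a k l))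
    (i j k l : Fin N) :
    w * ((∑ p, a i p * a' p j) * (∑ q, b k q * b' q l)
        - (∑ q, b k q * b' q l) * (∑ p, a i p * a' p j))
      = (∑ p, a i p * a' p l) * (∑ q, b k q * b' q j)
        - (∑ p, b i p * b' p l) * (∑ q, a k q * a' q j) := by
  have e1 : ∀ p q, w * (a i p * a' p j * (b k q * b' q l) - b k q * b' q l * (a i p * a' p j))
      = a i p * a' p l * (b k q * b' q j) - a i p * b k q * (b' p l * a' q j)
        + (a i q * b k p * (b' q l * a' p j) - b i q * b' q l * (a k p * a' p j)) := by
    intro p q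
    have s1 : a i p * a' p j * (b k q * b' q l) = a i p * b k q * (a' p j * b' q l) := by
      rw [mul_assoc, ← mul_assoc (a' p j), (hab p j k q).eq]; simp only [mul_assoc]
    have s2 : b k q * b' q l * (a i p * a' p j) = b k q * a i p * (b' q l * a' p j) := by
      rw [mul_assoc, ← mul_assoc (b' q l), (hba q l i p).eq]; simp only [mul_assoc]
    have s3 : a i p * a' p l * (b k q * b' q j) = a i p * b k q * (a' p l * b' q j) := by
      rw [mul_assoc, ← mul_assoc (a' p l), (hab p l k q).eq]; simp only [mul_assoc]
    have s4 : b i q * b' q l * (a k p * a' p j) = b i q * a k p * (b' q l * a' p j) := by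
      rw [mul_assoc, ← mul_assoc (b' q l), (hba q l k p).eq]; simp only [mul_assoc]
    rw [s1, s2, s3, s4]
    have t1 := congrArg (· * (b' q l * a' p j)) (h i p k q)
    have t2 := congrArg (a i p * b k q * ·) (h' p j q l)
    simp only [← mul_assoc] at t2
    rw [← (hw (a i p * b k q)).eq] at t2
    simp only [sub_mul, mul_sub, mul_assoc] at t1 t2 ⊢
    rw [← sub_add_sub_cancel _ (w * (a i p * (b k q * (b' q l * a' p j)))) _, t1, t2]
  have e2 : w * ((∑ p, a i p * a' p j) * (∑ q, b k q * b' q l)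
        - (∑ q, b k q * b' q l) * (∑ p, a i p * a' p j))
      = ∑ p, ∑ q,
        w * (a i p * a' p j * (b k q * b' q l) - b k q * b' q l * (a i p * a' p j)) := by
    rw [Finset.sum_mul_sum, Finset.sum_mul_sum, Finset.sum_comm (γ := Fin N)
      (f := fun q p => b k q * b' q l * (a i p * a' p j))]
    simp only [← Finset.sum_sub_distrib, Finset.mul_sum]
  rw [e2]
  simp only [e1, Finset.sum_add_distrib, Finset.sum_sub_distrib]
  rw [Finset.sum_mul_sum, Finset.sum_mul_sum]
  rw [Finset.sum_comm (f := fun p q => a i q * b k p * (b' q l * a' p j)),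
    Finset.sum_comm (f := fun p q => b i q * b' q l * (a k p * a' p j))]
  abel

variable {A : Type*} [Ring A] {t t' : ℕ → Fin N → Fin N → A}

theorem commute_fst_snd (hcomm : ∀ r s i j k l, Commute (t r i j) (t' s k l)) (i j k l : Fin N) :
    Commute (fstVar (seriesMatrix t' i j)) (sndVar (seriesMatrix t k l)) := by
  apply ext_two
  intro r s
  rw [coeff_fst_mul_snd, coeff_snd_mul_fst]
  simpa [seriesMatrix] using (hcomm s r k l i j).symm.eq

theorem commute_snd_fst (hcomm : ∀ r s i j k l, Commute (t r i j) (t' s k l)) (i j k l : Fin N) :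
    Commute (sndVar (seriesMatrix t' i j)) (fstVar (seriesMatrix t k l)) := by
  apply ext_two
  intro r s
  rw [coeff_fst_mul_snd, coeff_snd_mul_fst]
  simpa [seriesMatrix] using (hcomm r s k l i j).symm.eq

theorem fstVar_seriesMul (i j : Fin N) : fstVar (seriesMatrix (seriesMul t t') i j)
    = ∑ p, fstVar (seriesMatrix t i p) * fstVar (seriesMatrix t' p j) := by
  rw [seriesMatrix_mul, Matrix.mul_apply]
  simp [fstVar, map_sum]

theorem sndVar_seriesMul (i j : Fin N) : sndVar (seriesMatrix (seriesMul t t') i j)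
    = ∑ p, sndVar (seriesMatrix t i p) * sndVar (seriesMatrix t' p j) := by
  rw [seriesMatrix_mul, Matrix.mul_apply]
  simp [sndVar, map_sum]

theorem seriesMul_zero_eq (h0 : ∀ i j, t 0 i j = if i = j then 1 else 0)
    (h0' : ∀ i j, t' 0 i j = if i = j then 1 else 0) (i j : Fin N) :
    seriesMul t t' 0 i j = if i = j then 1 else 0 := by
  simp [seriesMul, h0, h0']

theorem IsYangianSeries.seriesMul (ht : IsYangianSeries t) (ht' : IsYangianSeries t')
    (h0 : ∀ i j, t 0 i j = if i = j then 1 else 0)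
    (h0' : ∀ i j, t' 0 i j = if i = j then 1 else 0)
    (hcomm : ∀ r s i j k l, Commute (t r i j) (t' s k l)) :
    IsYangianSeries (seriesMul t t') := by
  rw [isYangianSeries_iff (seriesMul_zero_eq h0 h0')]
  rw [isYangianSeries_iff h0] at ht
  rw [isYangianSeries_iff h0'] at ht'
  intro i j k l
  simp only [fstVar_seriesMul, sndVar_seriesMul]
  exact relation_mul (fun x => (commute_varSnd x).sub_left (commute_varFst x))
    (fun x => (commute_varFst x).mul_left (commute_varSnd x))
    (a := fun i j => fstVar (seriesMatrix t i j)) (b := fun i j => sndVar (seriesMatrix t i j))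
    (a' := fun i j => fstVar (seriesMatrix t' i j)) (b' := fun i j => sndVar (seriesMatrix t' i j))
    ht ht' (commute_fst_snd hcomm) (commute_snd_fst hcomm) i j k l

theorem IsDualYangianSeries.seriesMul (ht : IsDualYangianSeries t) (ht' : IsDualYangianSeries t')
    (hcomm : ∀ r s i j k l, Commute (t r i j) (t' s k l)) :
    IsDualYangianSeries (seriesMul t t') := by
  rw [isDualYangianSeries_iff] at ht ht' ⊢
  intro i j k l
  simp only [fstVar_seriesMul, sndVar_seriesMul]
  exact dualRelation_mul (fun x => (commute_varFst x).sub_left (commute_varSnd x))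
    (a := fun i j => fstVar (seriesMatrix t i j)) (b := fun i j => sndVar (seriesMatrix t i j))
    (a' := fun i j => fstVar (seriesMatrix t' i j)) (b' := fun i j => sndVar (seriesMatrix t' i j))
    ht ht' (commute_fst_snd hcomm) (commute_snd_fst hcomm) i j k l

end Products

section Coalgebra

variable {N : ℕ} {A : Type*} [Ring A] [Algebra ℂ A] {t : ℕ → Fin N → Fin N → A}
  {Δ : A →ₐ[ℂ] A ⊗[ℂ] A} {ε : A →ₐ[ℂ] ℂ}

theorem coassoc_series
    (hΔ : ∀ r i j, Δ (t r i j)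
      = seriesMul (fun r i j => t r i j ⊗ₜ[ℂ] (1 : A)) (fun r i j => (1 : A) ⊗ₜ[ℂ] t r i j) r i j)
    (r : ℕ) (i j : Fin N) :
    (Algebra.TensorProduct.assoc ℂ ℂ ℂ A A A).toAlgHom.comp
      ((Algebra.TensorProduct.map Δ (.id ℂ A)).comp Δ) (t r i j)
      = (Algebra.TensorProduct.map (.id ℂ A) Δ).comp Δ (t r i j) := by
  let a : ℕ → Fin N → Fin N → A ⊗[ℂ] (A ⊗[ℂ] A) :=
    fun r i j => t r i j ⊗ₜ[ℂ] ((1 : A) ⊗ₜ[ℂ] (1 : A))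
  let b : ℕ → Fin N → Fin N → A ⊗[ℂ] (A ⊗[ℂ] A) :=
    fun r i j => (1 : A) ⊗ₜ[ℂ] (t r i j ⊗ₜ[ℂ] (1 : A))
  let c : ℕ → Fin N → Fin N → A ⊗[ℂ] (A ⊗[ℂ] A) :=
    fun r i j => (1 : A) ⊗ₜ[ℂ] ((1 : A) ⊗ₜ[ℂ] t r i j)
  let F : A ⊗[ℂ] A →ₐ[ℂ] A ⊗[ℂ] (A ⊗[ℂ] A) :=
    (Algebra.TensorProduct.assoc ℂ ℂ ℂ A A A).toAlgHom.comp
      (Algebra.TensorProduct.map Δ (.id ℂ A))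
  let G : A ⊗[ℂ] A →ₐ[ℂ] A ⊗[ℂ] (A ⊗[ℂ] A) := Algebra.TensorProduct.map (.id ℂ A) Δ
  have F1 : (fun r i j => F (t r i j ⊗ₜ[ℂ] (1 : A))) = seriesMul a b := by
    funext r i j
    have := seriesMul_map ((Algebra.TensorProduct.assoc ℂ ℂ ℂ A A A).toAlgHom.comp
      (Algebra.TensorProduct.includeLeft (R := ℂ) (S := ℂ) (A := A ⊗[ℂ] A) (B := A)))
      (fun r i j => t r i j ⊗ₜ[ℂ] (1 : A)) (fun r i j => (1 : A) ⊗ₜ[ℂ] t r i j) r i j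
    rw [← hΔ] at this
    simpa [F, a, b] using this
  have F2 : (fun r i j => F ((1 : A) ⊗ₜ[ℂ] t r i j)) = c := by
    funext r i j
    simp [F, c, Algebra.TensorProduct.one_def]
  have G1 : (fun r i j => G (t r i j ⊗ₜ[ℂ] (1 : A))) = a := by
    funext r i j
    simp [G, a, Algebra.TensorProduct.one_def]
  have G2 : (fun r i j => G ((1 : A) ⊗ₜ[ℂ] t r i j)) = seriesMul b c := by
    funext r i j
    have := seriesMul_map (Algebra.TensorProduct.includeRight (R := ℂ) (A := A) (B := A ⊗[ℂ] A))
      (fun r i j => t r i j ⊗ₜ[ℂ] (1 : A)) (fun r i j => (1 : A) ⊗ₜ[ℂ] t r i j) r i j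
    rw [← hΔ] at this
    simpa [G, b, c] using this
  change F (Δ (t r i j)) = G (Δ (t r i j))
  rw [hΔ, seriesMul_map, seriesMul_map, F1, F2, G1, G2, seriesMul_assoc]

theorem rTensor_series
    (hΔ : ∀ r i j, Δ (t r i j)
      = seriesMul (fun r i j => t r i j ⊗ₜ[ℂ] (1 : A)) (fun r i j => (1 : A) ⊗ₜ[ℂ] t r i j) r i j)
    (hε : ∀ r i j, ε (t r i j) = seriesOne r i j) (r : ℕ) (i j : Fin N) :
    (Algebra.TensorProduct.map ε (.id ℂ A)).comp Δ (t r i j)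
      = ((Algebra.TensorProduct.lid ℂ A).symm : A →ₐ[ℂ] ℂ ⊗[ℂ] A) (t r i j) := by
  have e : (fun r i j => Algebra.TensorProduct.map ε (.id ℂ A) (t r i j ⊗ₜ[ℂ] (1 : A)))
      = seriesOne := by
    funext r i j
    by_cases h : r = 0 ∧ i = j <;> simp [hε, seriesOne, h, Algebra.TensorProduct.one_def]
  rw [AlgHom.comp_apply, hΔ, seriesMul_map, e, one_seriesMul]
  simp

theorem lTensor_series
    (hΔ : ∀ r i j, Δ (t r i j)
      = seriesMul (fun r i j => t r i j ⊗ₜ[ℂ] (1 : A)) (fun r i j => (1 : A) ⊗ₜ[ℂ] t r i j) r i j)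
    (hε : ∀ r i j, ε (t r i j) = seriesOne r i j) (r : ℕ) (i j : Fin N) :
    (Algebra.TensorProduct.map (.id ℂ A) ε).comp Δ (t r i j)
      = ((Algebra.TensorProduct.rid ℂ ℂ A).symm : A →ₐ[ℂ] A ⊗[ℂ] ℂ) (t r i j) := by
  have e : (fun r i j => Algebra.TensorProduct.map (.id ℂ A) ε ((1 : A) ⊗ₜ[ℂ] t r i j))
      = seriesOne := by
    funext r i j
    by_cases h : r = 0 ∧ i = j <;> simp [hε, seriesOne, h, Algebra.TensorProduct.one_def]
  rw [AlgHom.comp_apply, hΔ, seriesMul_map, e, seriesMul_one]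
  simp

end Coalgebra

/-! ## The Yangian -/

/-- The index set of the generators: `(r, i, j)` with `r ≥ 1` stands for `T_ij^(r)` in the Yangian
and for `T_ij^(-r)` in the dual Yangian. -/
abbrev GenIndex (N : ℕ) : Type := ℕ+ × Fin N × Fin N

/-- `T_ij^(r)` in the free algebra, with `T_ij^(0) = δ_ij`. -/
def Yangian.freeT {N : ℕ} (r : ℕ) (i j : Fin N) : FreeAlgebra ℂ (GenIndex N) :=
  if h : 0 < r then FreeAlgebra.ι ℂ (⟨r, h⟩, i, j) else if i = j then 1 else 0

/-- The defining relations
`[T_ij^(r+1), T_kl^(s)] - [T_ij^(r), T_kl^(s+1)] = T_kj^(r) T_il^(s) - T_kj^(s) T_il^(r)`,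
`r, s ≥ 0`. -/
inductive Yangian.Rel (N : ℕ) : FreeAlgebra ℂ (GenIndex N) → FreeAlgebra ℂ (GenIndex N) → Prop
  | mk (r s : ℕ) (i j k l : Fin N) : Yangian.Rel N
      (⁅Yangian.freeT (r + 1) i j, Yangian.freeT s k l⁆
        - ⁅Yangian.freeT r i j, Yangian.freeT (s + 1) k l⁆)
      (Yangian.freeT r k j * Yangian.freeT s i l - Yangian.freeT s k j * Yangian.freeT r i l)

/-- The Yangian `Y(gl_N)` over `ℂ`. -/
def Yangian (N : ℕ) : Type := RingQuot (Yangian.Rel N)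

namespace Yangian

variable {N : ℕ}

instance : Ring (Yangian N) := inferInstanceAs (Ring (RingQuot (Rel N)))

instance : Algebra ℂ (Yangian N) := inferInstanceAs (Algebra ℂ (RingQuot (Rel N)))

/-- The projection from the free algebra. -/
def proj (N : ℕ) : FreeAlgebra ℂ (GenIndex N) →ₐ[ℂ] Yangian N := RingQuot.mkAlgHom ℂ (Rel N)

/-- The element `T_ij^(r)` of `Y(gl_N)`, `r ≥ 0`, where `T_ij^(0) = δ_ij`; it is the coefficient
at `u⁻ʳ` of the series `T_ij(u)`. -/
def T (r : ℕ) (i j : Fin N) : Yangian N := proj N (freeT r i j)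

theorem proj_rel {x y : FreeAlgebra ℂ (GenIndex N)} (h : Rel N x y) : proj N x = proj N y :=
  RingQuot.mkAlgHom_rel ℂ h

theorem T_zero (i j : Fin N) : (T 0 i j : Yangian N) = if i = j then 1 else 0 := by
  by_cases h : i = j <;> simp [T, freeT, h]

theorem T_isYangianSeries : IsYangianSeries (T : ℕ → Fin N → Fin N → Yangian N) := by
  intro r s i j k l
  simpa only [T, Ring.lie_def, map_sub, map_mul] using proj_rel (Rel.mk (N := N) r s i j k l)

section Lift

variable {A : Type*} [Ring A] [Algebra ℂ A]

theorem lift_freeT (t : ℕ → Fin N → Fin N → A) (h0 : ∀ i j, t 0 i j = if i = j then 1 else 0)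
    (r : ℕ) (i j : Fin N) :
    FreeAlgebra.lift ℂ (fun g : GenIndex N => t g.1 g.2.1 g.2.2) (freeT r i j) = t r i j := by
  rcases Nat.eq_zero_or_pos r with rfl | hr
  · by_cases h : i = j <;> simp [freeT, h0, h]
  · simp [freeT, hr]

/-- The homomorphism `T_ij^(r) ↦ t r i j`. -/
def lift (t : ℕ → Fin N → Fin N → A) (h0 : ∀ i j, t 0 i j = if i = j then 1 else 0)
    (ht : IsYangianSeries t) : Yangian N →ₐ[ℂ] A :=
  RingQuot.liftAlgHom ℂ ⟨FreeAlgebra.lift ℂ fun g : GenIndex N => t g.1 g.2.1 g.2.2, by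
    rintro _ _ ⟨r, s, i, j, k, l⟩
    simpa only [map_sub, map_mul, Ring.lie_def, lift_freeT t h0] using ht r s i j k l⟩

theorem lift_T (t : ℕ → Fin N → Fin N → A) (h0 : ∀ i j, t 0 i j = if i = j then 1 else 0)
    (ht : IsYangianSeries t) (r : ℕ) (i j : Fin N) : lift t h0 ht (T r i j) = t r i j := by
  rw [← lift_freeT t h0 r i j]
  exact RingQuot.liftAlgHom_mkAlgHom_apply ℂ _ _ _

theorem algHom_ext {f g : Yangian N →ₐ[ℂ] A} (h : ∀ r i j, f (T r i j) = g (T r i j)) :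
    f = g := by
  have : f.comp (proj N) = g.comp (proj N) := by
    apply FreeAlgebra.hom_ext
    funext ⟨⟨r, hr⟩, i, j⟩
    simpa [T, freeT, hr] using h r i j
  exact RingQuot.ringQuot_ext' ℂ f g this

end Lift

/-- The comultiplication `T_ij(u) ↦ ∑ k, T_ik(u) ⊗ T_kj(u)`, that is
`T_ij^(r) ↦ ∑ k, ∑ a + b = r, T_ik^(a) ⊗ T_kj^(b)`. -/
def comulHom (N : ℕ) : Yangian N →ₐ[ℂ] Yangian N ⊗[ℂ] Yangian N :=
  lift (seriesMul (fun r i j => T r i j ⊗ₜ[ℂ] 1) (fun r i j => 1 ⊗ₜ[ℂ] T r i j))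
    (seriesMul_zero_eq
      (fun i j => by by_cases h : i = j <;> simp [T_zero, h, Algebra.TensorProduct.one_def])
      (fun i j => by by_cases h : i = j <;> simp [T_zero, h, Algebra.TensorProduct.one_def]))
    (IsYangianSeries.seriesMul
      (fun r s i j k l => by
        have := congrArg (Algebra.TensorProduct.includeLeft (R := ℂ) (S := ℂ) (B := Yangian N))
          (T_isYangianSeries (N := N) r s i j k l)
        simpa only [Ring.lie_def, map_sub, map_mul,
          Algebra.TensorProduct.includeLeft_apply] using this)
      (fun r s i j k l => by
        have := congrArg (Algebra.TensorProduct.includeRight (R := ℂ) (A := Yangian N))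
          (T_isYangianSeries (N := N) r s i j k l)
        simpa only [Ring.lie_def, map_sub, map_mul,
          Algebra.TensorProduct.includeRight_apply] using this)
      (fun i j => by by_cases h : i = j <;> simp [T_zero, h, Algebra.TensorProduct.one_def])
      (fun i j => by by_cases h : i = j <;> simp [T_zero, h, Algebra.TensorProduct.one_def])
      (fun r s i j k l => by simp [Commute, SemiconjBy]))

/-- The counit `T_ij(u) ↦ δ_ij`. -/
def counitHom (N : ℕ) : Yangian N →ₐ[ℂ] ℂ :=
  lift seriesOne (fun i j => by simp [seriesOne])
    (fun r s i j k l => by simp [seriesOne, Ring.lie_def, mul_comm]; grind)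

theorem comulHom_T (r : ℕ) (i j : Fin N) : comulHom N (T r i j)
    = seriesMul (fun r i j => T r i j ⊗ₜ[ℂ] 1) (fun r i j => 1 ⊗ₜ[ℂ] T r i j) r i j :=
  lift_T _ _ _ r i j

theorem counitHom_T (r : ℕ) (i j : Fin N) : counitHom N (T r i j) = seriesOne r i j :=
  lift_T _ _ _ r i j

instance : Bialgebra ℂ (Yangian N) :=
  Bialgebra.ofAlgHom (comulHom N) (counitHom N)
    (algHom_ext (coassoc_series comulHom_T))
    (algHom_ext (rTensor_series comulHom_T counitHom_T))
    (algHom_ext (lTensor_series comulHom_T counitHom_T))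

end Yangian

/-! ## The dual Yangian -/

/-- The coefficient at `vʳ` of `T*_ij(v) = δ_ij + T_ij^(-1) + T_ij^(-2) v + T_ij^(-3) v² + ⋯`
in the free algebra. -/
def DualYangian.freeS {N : ℕ} (r : ℕ) (i j : Fin N) : FreeAlgebra ℂ (GenIndex N) :=
  (if r = 0 ∧ i = j then 1 else 0) + FreeAlgebra.ι ℂ (r.succPNat, i, j)

/-- The defining relations
`(u - v) [T*_ij(u), T*_kl(v)] = T*_il(u) T*_kj(v) - T*_il(v) T*_kj(u)`, that is
`T*_1(u) T*_2(v) R(u - v) = R(u - v) T*_2(v) T*_1(u)` multiplied by `u - v`, compared at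
`uʳ vˢ`. -/
inductive DualYangian.Rel (N : ℕ) :
    FreeAlgebra ℂ (GenIndex N) → FreeAlgebra ℂ (GenIndex N) → Prop
  | mk (r s : ℕ) (i j k l : Fin N) : DualYangian.Rel N
      (⁅seriesShift DualYangian.freeS r i j, DualYangian.freeS s k l⁆
        - ⁅DualYangian.freeS r i j, seriesShift DualYangian.freeS s k l⁆)
      (DualYangian.freeS r i l * DualYangian.freeS s k j
        - DualYangian.freeS s i l * DualYangian.freeS r k j)

/-- The dual Yangian `Y*(gl_N)` over `ℂ`. -/
def DualYangian (N : ℕ) : Type := RingQuot (DualYangian.Rel N)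

namespace DualYangian

variable {N : ℕ}

instance : Ring (DualYangian N) := inferInstanceAs (Ring (RingQuot (Rel N)))

instance : Algebra ℂ (DualYangian N) := inferInstanceAs (Algebra ℂ (RingQuot (Rel N)))

/-- The projection from the free algebra. -/
def proj (N : ℕ) : FreeAlgebra ℂ (GenIndex N) →ₐ[ℂ] DualYangian N := RingQuot.mkAlgHom ℂ (Rel N)

/-- The generator `T_ij^(-r)` of `Y*(gl_N)`, `r ≥ 1`. -/
def T (r : ℕ+) (i j : Fin N) : DualYangian N := proj N (FreeAlgebra.ι ℂ (r, i, j))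

/-- The coefficient at `vʳ` of `T*_ij(v) = δ_ij + T_ij^(-1) + T_ij^(-2) v + ⋯`. -/
def S (r : ℕ) (i j : Fin N) : DualYangian N :=
  (if r = 0 ∧ i = j then 1 else 0) + T r.succPNat i j

theorem proj_freeS (r : ℕ) (i j : Fin N) : proj N (freeS r i j) = S r i j := by
  by_cases h : r = 0 ∧ i = j <;> simp [freeS, S, T, h]

theorem proj_rel {x y : FreeAlgebra ℂ (GenIndex N)} (h : Rel N x y) : proj N x = proj N y :=
  RingQuot.mkAlgHom_rel ℂ h

theorem map_seriesShift {A B F : Type*} [Ring A] [Ring B] [FunLike F A B] [RingHomClass F A B]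
    (f : F) (t : ℕ → Fin N → Fin N → A) (r : ℕ) (i j : Fin N) :
    f (seriesShift t r i j) = seriesShift (fun r i j => f (t r i j)) r i j := by
  cases r <;> simp [seriesShift]

theorem S_isDualYangianSeries :
    IsDualYangianSeries (S : ℕ → Fin N → Fin N → DualYangian N) := by
  intro r s i j k l
  simpa only [Ring.lie_def, map_sub, map_mul, map_seriesShift, proj_freeS]
    using proj_rel (Rel.mk (N := N) r s i j k l)

section Lift

variable {A : Type*} [Ring A] [Algebra ℂ A]

theorem lift_freeS (t : ℕ → Fin N → Fin N → A) (r : ℕ) (i j : Fin N) :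
    FreeAlgebra.lift ℂ (fun g : GenIndex N =>
      t (g.1.natPred) g.2.1 g.2.2 - seriesOne g.1.natPred g.2.1 g.2.2) (freeS r i j)
      = t r i j := by
  by_cases h : r = 0 ∧ i = j <;> simp [freeS, seriesOne, h]

/-- The homomorphism `S r i j ↦ t r i j`. -/
def lift (t : ℕ → Fin N → Fin N → A) (ht : IsDualYangianSeries t) : DualYangian N →ₐ[ℂ] A :=
  RingQuot.liftAlgHom ℂ ⟨FreeAlgebra.lift ℂ fun g : GenIndex N =>
      t (g.1.natPred) g.2.1 g.2.2 - seriesOne g.1.natPred g.2.1 g.2.2, by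
    rintro _ _ ⟨r, s, i, j, k, l⟩
    simpa only [map_sub, map_mul, Ring.lie_def, map_seriesShift, lift_freeS t]
      using ht r s i j k l⟩

theorem lift_S (t : ℕ → Fin N → Fin N → A) (ht : IsDualYangianSeries t) (r : ℕ) (i j : Fin N) :
    lift t ht (S r i j) = t r i j := by
  rw [← lift_freeS t r i j, ← proj_freeS]
  exact RingQuot.liftAlgHom_mkAlgHom_apply ℂ _ _ _

theorem algHom_ext {f g : DualYangian N →ₐ[ℂ] A} (h : ∀ r i j, f (S r i j) = g (S r i j)) :
    f = g := by
  have : f.comp (proj N) = g.comp (proj N) := by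
    apply FreeAlgebra.hom_ext
    funext ⟨r, i, j⟩
    obtain ⟨r, rfl⟩ : ∃ q : ℕ, r = q.succPNat := ⟨r.natPred, (PNat.succPNat_natPred r).symm⟩
    have := h r i j
    by_cases h' : r = 0 ∧ i = j <;> simpa [S, T, h'] using this
  exact RingQuot.ringQuot_ext' ℂ f g this

end Lift

/-- The comultiplication `T*_ij(v) ↦ ∑ k, T*_ik(v) ⊗ T*_kj(v)`. -/
def comulHom (N : ℕ) : DualYangian N →ₐ[ℂ] DualYangian N ⊗[ℂ] DualYangian N :=
  lift (seriesMul (fun r i j => S r i j ⊗ₜ[ℂ] 1) (fun r i j => 1 ⊗ₜ[ℂ] S r i j))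
    (IsDualYangianSeries.seriesMul
      (fun r s i j k l => by
        have := congrArg (Algebra.TensorProduct.includeLeft (R := ℂ) (S := ℂ) (B := DualYangian N))
          (S_isDualYangianSeries (N := N) r s i j k l)
        simpa only [Ring.lie_def, map_sub, map_mul, map_seriesShift,
          Algebra.TensorProduct.includeLeft_apply] using this)
      (fun r s i j k l => by
        have := congrArg (Algebra.TensorProduct.includeRight (R := ℂ) (A := DualYangian N))
          (S_isDualYangianSeries (N := N) r s i j k l)
        simpa only [Ring.lie_def, map_sub, map_mul, map_seriesShift,
          Algebra.TensorProduct.includeRight_apply] using this)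
      (fun r s i j k l => by simp [Commute, SemiconjBy]))

/-- The counit `T*_ij(v) ↦ δ_ij`. -/
def counitHom (N : ℕ) : DualYangian N →ₐ[ℂ] ℂ :=
  lift seriesOne (fun r s i j k l => by
    cases r <;> cases s <;> simp [seriesOne, seriesShift, Ring.lie_def, mul_comm])

theorem comulHom_S (r : ℕ) (i j : Fin N) : comulHom N (S r i j)
    = seriesMul (fun r i j => S r i j ⊗ₜ[ℂ] 1) (fun r i j => 1 ⊗ₜ[ℂ] S r i j) r i j :=
  lift_S _ _ r i j

theorem counitHom_S (r : ℕ) (i j : Fin N) : counitHom N (S r i j) = seriesOne r i j :=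
  lift_S _ _ r i j

instance : Bialgebra ℂ (DualYangian N) :=
  Bialgebra.ofAlgHom (comulHom N) (counitHom N)
    (algHom_ext (coassoc_series comulHom_S))
    (algHom_ext (rTensor_series comulHom_S counitHom_S))
    (algHom_ext (lTensor_series comulHom_S counitHom_S))

end DualYangian

/-! ## The pairing -/

/-- Coefficients of the expansion of `1 / (u_a - v_b)` as a power series in the variables
`u_1⁻¹, …, u_m⁻¹, v_1, …, v_n`, which are `X (inl 0), …, X (inl (m-1))` and
`X (inr 0), …, X (inr (n-1))`: it is `u_a⁻¹ (1 - u_a⁻¹ v_b)⁻¹ = ∑ r ≥ 1, u_a⁻ʳ v_bʳ⁻¹`. -/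
def invSub {m n : ℕ} (a : Fin m) (b : Fin n) : MvPowerSeries (Fin m ⊕ Fin n) ℂ :=
  MvPowerSeries.X (Sum.inl a)
    * (1 - MvPowerSeries.X (Sum.inl a) * MvPowerSeries.X (Sum.inr b))⁻¹

/-- Elements of `(End ℂᴺ)^{⊗(m+n)}` with coefficients in the power series in
`u_1⁻¹, …, u_m⁻¹, v_1, …, v_n`, as matrices in the basis `e_{f(1)} ⊗ ⋯ ⊗ e_{f(m+n)}` of
`(ℂᴺ)^{⊗(m+n)}`; the first `m` tensor factors are labelled by `Fin m`, the last `n` by `Fin n`. -/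
abbrev TensorSeries (N m n : ℕ) : Type :=
  Matrix (Fin m ⊕ Fin n → Fin N) (Fin m ⊕ Fin n → Fin N) (MvPowerSeries (Fin m ⊕ Fin n) ℂ)

/-- The operator `P_{a, b+m}` exchanging the tensor factors `a` and `b + m`. -/
def permOp (N : ℕ) {m n : ℕ} (a : Fin m) (b : Fin n) : TensorSeries N m n :=
  Matrix.of fun f g => if f = g ∘ Equiv.swap (Sum.inl a) (Sum.inr b) then 1 else 0

/-- `R_{a, b+m}(u_a - v_b) = 1 - P_{a, b+m} (u_a - v_b)⁻¹`, expanded. -/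
def yangR (N : ℕ) {m n : ℕ} (a : Fin m) (b : Fin n) : TensorSeries N m n :=
  1 - invSub a b • permOp N a b

/-- The ordered product of `R_{a, b+m}(u_a - v_b)` over `a = 1, …, m` (outer product) and
`b = 1, …, n` (inner product), indices increasing from left to right. -/
def yangRProd (N m n : ℕ) : TensorSeries N m n :=
  (List.ofFn fun a : Fin m => (List.ofFn fun b : Fin n => yangR N a b).prod).prod

/-- The pairing sends `T_1(u_1) ⋯ T_m(u_m) ⊗ T*_1(v_1) ⋯ T*_n(v_n)` to
`∏_a ∏_b R_{a, b+m}(u_a - v_b)`, for all `m, n ≥ 0`: compared are the coefficients at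
`e_{i_1 j_1} ⊗ ⋯ ⊗ e_{i_m j_m} ⊗ e_{k_1 l_1} ⊗ ⋯ ⊗ e_{k_n l_n}` and at
`u_1^{-r_1} ⋯ u_m^{-r_m} v_1^{s_1} ⋯ v_n^{s_n}`. -/
def IsCanonicalPairing {N : ℕ} (β : Yangian N →ₗ[ℂ] DualYangian N →ₗ[ℂ] ℂ) : Prop :=
  ∀ (m n : ℕ) (i j : Fin m → Fin N) (k l : Fin n → Fin N) (r : Fin m → ℕ) (s : Fin n → ℕ),
    β (List.ofFn fun a => Yangian.T (r a) (i a) (j a)).prod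
        (List.ofFn fun b => DualYangian.S (s b) (k b) (l b)).prod
      = MvPowerSeries.coeff (Finsupp.equivFunOnFinite.symm (Sum.elim r s))
          (yangRProd N m n (Sum.elim i k) (Sum.elim j l))

/-- The bilinear form with `⟨X ⊗ Y, Z ⊗ W⟩ = ⟨X, Z⟩ ⟨Y, W⟩`. -/
def tensorPairing {A B : Type*} [AddCommGroup A] [Module ℂ A] [AddCommGroup B] [Module ℂ B]
    (β : A →ₗ[ℂ] B →ₗ[ℂ] ℂ) : A ⊗[ℂ] A →ₗ[ℂ] B ⊗[ℂ] B →ₗ[ℂ] ℂ :=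
  (TensorProduct.map₂ β β).compr₂ (LinearMap.mul' ℂ ℂ)

/-- A bialgebra pairing: multiplication and comultiplication, unit and counit of `A` are dual to
comultiplication and multiplication, counit and unit of `B`. -/
structure IsBialgebraPairing {A B : Type*} [Ring A] [Bialgebra ℂ A] [Ring B] [Bialgebra ℂ B]
    (β : A →ₗ[ℂ] B →ₗ[ℂ] ℂ) : Prop where
  apply_mul : ∀ (x : A) (z w : B), β x (z * w) = tensorPairing β (Coalgebra.comul x) (z ⊗ₜ[ℂ] w)
  mul_apply : ∀ (x y : A) (z : B), β (x * y) z = tensorPairing β (x ⊗ₜ[ℂ] y) (Coalgebra.comul z)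
  apply_one : ∀ x : A, β x 1 = Coalgebra.counit (R := ℂ) x
  one_apply : ∀ z : B, β 1 z = Coalgebra.counit (R := ℂ) z

/-! ## Filtrations and graded pieces -/

/-- The degree `r_1 + ⋯ + r_m` of a word `(r_1, i_1, j_1), …, (r_m, i_m, j_m)`. -/
def wordDegree {N : ℕ} (w : List (GenIndex N)) : ℕ := (w.map fun g => (g.1 : ℕ)).sum

/-- The monomial `T_{i_1 j_1}^(r_1) ⋯ T_{i_m j_m}^(r_m)` in the Yangian. -/
def Yangian.monomial {N : ℕ} (w : List (GenIndex N)) : Yangian N :=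
  (w.map fun g => Yangian.T g.1 g.2.1 g.2.2).prod

/-- The monomial `T_{i_1 j_1}^(-r_1) ⋯ T_{i_m j_m}^(-r_m)` in the dual Yangian. -/
def DualYangian.monomial {N : ℕ} (w : List (GenIndex N)) : DualYangian N :=
  (w.map fun g => DualYangian.T g.1 g.2.1 g.2.2).prod

/-- The elements of degree less than `s` for the ascending filtration with
`deg T_ij^(r) = r`. -/
def Yangian.filLT (N s : ℕ) : Submodule ℂ (Yangian N) :=
  Submodule.span ℂ (Yangian.monomial '' {w | wordDegree w < s})

/-- The elements of degree at most `s` for the ascending filtration with `deg T_ij^(r) = r`. -/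
def Yangian.fil (N s : ℕ) : Submodule ℂ (Yangian N) :=
  Submodule.span ℂ (Yangian.monomial '' {w | wordDegree w ≤ s})

/-- The elements of degree at least `s` for the descending filtration with
`deg T_ij^(-r) = r`. -/
def DualYangian.fil (N s : ℕ) : Submodule ℂ (DualYangian N) :=
  Submodule.span ℂ (DualYangian.monomial '' {w | s ≤ wordDegree w})

/-- The component of degree `s` of the graded algebra `gr Y(gl_N)`. -/
abbrev Yangian.Gr (N s : ℕ) : Type :=
  Yangian.fil N s ⧸ (Yangian.filLT N s).submoduleOf (Yangian.fil N s)

/-- The component of degree `s` of the graded algebra `gr Y*(gl_N)`. -/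
abbrev DualYangian.Gr (N s : ℕ) : Type :=
  DualYangian.fil N s ⧸ (DualYangian.fil N (s + 1)).submoduleOf (DualYangian.fil N s)

/-- The class of an element in `gr_s Y(gl_N)`. -/
def Yangian.toGr {N : ℕ} (s : ℕ) : Yangian.fil N s →ₗ[ℂ] Yangian.Gr N s := Submodule.mkQ _

/-- The class of an element in `gr_s Y*(gl_N)`. -/
def DualYangian.toGr {N : ℕ} (s : ℕ) : DualYangian.fil N s →ₗ[ℂ] DualYangian.Gr N s :=
  Submodule.mkQ _

theorem Yangian.monomial_mem {N s : ℕ} {w : List (GenIndex N)} (h : wordDegree w ≤ s) :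
    Yangian.monomial w ∈ Yangian.fil N s :=
  Submodule.subset_span ⟨w, h, rfl⟩

theorem DualYangian.monomial_mem {N s : ℕ} {w : List (GenIndex N)} (h : s ≤ wordDegree w) :
    DualYangian.monomial w ∈ DualYangian.fil N s :=
  Submodule.subset_span ⟨w, h, rfl⟩

/-- The pairing on `gr_s Y(gl_N) × gr_s Y*(gl_N)` induced by `β`. -/
def IsGrPairing {N : ℕ} (β : Yangian N →ₗ[ℂ] DualYangian N →ₗ[ℂ] ℂ) (s : ℕ)
    (γ : Yangian.Gr N s →ₗ[ℂ] DualYangian.Gr N s →ₗ[ℂ] ℂ) : Prop :=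
  ∀ (x : Yangian.fil N s) (z : DualYangian.fil N s),
    γ (Yangian.toGr s x) (DualYangian.toGr s z) = β x z

/-- The image of the monomial of `w` in `gr_s Y(gl_N)`, where `s` is the degree of `w`. -/
def Yangian.grMonomial {N : ℕ} (s : ℕ) (w : List (GenIndex N)) (h : wordDegree w = s) :
    Yangian.Gr N s :=
  Yangian.toGr s ⟨Yangian.monomial w, Yangian.monomial_mem h.le⟩

/-- The image of the monomial of `w` in `gr_s Y*(gl_N)`, where `s` is the degree of `w`. -/
def DualYangian.grMonomial {N : ℕ} (s : ℕ) (w : List (GenIndex N)) (h : wordDegree w = s) :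
    DualYangian.Gr N s :=
  DualYangian.toGr s ⟨DualYangian.monomial w, DualYangian.monomial_mem h.ge⟩

/-- The word with the matrix indices transposed: `(r, i, j)` is replaced by `(r, j, i)`. -/
def transposeWord {N : ℕ} (w : List (GenIndex N)) : List (GenIndex N) :=
  w.map fun g => (g.1, g.2.2, g.2.1)

theorem wordDegree_transposeWord {N : ℕ} (w : List (GenIndex N)) :
    wordDegree (transposeWord w) = wordDegree w := by
  simp [wordDegree, transposeWord, Function.comp_def]

/-- The multisets of triples `(r_1, i_1, j_1), …, (r_m, i_m, j_m)` with `r_1 + ⋯ + r_m = s`. -/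
abbrev GrIndex (N s : ℕ) : Type :=
  {μ : Multiset (GenIndex N) // (μ.map fun g => (g.1 : ℕ)).sum = s}

/-- The partition `r_1 ≥ ⋯ ≥ r_m` of `s` underlying a multiset of triples, written from its
smallest part to its largest one, so that the inverse lexicographical ordering of partitions is
the lexicographical ordering of these lists. -/
def GrIndex.parts {N s : ℕ} (μ : GrIndex N s) : List ℕ :=
  (μ.1.map fun g => (g.1 : ℕ)).sort (· ≤ ·)

/-- A way to order the factors of each monomial with `r_1 ≥ ⋯ ≥ r_m`. -/
structure Listing (N s : ℕ) where
  word : GrIndex N s → List (GenIndex N)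
  coe_word : ∀ μ, (word μ : Multiset (GenIndex N)) = μ.1
  decreasing : ∀ μ, (word μ).Pairwise fun g h => h.1 ≤ g.1

theorem Listing.wordDegree_word {N s : ℕ} (L : Listing N s) (μ : GrIndex N s) :
    wordDegree (L.word μ) = s := by
  have := μ.2
  rw [← L.coe_word μ, Multiset.map_coe, Multiset.sum_coe] at this
  exact this

/-- The basis vector `T_{i_1 j_1}^(r_1) ⋯ T_{i_m j_m}^(r_m)` of `gr_s Y(gl_N)`. -/
def Listing.vec {N s : ℕ} (L : Listing N s) (μ : GrIndex N s) : Yangian.Gr N s :=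
  Yangian.grMonomial s (L.word μ) (L.wordDegree_word μ)

/-- The corresponding vector `T_{j_1 i_1}^(-r_1) ⋯ T_{j_m i_m}^(-r_m)` of `gr_s Y*(gl_N)`. -/
def Listing.dualVec {N s : ℕ} (L : Listing N s) (μ : GrIndex N s) : DualYangian.Gr N s :=
  DualYangian.grMonomial s (transposeWord (L.word μ))
    ((wordDegree_transposeWord _).trans (L.wordDegree_word μ))

end

noncomputable section

/-! The vector representation of the dual Yangian sends T*(v) to R(u - v), so its matrix
coefficients at the powers of u⁻¹ are functionals on Y*. Under convolution, the product dual to the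
comultiplication, they satisfy the relations of Y, because R intertwines the two orders of a tensor
product of vector representations (`intertwiner_mul_doubleRep`, a form of the Yang–Baxter equation).
This gives a homomorphism `convHom` from Y to the convolution algebra of Y*, which is the pairing.
Compatibility with products in Y is then built in, compatibility with products in Y* extends from
generators, and the values at words are entries of the ordered product of R-matrices. Uniqueness
holds because words span.

In the graded statement, T^(-r) acts in the vector representation by u⁻ʳ times a matrix unit, up to
sign, and is primitive modulo higher degree. So a monomial of degree d in Y kills all of degree
above d, and in equal degree the pairing is a sum over the ways to cut the second monomial into
blocks, one for each factor of the first, with matching degrees. A non-zero value forces the second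
partition to refine the first. If no block has more than one letter, all terms have the same sign,
so the diagonal entries do not cancel. Both families of ordered monomials span their graded
components, by commutator estimates; together with triangularity this yields the bases and the
non-degeneracy of the graded pairing at once.

Non-degeneracy on the side of Y follows since the ascending filtration is exhaustive and starts at
zero. On the side of Y* it amounts to the vanishing of the intersection of the descending filtration
(`DualYangian.eq_zero_of_mem_fil`). For this, tensor powers of the representation (1 - t) + t(v +
P), times a scalar series with indeterminate coefficients, are taken over polynomials in t. At t = 0
they reduce to the counit, and high filtration degree forces divisibility by a high power of t, so
the intersection acts by zero for all t. At t = 1 the action is by ∏ (v + P) times a generic series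
∑ X_r vʳ. A leading-term argument in the total exponent of v shows that no non-zero element is
killed by all of these representations. -/

theorem isDualYangianSeries_vector {N : ℕ} {K : Type*} [CommRing K] (c d : ℕ → K)
    (h : ∀ r s, (r.casesOn 0 d : K) * d s - d r * (s.casesOn 0 d : K) = d r * c s - c r * d s) :
    IsDualYangianSeries fun (r : ℕ) (i j : Fin N) =>
      (if i = j then c r else 0) • (1 : Matrix (Fin N) (Fin N) K) - Matrix.single j i (d r) := by
  have hs : ∀ (r : ℕ) (i j : Fin N), seriesShift (fun (r : ℕ) (i j : Fin N) =>
      (if i = j then c r else 0) • (1 : Matrix (Fin N) (Fin N) K) - Matrix.single j i (d r)) r i j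
      = (if i = j then (r.casesOn 0 c : K) else 0) • (1 : Matrix (Fin N) (Fin N) K)
        - Matrix.single j i (r.casesOn 0 d : K) := by
    rintro (_ | r) i j <;> simp [seriesShift]
  -- With T*_ij(v) sent to δ_ij c(v) - d(v) e_ji, the commutator sees only [e_ji, e_lk], and on the
  -- right the terms quadratic in d cancel. What remains is (u - v) d(u) d(v) = d(u) c(v) - c(u)
  -- d(v), formally that c(v)/d(v) + v is constant. Solutions used below are c = 1, d = 1/(w - v)
  -- for the vector representation and c = 1 - t + tv, d = -t for its deformation.
  have key : ∀ (a b x y : K) (i j k l : Fin N),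
      ⁅a • (1 : Matrix (Fin N) (Fin N) K) - Matrix.single j i x,
        b • (1 : Matrix (Fin N) (Fin N) K) - Matrix.single l k y⁆
      = (x * y) • ((if i = l then Matrix.single j k 1 else 0)
        - (if k = j then Matrix.single l i 1 else 0)) := by
    intro a b x y i j k l
    rw [Ring.lie_def]
    have e1 : Matrix.single j i x * Matrix.single l k y
        = (x * y) • (if i = l then Matrix.single j k 1 else 0) := by
      split_ifs with h
      · subst h; simp
      · simp [h]
    have e2 : Matrix.single l k y * Matrix.single j i x
        = (x * y) • (if k = j then Matrix.single l i 1 else 0) := by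
      split_ifs with h
      · subst h; simp [mul_comm]
      · simp [h]
    simp only [sub_mul, mul_sub, e1, e2, smul_mul_assoc, mul_smul_comm, one_mul, mul_one,
      smul_sub]
    rw [smul_comm a b]
    abel
  intro r s i j k l
  rw [hs, hs, key, key, ← sub_smul, h]
  have e3 : ∀ x y : K, Matrix.single l i x * Matrix.single j k y
      = Matrix.single l i y * Matrix.single j k x := by
    intro x y
    by_cases h : i = j
    · subst h; simp [mul_comm]
    · simp [h]
  have e4 : ∀ (i j : Fin N) (x : K), Matrix.single i j x = x • Matrix.single i j 1 := by
    intro i j x; simp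
  simp only [sub_mul, mul_sub, e3 (d r) (d s), smul_mul_assoc, mul_smul_comm, one_mul, mul_one]
  rw [e4 l i (d s), e4 l i (d r), e4 j k (d s), e4 j k (d r)]
  split_ifs <;> (try simp only [zero_smul, smul_zero, zero_sub, sub_zero]) <;> module

/-! ### The vector representation and the Yangian relations for its coefficients -/

namespace DualYangian

variable {N : ℕ}

open Polynomial

/-- The universal property gives a map into the generated subalgebra whose composite with the
inclusion is the identity. -/
theorem adjoin_S : Algebra.adjoin ℂ
    (Set.range fun g : ℕ × Fin N × Fin N => (S g.1 g.2.1 g.2.2 : DualYangian N)) = ⊤ := by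
  let B := Algebra.adjoin ℂ
    (Set.range fun g : ℕ × Fin N × Fin N => (S g.1 g.2.1 g.2.2 : DualYangian N))
  have hB : ∀ r i j, S r i j ∈ B := fun r i j => Algebra.subset_adjoin ⟨(r, i, j), rfl⟩
  let f : DualYangian N →ₐ[ℂ] B := lift (fun r i j => ⟨S r i j, hB r i j⟩) (by
    intro r s i j k l
    have := S_isDualYangianSeries (N := N) r s i j k l
    apply Subtype.ext
    cases r <;> cases s <;> exact this)
  have : B.val.comp f = AlgHom.id ℂ _ := algHom_ext fun r i j => by
    exact congrArg B.val (lift_S _ _ r i j)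
  rw [eq_top_iff]
  intro z _
  have h := congrArg (fun g => g z) this
  exact (show z = (f z : DualYangian N) from h.symm) ▸ (f z).2

@[elab_as_elim]
theorem induction_on {P : DualYangian N → Prop} (z : DualYangian N)
    (algebraMap : ∀ c : ℂ, P (algebraMap ℂ _ c)) (S : ∀ r i j, P (S r i j))
    (mul : ∀ x y, P x → P y → P (x * y)) (add : ∀ x y, P x → P y → P (x + y)) : P z := by
  have hz : z ∈ Algebra.adjoin ℂ
      (Set.range fun g : ℕ × Fin N × Fin N => (DualYangian.S g.1 g.2.1 g.2.2 : DualYangian N)) := by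
    rw [adjoin_S]; trivial
  induction hz using Algebra.adjoin_induction with
  | mem x hx => obtain ⟨g, rfl⟩ := hx; exact S _ _ _
  | algebraMap c => exact algebraMap c
  | add x y _ _ hx hy => exact add x y hx hy
  | mul x y _ _ hx hy => exact mul x y hx hy

/-- The vector representation `T*(v) ↦ R(u - v)` over the polynomials in `u⁻¹`. -/
def vecRep (N : ℕ) : DualYangian N →ₐ[ℂ] Matrix (Fin N) (Fin N) ℂ[X] :=
  lift (fun r i j => (if i = j then (if r = 0 then 1 else 0) else 0 : ℂ[X]) • (1 : Matrix _ _ ℂ[X])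
      - Matrix.single j i (X ^ (r + 1)))
    (isDualYangianSeries_vector (fun r => if r = 0 then 1 else 0) (fun r => X ^ (r + 1)) (by
      rintro (_ | r) (_ | s) <;> simp <;> ring))

theorem vecRep_S (r : ℕ) (i j : Fin N) : vecRep N (S r i j)
    = (if i = j then (if r = 0 then 1 else 0) else 0 : ℂ[X]) • (1 : Matrix _ _ ℂ[X])
      - Matrix.single j i (X ^ (r + 1)) := by
  rw [vecRep, lift_S]

theorem vecRep_T (r : ℕ+) (i j : Fin N) :
    vecRep N (T r i j) = - Matrix.single j i (X ^ (r : ℕ)) := by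
  obtain ⟨r, rfl⟩ : ∃ q : ℕ, r = q.succPNat := ⟨r.natPred, (PNat.succPNat_natPred r).symm⟩
  have h := vecRep_S r i j
  rw [S, map_add] at h
  have h2 : vecRep N (if r = 0 ∧ i = j then 1 else 0)
      = (if i = j then (if r = 0 then 1 else 0) else 0 : ℂ[X]) • (1 : Matrix _ _ ℂ[X]) := by
    by_cases h1 : i = j <;> by_cases h2 : r = 0 <;> simp [h1, h2]
  rw [h2] at h
  have := congrArg (fun M => -((if i = j then (if r = 0 then 1 else 0) else 0 : ℂ[X]) •
    (1 : Matrix (Fin N) (Fin N) ℂ[X])) + M) h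
  simpa [neg_add_cancel_left, sub_eq_add_neg] using this

/-- At u⁻¹ = 0 the matrix R(u - v) is the identity. The counit is the unit of the convolution
algebra, so this becomes the normalisation T_ij^(0) = δ_ij. -/
theorem vecRep_coeff_zero (z : DualYangian N) (i j : Fin N) :
    (vecRep N z i j).coeff 0 = if i = j then counitHom N z else 0 := by
  let f : DualYangian N →ₐ[ℂ] Matrix (Fin N) (Fin N) ℂ :=
    (Polynomial.aeval (0 : ℂ)).mapMatrix.comp (vecRep N)
  let g : DualYangian N →ₐ[ℂ] Matrix (Fin N) (Fin N) ℂ :=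
    (Algebra.ofId ℂ _).comp (counitHom N)
  have : f = g := by
    apply algHom_ext
    intro r i j
    ext k l
    simp only [f, g, AlgHom.comp_apply, vecRep_S, counitHom_S, seriesOne, Algebra.ofId_apply,
      AlgHom.mapMatrix_apply, Matrix.map_apply, Matrix.sub_apply, Matrix.smul_apply,
      Matrix.single_apply, Matrix.algebraMap_matrix_apply, Matrix.one_apply]
    by_cases h1 : i = j <;> by_cases h2 : r = 0 <;> by_cases h3 : k = l <;>
      simp [h1, h2, h3, apply_ite (Polynomial.eval (0 : ℂ))]
  have h := congrArg (fun h => h z i j) this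
  simp only [f, g, AlgHom.comp_apply, Algebra.ofId_apply,
      AlgHom.mapMatrix_apply, Matrix.map_apply, Matrix.algebraMap_matrix_apply] at h
  rw [← Polynomial.coeff_zero_eq_aeval_zero] at h
  simpa using h

/-- The functional dual to `T_ij^(r)`: the coefficient at `u⁻ʳ` of the `(i, j)` entry of the
vector representation. -/
def vecCoeff (r : ℕ) (i j : Fin N) : WithConv (DualYangian N →ₗ[ℂ] ℂ) :=
  WithConv.toConv ((Polynomial.lcoeff ℂ r) ∘ₗ (Matrix.entryLinearMap ℂ ℂ[X] i j) ∘ₗ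
    (vecRep N).toLinearMap)

/-- The vector representation in the variable `u⁻¹` on the first of two tensor factors. -/
def leftRep (N : ℕ) : DualYangian N →ₐ[ℂ] Matrix (Fin N) (Fin N) (Matrix (Fin N) (Fin N) ℂ[X][X]) :=
  AlgHom.comp (((Algebra.ofId ℂ[X][X] _).restrictScalars ℂ).mapMatrix.comp
    ((Algebra.ofId ℂ[X] ℂ[X][X]).restrictScalars ℂ).mapMatrix) (vecRep N)

/-- The vector representation in the variable `v⁻¹` on the second of two tensor factors. -/
def rightRep (N : ℕ) :
    DualYangian N →ₐ[ℂ] Matrix (Fin N) (Fin N) (Matrix (Fin N) (Fin N) ℂ[X][X]) :=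
  AlgHom.comp ((Matrix.scalarAlgHom (Fin N) ℂ).comp
    (Polynomial.mapAlgHom (Algebra.ofId ℂ ℂ[X])).mapMatrix) (vecRep N)

theorem leftRep_apply (z : DualYangian N) (i j k l : Fin N) :
    leftRep N z i j k l = if k = l then C (vecRep N z i j) else 0 := by
  simp [leftRep, Algebra.ofId_apply, Matrix.algebraMap_matrix_apply]

theorem rightRep_apply (z : DualYangian N) (i j k l : Fin N) :
    rightRep N z i j k l = if i = j then (vecRep N z k l).map C else 0 := by
  by_cases h : i = j <;> simp [rightRep, h, Matrix.scalar_apply]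

theorem leftRep_mul_rightRep_apply (z w : DualYangian N) (i j k l : Fin N) :
    (leftRep N z * rightRep N w) i j k l = C (vecRep N z i j) * (vecRep N w k l).map C := by
  simp only [Matrix.mul_apply, Matrix.sum_apply, leftRep_apply, rightRep_apply, mul_ite, ite_mul,
    mul_zero, zero_mul]
  rw [Finset.sum_eq_single j (by intro b _ hb; simp [hb]) (by simp)]
  simp

theorem leftRep_commute (z w : DualYangian N) : Commute (leftRep N z) (rightRep N w) := by
  ext i j k l : 2
  ext l : 1
  rw [leftRep_mul_rightRep_apply]
  simp only [Matrix.mul_apply, Matrix.sum_apply, leftRep_apply, rightRep_apply, mul_ite, ite_mul,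
    mul_zero, zero_mul]
  rw [Finset.sum_eq_single i (by intro b _ hb; simp [hb.symm]) (by simp)]
  simp [mul_comm]

/-- Both vector representations applied to the comultiplication. -/
def doubleRep (N : ℕ) :
    DualYangian N →ₐ[ℂ] Matrix (Fin N) (Fin N) (Matrix (Fin N) (Fin N) ℂ[X][X]) :=
  (Algebra.TensorProduct.lift (leftRep N) (rightRep N) leftRep_commute).comp (comulHom N)

/-- Both vector representations applied to the opposite comultiplication. -/
def doubleRepOp (N : ℕ) :
    DualYangian N →ₐ[ℂ] Matrix (Fin N) (Fin N) (Matrix (Fin N) (Fin N) ℂ[X][X]) :=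
  (Algebra.TensorProduct.lift (rightRep N) (leftRep N)
    fun z w => (leftRep_commute w z).symm).comp (comulHom N)

/-- Convolution is defined through the comultiplication, so products of coefficient functionals in
either order are read off from the two tensor products of vector representations. The outer
polynomial variable is v⁻¹, the inner one u⁻¹. -/
theorem doubleRep_coeff (z : DualYangian N) (r s : ℕ) (i j k l : Fin N) :
    ((doubleRep N z i j k l).coeff s).coeff r = (vecCoeff r i j * vecCoeff s k l) z := by
  rw [LinearMap.convMul_apply]
  change (((Algebra.TensorProduct.lift (leftRep N) (rightRep N) leftRep_commute)
    (comulHom N z) i j k l).coeff s).coeff r = _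
  change _ = LinearMap.mul' ℂ ℂ (TensorProduct.map _ _ (comulHom N z))
  induction comulHom N z using TensorProduct.induction_on with
  | zero => simp
  | add x y hx hy => simp only [map_add, Matrix.add_apply, coeff_add, hx, hy]
  | tmul x y =>
    simp only [Algebra.TensorProduct.lift_tmul, TensorProduct.map_tmul, LinearMap.mul'_apply,
      leftRep_mul_rightRep_apply]
    rw [coeff_C_mul, coeff_map, coeff_mul_C]
    rfl

theorem doubleRepOp_coeff (z : DualYangian N) (r s : ℕ) (i j k l : Fin N) :
    ((doubleRepOp N z i j k l).coeff s).coeff r = (vecCoeff s k l * vecCoeff r i j) z := by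
  rw [LinearMap.convMul_apply]
  change (((Algebra.TensorProduct.lift (rightRep N) (leftRep N)
    fun z w => (leftRep_commute w z).symm) (comulHom N z) i j k l).coeff s).coeff r = _
  change _ = LinearMap.mul' ℂ ℂ (TensorProduct.map _ _ (comulHom N z))
  induction comulHom N z using TensorProduct.induction_on with
  | zero => simp
  | add x y hx hy => simp only [map_add, Matrix.add_apply, coeff_add, hx, hy]
  | tmul x y =>
    simp only [Algebra.TensorProduct.lift_tmul, TensorProduct.map_tmul, LinearMap.mul'_apply,
      ← (leftRep_commute y x).eq, leftRep_mul_rightRep_apply]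
    rw [coeff_C_mul, coeff_map, coeff_mul_C, mul_comm]
    rfl

/-- The operator `(u - v - P) u⁻¹ v⁻¹`. -/
def intertwiner (N : ℕ) : Matrix (Fin N) (Fin N) (Matrix (Fin N) (Fin N) ℂ[X][X]) :=
  (Matrix.scalar (Fin N) (Matrix.scalar (Fin N) (X - C X : ℂ[X][X])))
    - Matrix.of fun i j => Matrix.single j i (C X * X : ℂ[X][X])

theorem intertwiner_mul_apply (M : Matrix (Fin N) (Fin N) (Matrix (Fin N) (Fin N) ℂ[X][X]))
    (i j k l : Fin N) :
    (intertwiner N * M) i j k l = (X - C X) * M i j k l - C X * X * M k j i l := by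
  rw [intertwiner, sub_mul, Matrix.sub_apply, Matrix.sub_apply]
  congr 1
  · simp [Matrix.scalar_apply, Matrix.diagonal_mul]
  · simp only [Matrix.mul_apply, Matrix.sum_apply, Matrix.of_apply, Matrix.single_apply]
    rw [Finset.sum_eq_single k (by intro b _ hb; simp [hb]) (by simp)]
    simp

theorem mul_intertwiner_apply (M : Matrix (Fin N) (Fin N) (Matrix (Fin N) (Fin N) ℂ[X][X]))
    (i j k l : Fin N) :
    (M * intertwiner N) i j k l = (X - C X) * M i j k l - C X * X * M i l k j := by
  rw [intertwiner, mul_sub, Matrix.sub_apply, Matrix.sub_apply]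
  congr 1
  · simp [Matrix.scalar_apply, Matrix.mul_diagonal, mul_comm]
  · simp only [Matrix.mul_apply, Matrix.sum_apply, Matrix.of_apply, Matrix.single_apply]
    rw [Finset.sum_eq_single l (by intro b _ hb; simp [hb]) (by simp)]
    simp only [and_true, mul_ite, mul_zero, Finset.sum_ite_eq, Finset.mem_univ, if_true]
    exact mul_comm _ _

theorem doubleRep_S (s : ℕ) (p q : Fin N) :
    doubleRep N (S s p q)
      = seriesMul (fun r i j => leftRep N (S r i j)) (fun r i j => rightRep N (S r i j)) s p q := by
  rw [doubleRep, AlgHom.comp_apply, comulHom_S, seriesMul_map]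
  simp

theorem doubleRepOp_S (s : ℕ) (p q : Fin N) :
    doubleRepOp N (S s p q)
      = seriesMul (fun r i j => rightRep N (S r i j)) (fun r i j => leftRep N (S r i j)) s p q := by
  rw [doubleRepOp, AlgHom.comp_apply, comulHom_S, seriesMul_map]
  simp

theorem vecRep_S_apply (r : ℕ) (i j k l : Fin N) : vecRep N (S r i j) k l
    = (if r = 0 ∧ i = j ∧ k = l then 1 else 0) - if k = j ∧ l = i then X ^ (r + 1) else 0 := by
  rw [vecRep_S]
  by_cases h1 : i = j <;> by_cases h2 : r = 0 <;> by_cases h3 : k = l <;>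
    simp [h1, h2, h3, Matrix.single_apply, eq_comm]

/-- Expansion of a product of two R-matrices on generators, into the identity, two linear terms and
one quadratic term. The scalars x and y are kept general because the opposite comultiplication uses
the same formula with u⁻¹ and v⁻¹ exchanged. -/
theorem sum_vector_mul_vector {K : Type*} [CommRing K] (x y : K) (s : ℕ) (p q i j k l : Fin N) :
    ∑ m : Fin N, ∑ a ∈ Finset.HasAntidiagonal.antidiagonal s,
      ((if a.1 = 0 ∧ p = m ∧ i = j then 1 else 0) - if i = m ∧ j = p then x ^ (a.1 + 1) else 0)
        * ((if a.2 = 0 ∧ m = q ∧ k = l then 1 else 0) - if k = q ∧ l = m then y ^ (a.2 + 1) else 0)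
      = (if s = 0 ∧ p = q ∧ i = j ∧ k = l then 1 else 0)
        - (if i = q ∧ j = p ∧ k = l then x ^ (s + 1) else 0)
        - (if i = j ∧ k = q ∧ l = p then y ^ (s + 1) else 0)
        + (if i = l ∧ j = p ∧ k = q then
            ∑ a ∈ Finset.HasAntidiagonal.antidiagonal s, x ^ (a.1 + 1) * y ^ (a.2 + 1) else 0) := by
  have h1 : ∀ g : ℕ → K, ∑ a ∈ Finset.HasAntidiagonal.antidiagonal s,
      (if a.1 = 0 then g a.2 else 0) = g s := by
    intro g
    cases s with
    | zero => simp
    | succ s => rw [Finset.Nat.sum_antidiagonal_succ]; simp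
  have h2 : ∀ g : ℕ → K, ∑ a ∈ Finset.HasAntidiagonal.antidiagonal s,
      (if a.2 = 0 then g a.1 else 0) = g s := by
    intro g
    cases s with
    | zero => simp
    | succ s => rw [Finset.Nat.sum_antidiagonal_succ']; simp
  simp only [sub_mul, mul_sub, Finset.sum_sub_distrib]
  simp only [mul_ite, ite_mul, mul_one, one_mul, mul_zero, zero_mul, ite_and]
  have e1 : ∑ m : Fin N, ∑ a ∈ Finset.HasAntidiagonal.antidiagonal s, (if a.2 = 0 then
      if m = q then if k = l then if a.1 = 0 then if p = m then if i = j then (1 : K) else 0 else 0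
        else 0 else 0 else 0 else 0)
      = if s = 0 ∧ p = q ∧ i = j ∧ k = l then 1 else 0 := by
    rw [Finset.sum_eq_single q (by intro b _ hb; simp [hb]) (by simp)]
    rw [h2 (fun n => if q = q then if k = l then if n = 0 then if p = q then if i = j then (1 : K)
      else 0 else 0 else 0 else 0 else 0)]
    split_ifs <;> simp_all
  have e2 : ∑ m : Fin N, ∑ a ∈ Finset.HasAntidiagonal.antidiagonal s, (if a.2 = 0 then
      if m = q then if k = l then if i = m then if j = p then x ^ (a.1 + 1) else 0 else 0
        else 0 else 0 else 0)
      = if i = q ∧ j = p ∧ k = l then x ^ (s + 1) else 0 := by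
    rw [Finset.sum_eq_single q (by intro b _ hb; simp [hb]) (by simp)]
    rw [h2 (fun n => if q = q then if k = l then if i = q then if j = p then x ^ (n + 1)
      else 0 else 0 else 0 else 0)]
    split_ifs <;> simp_all
  have e3 : ∑ m : Fin N, ∑ a ∈ Finset.HasAntidiagonal.antidiagonal s, (if k = q then
      if l = m then if a.1 = 0 then if p = m then if i = j then y ^ (a.2 + 1) else 0 else 0
        else 0 else 0 else 0)
      = if i = j ∧ k = q ∧ l = p then y ^ (s + 1) else 0 := by
    rw [Finset.sum_eq_single l (by intro b _ hb; simp [hb.symm]) (by simp)]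
    by_cases hk : k = q <;> simp only [hk, if_true, if_false]
    · rw [h1 (fun n => if p = l then if i = j then y ^ (n + 1) else 0 else 0)]
      rcases eq_or_ne l p with rfl | h <;> by_cases hi : i = j <;> simp [*, Ne.symm]
    · simp
  have e4 : ∑ m : Fin N, ∑ a ∈ Finset.HasAntidiagonal.antidiagonal s, (if k = q then
      if l = m then if i = m then if j = p then x ^ (a.1 + 1) * y ^ (a.2 + 1) else 0 else 0
        else 0 else 0)
      = if i = l ∧ j = p ∧ k = q then
        ∑ a ∈ Finset.HasAntidiagonal.antidiagonal s, x ^ (a.1 + 1) * y ^ (a.2 + 1) else 0 := by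
    rw [Finset.sum_eq_single l (by intro b _ hb; simp [hb.symm]) (by simp)]
    by_cases h1 : i = l <;> by_cases h2 : j = p <;> by_cases h3 : k = q <;> simp [h1, h2, h3]
  rw [e1, e2, e3, e4]
  simp only [ite_and]
  ring

theorem doubleRep_S_apply (s : ℕ) (p q i j k l : Fin N) :
    doubleRep N (S s p q) i j k l
      = (if s = 0 ∧ p = q ∧ i = j ∧ k = l then 1 else 0)
        - (if i = q ∧ j = p ∧ k = l then C X ^ (s + 1) else 0)
        - (if i = j ∧ k = q ∧ l = p then X ^ (s + 1) else 0)
        + (if i = l ∧ j = p ∧ k = q then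
            ∑ x ∈ Finset.HasAntidiagonal.antidiagonal s, C X ^ (x.1 + 1) * X ^ (x.2 + 1) else 0) := by
  rw [doubleRep_S, seriesMul, ← sum_vector_mul_vector]
  simp only [Matrix.sum_apply, leftRep_mul_rightRep_apply, vecRep_S_apply]
  simp only [Polynomial.map_sub, map_sub, apply_ite C, apply_ite (Polynomial.map C), map_zero,
    map_one, Polynomial.map_zero, Polynomial.map_one, map_pow, Polynomial.map_pow, map_X]

theorem doubleRepOp_S_apply (s : ℕ) (p q i j k l : Fin N) :
    doubleRepOp N (S s p q) i j k l
      = (if s = 0 ∧ p = q ∧ i = j ∧ k = l then 1 else 0)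
        - (if i = q ∧ j = p ∧ k = l then C X ^ (s + 1) else 0)
        - (if i = j ∧ k = q ∧ l = p then X ^ (s + 1) else 0)
        + (if k = j ∧ l = p ∧ i = q then
            ∑ x ∈ Finset.HasAntidiagonal.antidiagonal s, C X ^ (x.1 + 1) * X ^ (x.2 + 1) else 0) := by
  rw [doubleRepOp_S, seriesMul]
  simp only [Matrix.sum_apply, ← (leftRep_commute _ _).eq, leftRep_mul_rightRep_apply,
    vecRep_S_apply]
  simp only [Polynomial.map_sub, map_sub, apply_ite C, apply_ite (Polynomial.map C), map_zero,
    map_one, Polynomial.map_zero, Polynomial.map_one, map_pow, Polynomial.map_pow, map_X]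
  refine (Finset.sum_congr rfl fun m _ => (Finset.sum_congr rfl fun a _ => mul_comm _ _)).trans
    ((sum_vector_mul_vector (X : ℂ[X][X]) (C X) s p q k l i j).trans ?_)
  rw [← Finset.Nat.sum_antidiagonal_swap]
  simp only [Prod.fst_swap, Prod.snd_swap, mul_comm ((X : ℂ[X][X]) ^ _)]
  rw [sub_right_comm]
  simp only [show (s = 0 ∧ p = q ∧ k = l ∧ i = j) = (s = 0 ∧ p = q ∧ i = j ∧ k = l) by grind,
    show (k = q ∧ l = p ∧ i = j) = (i = j ∧ k = q ∧ l = p) by grind,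
    show (k = l ∧ i = q ∧ j = p) = (i = q ∧ j = p ∧ k = l) by grind]

/-- The coefficient at wˢ of the partial fraction identity (u - v)/((u - w)(v - w)) = 1/(v - w) -
1/(u - w), with x = u⁻¹ and y = v⁻¹. -/
theorem sub_mul_sum_antidiagonal {R : Type*} [CommRing R] (x y : R) (s : ℕ) :
    (y - x) * ∑ p ∈ Finset.HasAntidiagonal.antidiagonal s, x ^ (p.1 + 1) * y ^ (p.2 + 1)
      = x * y * (y ^ (s + 1) - x ^ (s + 1)) := by
  rw [Finset.Nat.sum_antidiagonal_eq_sum_range_succ (fun a b => x ^ (a + 1) * y ^ (b + 1)),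
    ← (Commute.all x y).mul_neg_geom_sum₂ (s + 1), mul_left_comm]
  congr 1
  rw [Finset.mul_sum]
  refine Finset.sum_congr rfl fun a ha => ?_
  rw [show s + 1 - 1 - a = s - a by omega]
  ring

/-- Both representations are multiplicative, so intertwining passes to products and sums and has to
be checked on generators only. -/
theorem intertwiner_mul_doubleRep (z : DualYangian N) :
    intertwiner N * doubleRep N z = doubleRepOp N z * intertwiner N := by
  have hgen : ∀ s (p q : Fin N), intertwiner N * doubleRep N (S s p q)
      = doubleRepOp N (S s p q) * intertwiner N := by
    intro s p q
    refine Matrix.ext fun i j => Matrix.ext fun k l => ?_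
    rw [intertwiner_mul_apply, mul_intertwiner_apply]
    simp only [doubleRep_S_apply, doubleRepOp_S_apply]
    have key := sub_mul_sum_antidiagonal (C X : ℂ[X][X]) X s
    generalize (∑ x ∈ Finset.HasAntidiagonal.antidiagonal s,
      C X ^ (x.1 + 1) * X ^ (x.2 + 1) : ℂ[X][X]) = G at key ⊢
    simp only [show (k = q ∧ j = p ∧ i = l) = (i = l ∧ j = p ∧ k = q) by grind,
      show (k = j ∧ i = q ∧ l = p) = (k = j ∧ l = p ∧ i = q) by grind,
      show (i = q ∧ l = p ∧ k = j) = (k = j ∧ l = p ∧ i = q) by grind,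
      show (i = l ∧ k = q ∧ j = p) = (i = l ∧ j = p ∧ k = q) by grind,
      show (s = 0 ∧ p = q ∧ k = j ∧ i = l) = (s = 0 ∧ p = q ∧ i = l ∧ k = j) by grind]
    -- Apart from common terms the two sides involve only these two index patterns, and their
    -- difference vanishes when both or neither hold. If exactly one holds, the quadratic term on
    -- one side must match a difference of linear terms, which is `key`.
    by_cases h1 : i = l ∧ j = p ∧ k = q <;> by_cases h2 : k = j ∧ l = p ∧ i = q
    · simp only [if_pos h1, if_pos h2]
    · simp only [if_pos h1, if_neg h2]
      linear_combination key
    · simp only [if_neg h1, if_pos h2]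
      linear_combination -key
    · simp only [if_neg h1, if_neg h2]
  induction z using induction_on with
  | algebraMap c => rw [AlgHom.commutes, AlgHom.commutes]; exact (Algebra.commutes c _).symm
  | S r i j => exact hgen r i j
  | mul x y hx hy => rw [map_mul, map_mul, ← mul_assoc, hx, mul_assoc, hy, mul_assoc]
  | add x y hx hy => rw [map_add, map_add, mul_add, add_mul, hx, hy]

/-- The defining relation of Y is the intertwining relation read in one entry, at u^(-r-1) v^(-s-1).
-/
theorem vecCoeff_isYangianSeries :
    IsYangianSeries (vecCoeff : ℕ → Fin N → Fin N → WithConv (DualYangian N →ₗ[ℂ] ℂ)) := by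
  intro r s i j k l
  ext z
  have h := congrArg (fun M => ((M i j k l).coeff (s + 1)).coeff (r + 1))
    (intertwiner_mul_doubleRep z)
  simp only [intertwiner_mul_apply, mul_intertwiner_apply, sub_mul, mul_assoc, coeff_sub,
    coeff_C_mul, coeff_X_mul, doubleRep_coeff, doubleRepOp_coeff] at h
  simp only [Ring.lie_def]
  change (vecCoeff (r + 1) i j * vecCoeff s k l) z - (vecCoeff s k l * vecCoeff (r + 1) i j) z
    - ((vecCoeff r i j * vecCoeff (s + 1) k l) z - (vecCoeff (s + 1) k l * vecCoeff r i j) z)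
    = (vecCoeff r k j * vecCoeff s i l) z - (vecCoeff s k j * vecCoeff r i l) z
  linear_combination h

theorem vecCoeff_zero (i j : Fin N) :
    (vecCoeff 0 i j : WithConv (DualYangian N →ₗ[ℂ] ℂ)) = if i = j then 1 else 0 := by
  ext z
  change (vecRep N z i j).coeff 0 = _
  rw [vecRep_coeff_zero]
  split_ifs
  · rfl
  · rfl

end DualYangian

/-! ### The canonical pairing and the bialgebra axioms -/

theorem sum_comm_pairs {ι κ μ ν M : Type*} [AddCommMonoid M] (s : Finset ι) (t : Finset κ)
    (u : Finset μ) (v : Finset ν) (f : ι → κ → μ → ν → M) :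
    ∑ i ∈ s, ∑ j ∈ t, ∑ k ∈ u, ∑ l ∈ v, f i j k l
      = ∑ k ∈ u, ∑ l ∈ v, ∑ i ∈ s, ∑ j ∈ t, f i j k l := by
  have h : ∀ i, ∑ j ∈ t, ∑ k ∈ u, ∑ l ∈ v, f i j k l = ∑ k ∈ u, ∑ l ∈ v, ∑ j ∈ t, f i j k l := by
    intro i
    rw [Finset.sum_comm]
    exact Finset.sum_congr rfl fun k _ => Finset.sum_comm
  simp only [h]
  rw [Finset.sum_comm]
  exact Finset.sum_congr rfl fun k _ => Finset.sum_comm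

theorem Yangian.adjoin_T (N : ℕ) : Algebra.adjoin ℂ
    (Set.range fun g : ℕ × Fin N × Fin N => (Yangian.T g.1 g.2.1 g.2.2 : Yangian N)) = ⊤ := by
  let B := Algebra.adjoin ℂ
    (Set.range fun g : ℕ × Fin N × Fin N => (T g.1 g.2.1 g.2.2 : Yangian N))
  have hB : ∀ r i j, T r i j ∈ B := fun r i j => Algebra.subset_adjoin ⟨(r, i, j), rfl⟩
  let f : Yangian N →ₐ[ℂ] B := lift (fun r i j => ⟨T r i j, hB r i j⟩)
    (fun i j => Subtype.ext (by
      refine (T_zero i j).trans ?_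
      split_ifs <;> rfl))
    (fun r s i j k l => Subtype.ext (T_isYangianSeries (N := N) r s i j k l))
  have : B.val.comp f = AlgHom.id ℂ _ :=
    algHom_ext fun r i j => congrArg B.val (lift_T _ _ _ r i j)
  rw [eq_top_iff]
  intro z _
  have h := congrArg (fun g => g z) this
  exact (show z = (f z : Yangian N) from h.symm) ▸ (f z).2

@[elab_as_elim]
theorem Yangian.induction_on {N : ℕ} {P : Yangian N → Prop} (x : Yangian N)
    (algebraMap : ∀ c : ℂ, P (algebraMap ℂ _ c)) (T : ∀ r i j, P (Yangian.T r i j))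
    (mul : ∀ x y, P x → P y → P (x * y)) (add : ∀ x y, P x → P y → P (x + y)) : P x := by
  have hz : x ∈ Algebra.adjoin ℂ
      (Set.range fun g : ℕ × Fin N × Fin N => (Yangian.T g.1 g.2.1 g.2.2 : Yangian N)) := by
    rw [adjoin_T]; trivial
  induction hz using Algebra.adjoin_induction with
  | mem x hx => obtain ⟨g, rfl⟩ := hx; exact T _ _ _
  | algebraMap c => exact algebraMap c
  | add x y _ _ hx hy => exact add x y hx hy
  | mul x y _ _ hx hy => exact mul x y hx hy

variable {N : ℕ}

/-- The homomorphism from the Yangian to the convolution algebra of functionals on the dual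
Yangian. -/
def convHom (N : ℕ) : Yangian N →ₐ[ℂ] WithConv (DualYangian N →ₗ[ℂ] ℂ) :=
  Yangian.lift DualYangian.vecCoeff DualYangian.vecCoeff_zero
    DualYangian.vecCoeff_isYangianSeries

theorem convHom_T (r : ℕ) (i j : Fin N) : convHom N (Yangian.T r i j) = DualYangian.vecCoeff r i j :=
  Yangian.lift_T _ _ _ _ _ _

/-- The canonical pairing. -/
def canonicalPairing (N : ℕ) : Yangian N →ₗ[ℂ] DualYangian N →ₗ[ℂ] ℂ :=
  (WithConv.linearEquiv ℂ (DualYangian N →ₗ[ℂ] ℂ)).toLinearMap ∘ₗ (convHom N).toLinearMap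

theorem canonicalPairing_apply (x : Yangian N) (z : DualYangian N) :
    canonicalPairing N x z = convHom N x z := rfl

theorem canonicalPairing_T (r : ℕ) (i j : Fin N) (z : DualYangian N) :
    canonicalPairing N (Yangian.T r i j) z = (DualYangian.vecRep N z i j).coeff r := by
  rw [canonicalPairing_apply, convHom_T]
  rfl

theorem tensorPairing_tmul {A B : Type*} [AddCommGroup A] [Module ℂ A] [AddCommGroup B]
    [Module ℂ B] (β : A →ₗ[ℂ] B →ₗ[ℂ] ℂ) (x y : A) (z w : B) :
    tensorPairing β (x ⊗ₜ y) (z ⊗ₜ w) = β x z * β y w := by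
  simp [tensorPairing]

theorem canonicalPairing_mul (x y : Yangian N) (z : DualYangian N) :
    canonicalPairing N (x * y) z
      = tensorPairing (canonicalPairing N) (x ⊗ₜ[ℂ] y) (Coalgebra.comul z) := by
  rw [canonicalPairing_apply, map_mul, LinearMap.convMul_apply]
  rfl

theorem canonicalPairing_one (z : DualYangian N) :
    canonicalPairing N 1 z = Coalgebra.counit (R := ℂ) z := by
  rw [canonicalPairing_apply, map_one]
  rfl

theorem canonicalPairing_apply_one (x : Yangian N) :
    canonicalPairing N x 1 = Coalgebra.counit (R := ℂ) x := by
  change _ = Yangian.counitHom N x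
  induction x using Yangian.induction_on with
  | algebraMap c =>
    rw [Algebra.algebraMap_eq_smul_one, map_smul, map_smul, LinearMap.smul_apply,
      canonicalPairing_one, Bialgebra.counit_one, map_one]
  | T r i j =>
    rw [canonicalPairing_T, Yangian.counitHom_T, map_one, seriesOne, Matrix.one_apply]
    by_cases h : i = j <;> simp [h, Polynomial.coeff_one]
  | mul x y hx hy =>
    rw [canonicalPairing_mul, Bialgebra.comul_one, Algebra.TensorProduct.one_def,
      tensorPairing_tmul, hx, hy, map_mul]
  | add x y hx hy => rw [map_add, LinearMap.add_apply, hx, hy, map_add]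

/-- On generators this is multiplicativity of `vecRep`: a matrix product combined with a Cauchy
product of coefficients. It passes to products because both comultiplications are algebra
homomorphisms. The induction hypotheses are needed at the Sweedler components of z and w, whence the
generalisation. -/
theorem canonicalPairing_apply_mul (x : Yangian N) (z w : DualYangian N) :
    canonicalPairing N x (z * w)
      = tensorPairing (canonicalPairing N) (Coalgebra.comul x) (z ⊗ₜ[ℂ] w) := by
  induction x using Yangian.induction_on generalizing z w with
  | algebraMap c =>
    rw [Algebra.algebraMap_eq_smul_one, map_smul, map_smul, map_smul, LinearMap.smul_apply,
      LinearMap.smul_apply, canonicalPairing_one, Bialgebra.comul_one,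
      Algebra.TensorProduct.one_def, tensorPairing_tmul, canonicalPairing_one,
      canonicalPairing_one, Bialgebra.counit_mul]
  | T r i j =>
    change _ = tensorPairing (canonicalPairing N) (Yangian.comulHom N (Yangian.T r i j)) _
    rw [canonicalPairing_T, map_mul, Matrix.mul_apply, Polynomial.finsetSum_coeff,
      Yangian.comulHom_T, seriesMul]
    simp only [map_sum, LinearMap.sum_apply, Algebra.TensorProduct.tmul_mul_tmul, one_mul,
      mul_one, tensorPairing_tmul, canonicalPairing_T, Polynomial.coeff_mul]
  | mul x y hx hy =>
    let X := Coalgebra.Repr.arbitrary ℂ x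
    let Y := Coalgebra.Repr.arbitrary ℂ y
    let Z := Coalgebra.Repr.arbitrary ℂ z
    let W := Coalgebra.Repr.arbitrary ℂ w
    have hX : ∀ z w, canonicalPairing N x (z * w) = ∑ i ∈ X.index,
        canonicalPairing N (X.left i) z * canonicalPairing N (X.right i) w := by
      intro z w
      rw [hx, ← X.eq, map_sum, LinearMap.sum_apply]
      simp only [tensorPairing_tmul]
    have hY : ∀ z w, canonicalPairing N y (z * w) = ∑ i ∈ Y.index,
        canonicalPairing N (Y.left i) z * canonicalPairing N (Y.right i) w := by
      intro z w
      rw [hy, ← Y.eq, map_sum, LinearMap.sum_apply]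
      simp only [tensorPairing_tmul]
    have hZ : ∀ x y, canonicalPairing N (x * y) z = ∑ i ∈ Z.index,
        canonicalPairing N x (Z.left i) * canonicalPairing N y (Z.right i) := by
      intro x y
      rw [canonicalPairing_mul, ← Z.eq, map_sum]
      simp only [tensorPairing_tmul]
    have hW : ∀ x y, canonicalPairing N (x * y) w = ∑ i ∈ W.index,
        canonicalPairing N x (W.left i) * canonicalPairing N y (W.right i) := by
      intro x y
      rw [canonicalPairing_mul, ← W.eq, map_sum]
      simp only [tensorPairing_tmul]
    rw [canonicalPairing_mul, Bialgebra.comul_mul, Bialgebra.comul_mul, ← X.eq, ← Y.eq, ← Z.eq,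
      ← W.eq]
    simp only [Finset.sum_mul_sum, map_sum, LinearMap.sum_apply,
      Algebra.TensorProduct.tmul_mul_tmul, tensorPairing_tmul, hX, hY, hZ, hW]
    rw [sum_comm_pairs]
    refine Finset.sum_congr rfl fun i _ => Finset.sum_congr rfl fun j _ => ?_
    refine Finset.sum_congr rfl fun p _ => Finset.sum_congr rfl fun q _ => ?_
    ring
  | add x y hx hy => simp only [map_add, LinearMap.add_apply, hx, hy]

theorem canonicalPairing_isBialgebraPairing : IsBialgebraPairing (canonicalPairing N) where
  apply_mul := canonicalPairing_apply_mul
  mul_apply := canonicalPairing_mul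
  apply_one := canonicalPairing_apply_one
  one_apply := canonicalPairing_one

/-! ### The ordered product of R-matrices in coordinates -/

section Sites

variable {ι n B : Type*} [Fintype ι] [DecidableEq ι] [Fintype n] [DecidableEq n] [Ring B]

/-- The matrix acting on one of the tensor factors labelled by `ι`. -/
def siteHom (a : ι) : Matrix n n B →+* Matrix (ι → n) (ι → n) B where
  toFun M := Matrix.of fun f g => if ∀ c, c ≠ a → f c = g c then M (f a) (g a) else 0
  map_one' := by
    ext f g
    simp only [Matrix.of_apply, Matrix.one_apply]
    by_cases h : f = g
    · simp [h]
    · by_cases h' : ∀ c, c ≠ a → f c = g c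
      · have : f a ≠ g a := fun e => h (funext fun c => by
          by_cases hc : c = a
          · rw [hc, e]
          · exact h' c hc)
        simp [h, this]
      · simp [h, h']
  map_mul' M M' := by
    ext f g
    simp only [Matrix.of_apply, Matrix.mul_apply]
    have key : ∀ x : n, (∀ c, c ≠ a → Function.update f a x c = g c) ↔ ∀ c, c ≠ a → f c = g c := by
      intro x
      refine forall₂_congr fun c hc => ?_
      rw [Function.update_of_ne hc]
    have : ∑ h : ι → n, (if ∀ c, c ≠ a → f c = h c then M (f a) (h a) else 0)
          * (if ∀ c, c ≠ a → h c = g c then M' (h a) (g a) else 0)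
        = ∑ x : n, M (f a) x * (if ∀ c, c ≠ a → f c = g c then M' x (g a) else 0) := by
      symm
      refine Fintype.sum_of_injective (fun x => Function.update f a x)
        (Function.update_injective f a) _ _ ?_ ?_
      · intro h hh
        rw [if_neg, zero_mul]
        intro hc
        refine hh ⟨h a, funext fun c => ?_⟩
        by_cases hca : c = a
        · subst hca; simp
        · simp [hca, hc c hca]
      · intro x
        have h2 : ∀ c, c ≠ a → f c = Function.update f a x c := fun c hc => by
          rw [Function.update_of_ne hc]
        simp only [key, Function.update_self, if_pos h2]
    rw [this]
    split_ifs <;> simp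
  map_zero' := by ext; simp
  map_add' M M' := by
    ext f g
    simp only [Matrix.of_apply, Matrix.add_apply]
    split_ifs <;> simp

theorem siteHom_apply (a : ι) (M : Matrix n n B) (f g : ι → n) :
    siteHom a M f g = if ∀ c, c ≠ a → f c = g c then M (f a) (g a) else 0 := rfl

/-- The factors act on distinct sites, so a single chain of intermediate states contributes: each
site passes from its initial to its final index when its turn comes. The entries need not commute,
as they will themselves be operators on other sites; hence the order is kept. -/
theorem prod_siteHom_apply (M : ι → Matrix n n B) (L : List ι) (hL : L.Nodup) (f g : ι → n) :
    (L.map fun a => siteHom a (M a)).prod f g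
      = if ∀ c, c ∉ L → f c = g c then (L.map fun a => M a (f a) (g a)).prod else 0 := by
  induction L generalizing f with
  | nil => simp [Matrix.one_apply, funext_iff]
  | cons a L ih =>
    have ha : a ∉ L := (List.nodup_cons.1 hL).1
    rw [List.map_cons, List.prod_cons, Matrix.mul_apply,
      Finset.sum_eq_single (Function.update f a (g a))]
    · rw [siteHom_apply, if_pos (fun c hc => by rw [Function.update_of_ne hc]),
        ih (List.nodup_cons.1 hL).2, Function.update_self, List.map_cons, List.prod_cons]
      have e1 : (∀ c, c ∉ L → Function.update f a (g a) c = g c)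
          ↔ ∀ c, c ∉ a :: L → f c = g c := by
        refine forall_congr' fun c => ?_
        by_cases hc : c = a
        · subst hc; simp
        · simp [hc]
      have e2 : (L.map fun b => M b (Function.update f a (g a) b) (g b))
          = L.map fun b => M b (f b) (g b) :=
        List.map_congr_left fun b hb => by
          rw [Function.update_of_ne (fun h : b = a => ha (h ▸ hb))]
      simp only [e1, e2, mul_ite, mul_zero]
    · intro h _ hh
      rw [siteHom_apply, ih (List.nodup_cons.1 hL).2]
      by_cases h1 : ∀ c, c ≠ a → f c = h c
      · rw [if_neg (c := ∀ c, c ∉ L → h c = g c), mul_zero]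
        intro h2
        refine hh (funext fun c => ?_)
        by_cases hc : c = a
        · subst hc; simp [h2 _ ha]
        · simp [hc, h1 c hc]
      · rw [if_neg h1, zero_mul]
    · simp

theorem prod_ofFn_siteHom_apply {m : ℕ} (M : Fin m → Matrix n n B) (f g : Fin m → n) :
    (List.ofFn fun a => siteHom a (M a)).prod f g
      = (List.ofFn fun a => M a (f a) (g a)).prod := by
  rw [List.ofFn_eq_map, List.ofFn_eq_map, prod_siteHom_apply _ _ (List.nodup_finRange m),
    if_pos (by simp)]

end Sites

section Separated

variable {σ R R' : Type*} [Fintype σ] [DecidableEq σ] [Ring R] [Ring R']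

/-- If the a-th factor involves only the a-th variable, one splitting of the exponent contributes.
The coefficient map is abstract, subject to the Cauchy rule, because the lemma serves both groups of
variables, with non-commuting coefficients. -/
theorem coeff_prod_separated (c : (σ →₀ ℕ) → R' → R) (h1 : ∀ s, c s 1 = if s = 0 then 1 else 0)
    (hmul : ∀ s x y, c s (x * y)
      = ∑ p ∈ Finset.HasAntidiagonal.antidiagonal s, c p.1 x * c p.2 y)
    (f : σ → R') (g : σ → ℕ → R)
    (hf : ∀ a s, c s (f a) = if s = Finsupp.single a (s a) then g a (s a) else 0)
    (L : List σ) (hL : L.Nodup) (s : σ →₀ ℕ) :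
    c s (L.map f).prod = if ∀ a, a ∉ L → s a = 0 then (L.map fun a => g a (s a)).prod else 0 := by
  induction L generalizing s with
  | nil => simp [h1, Finsupp.ext_iff]
  | cons a L ih =>
    have ha : a ∉ L := (List.nodup_cons.1 hL).1
    rw [List.map_cons, List.prod_cons, hmul,
      Finset.sum_eq_single (Finsupp.single a (s a), s.erase a)]
    · rw [hf, if_pos (by simp), ih (List.nodup_cons.1 hL).2, List.map_cons, List.prod_cons,
        Finsupp.single_eq_same]
      have e1 : (∀ c, c ∉ L → s.erase a c = 0) ↔ ∀ c, c ∉ a :: L → s c = 0 := by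
        refine forall_congr' fun c => ?_
        by_cases hc : c = a
        · subst hc; simp
        · simp [hc]
      have e2 : (L.map fun b => g b (s.erase a b)) = L.map fun b => g b (s b) :=
        List.map_congr_left fun b hb => by
          rw [Finsupp.erase_ne (fun h : b = a => ha (h ▸ hb))]
      simp only [e1, e2, mul_ite, mul_zero]
    · rintro ⟨p, q⟩ hpq hne
      rw [Finset.HasAntidiagonal.mem_antidiagonal] at hpq
      rw [hf, ih (List.nodup_cons.1 hL).2]
      by_cases hp : p = Finsupp.single a (p a)
      · rw [if_neg (c := ∀ b, b ∉ L → q b = 0), mul_zero]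
        intro hq
        apply hne
        have h3 := hq a ha
        have h4 : s a = p a := by rw [← hpq]; simp [h3]
        have h5 : p = Finsupp.single a (s a) := by rw [h4]; exact hp
        refine Prod.ext h5 ?_
        have : Finsupp.single a (s a) + q = Finsupp.single a (s a) + s.erase a := by
          rw [Finsupp.single_add_erase, ← h5]; exact hpq
        exact add_left_cancel this
      · rw [if_neg hp, zero_mul]
    · intro h
      exact absurd (Finset.HasAntidiagonal.mem_antidiagonal.2 (Finsupp.single_add_erase a s)) h

theorem coeff_prod_ofFn_separated {m : ℕ} (c : (Fin m →₀ ℕ) → R' → R)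
    (h1 : ∀ s, c s 1 = if s = 0 then 1 else 0)
    (hmul : ∀ s x y, c s (x * y)
      = ∑ p ∈ Finset.HasAntidiagonal.antidiagonal s, c p.1 x * c p.2 y)
    (f : Fin m → R') (g : Fin m → ℕ → R)
    (hf : ∀ a s, c s (f a) = if s = Finsupp.single a (s a) then g a (s a) else 0)
    (s : Fin m →₀ ℕ) :
    c s (List.ofFn f).prod = (List.ofFn fun a => g a (s a)).prod := by
  rw [List.ofFn_eq_map, List.ofFn_eq_map,
    coeff_prod_separated c h1 hmul f g hf _ (List.nodup_finRange m), if_pos (by simp)]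

end Separated

theorem sum_antidiagonal_sumElim {σ τ M : Type*} [DecidableEq σ] [DecidableEq τ] [AddCommMonoid M]
    (r : σ →₀ ℕ) (s : τ →₀ ℕ) (F : (σ ⊕ τ →₀ ℕ) → (σ ⊕ τ →₀ ℕ) → M) :
    ∑ p ∈ Finset.HasAntidiagonal.antidiagonal (r.sumElim s), F p.1 p.2
      = ∑ p ∈ Finset.HasAntidiagonal.antidiagonal r, ∑ q ∈ Finset.HasAntidiagonal.antidiagonal s,
        F (p.1.sumElim q.1) (p.2.sumElim q.2) := by
  rw [← Finset.sum_product']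
  have key : ∀ e : σ ⊕ τ →₀ ℕ,
      (Finsupp.sumFinsuppEquivProdFinsupp e).1.sumElim (Finsupp.sumFinsuppEquivProdFinsupp e).2 = e := by
    intro e
    ext (c | c) <;> rfl
  refine Finset.sum_bij'
    (fun p _ => (((Finsupp.sumFinsuppEquivProdFinsupp p.1).1, (Finsupp.sumFinsuppEquivProdFinsupp p.2).1),
      ((Finsupp.sumFinsuppEquivProdFinsupp p.1).2, (Finsupp.sumFinsuppEquivProdFinsupp p.2).2)))
    (fun q _ => (q.1.1.sumElim q.2.1, q.1.2.sumElim q.2.2)) ?_ ?_ ?_ ?_ ?_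
  · intro p hp
    rw [Finset.HasAntidiagonal.mem_antidiagonal] at hp
    simp only [Finset.mem_product, Finset.HasAntidiagonal.mem_antidiagonal]
    constructor
    · ext c
      exact DFunLike.congr_fun hp (Sum.inl c)
    · ext c
      exact DFunLike.congr_fun hp (Sum.inr c)
  · intro q hq
    simp only [Finset.mem_product, Finset.HasAntidiagonal.mem_antidiagonal] at hq ⊢
    rw [← hq.1, ← hq.2]
    ext (c | c) <;> rfl
  · intro p _
    exact Prod.ext (key _) (key _)
  · rintro ⟨⟨a, b⟩, ⟨c, d⟩⟩ _
    refine Prod.ext (Prod.ext ?_ ?_) (Prod.ext ?_ ?_) <;> ext x <;> rfl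
  · intro p _
    simp only [key]

theorem comul_prod_ofFn {A α : Type*} [Ring A] [Bialgebra ℂ A] {n : ℕ} (y : Fin n → A)
    (X : Fin n → Finset α) (u w : Fin n → α → A)
    (h : ∀ b, Coalgebra.comul (y b) = ∑ x ∈ X b, u b x ⊗ₜ[ℂ] w b x) :
    Coalgebra.comul (List.ofFn y).prod = ∑ f ∈ Fintype.piFinset X,
      (List.ofFn fun b => u b (f b)).prod ⊗ₜ[ℂ] (List.ofFn fun b => w b (f b)).prod := by
  induction n with
  | zero => simp [Algebra.TensorProduct.one_def, Bialgebra.comul_one]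
  | succ n ih =>
    rw [List.ofFn_succ, List.prod_cons, Bialgebra.comul_mul, h,
      ih (fun b => y b.succ) (fun b => X b.succ) (fun b => u b.succ) (fun b => w b.succ)
        fun b => h b.succ, Finset.sum_mul_sum, ← Finset.sum_product']
    refine Finset.sum_bij' (fun p _ => Fin.cons p.1 p.2) (fun f _ => (f 0, Fin.tail f)) ?_ ?_ ?_ ?_ ?_
    · intro p hp
      rw [Finset.mem_product] at hp
      rw [Fin.mem_piFinset_iff_zero_tail]
      exact hp
    · intro f hf
      rw [Fin.mem_piFinset_iff_zero_tail] at hf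
      exact Finset.mem_product.2 hf
    · intro p _
      simp
    · intro f _
      simp
    · intro p _
      simp [List.ofFn_succ, Algebra.TensorProduct.tmul_mul_tmul]

namespace DualYangian

/-- The monomial `S s_1 k_1 l_1 ⋯ S s_n k_n l_n`. -/
def word {n : ℕ} (s : Fin n → ℕ) (k l : Fin n → Fin N) : DualYangian N :=
  (List.ofFn fun b => S (s b) (k b) (l b)).prod

theorem comul_word {n : ℕ} (s : Fin n →₀ ℕ) (k l : Fin n → Fin N) :
    Coalgebra.comul (R := ℂ) (word s k l)
      = ∑ q : Fin n → Fin N, ∑ p ∈ Finset.HasAntidiagonal.antidiagonal s,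
        word p.1 k q ⊗ₜ[ℂ] word p.2 q l := by
  have h : ∀ b, Coalgebra.comul (R := ℂ) (S (s b) (k b) (l b))
      = ∑ x ∈ (Finset.univ : Finset (Fin N)) ×ˢ Finset.HasAntidiagonal.antidiagonal (s b),
        S x.2.1 (k b) x.1 ⊗ₜ[ℂ] S x.2.2 x.1 (l b) := by
    intro b
    refine (comulHom_S _ _ _).trans ?_
    rw [seriesMul, Finset.sum_product]
    simp
  rw [word, comul_prod_ofFn _ _ _ _ h, ← Finset.sum_product']
  refine Finset.sum_bij'
    (fun f _ => ((fun b => (f b).1), (Finsupp.equivFunOnFinite.symm fun b => (f b).2.1,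
      Finsupp.equivFunOnFinite.symm fun b => (f b).2.2)))
    (fun x _ => fun b => (x.1 b, (x.2.1 b, x.2.2 b))) ?_ ?_ ?_ ?_ ?_
  · intro f hf
    simp only [Fintype.mem_piFinset, Finset.mem_product, Finset.mem_univ, true_and,
      Finset.HasAntidiagonal.mem_antidiagonal] at hf ⊢
    ext b
    exact hf b
  · intro x hx
    simp only [Fintype.mem_piFinset, Finset.mem_product, Finset.mem_univ, true_and,
      Finset.HasAntidiagonal.mem_antidiagonal] at hx ⊢
    intro b
    rw [← hx]
    rfl
  · intro f _
    rfl
  · rintro ⟨q, p1, p2⟩ _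
    refine Prod.ext rfl (Prod.ext ?_ ?_) <;> ext x <;> rfl
  · intro f _
    rfl

theorem counit_word {n : ℕ} (s : Fin n →₀ ℕ) (k l : Fin n → Fin N) :
    Coalgebra.counit (R := ℂ) (word s k l) = if s = 0 ∧ k = l then 1 else 0 := by
  have : Coalgebra.counit (R := ℂ) (word s k l)
      = (List.ofFn fun b => seriesOne (s b) (k b) (l b)).prod := by
    change counitHom N _ = _
    rw [word, map_list_prod, List.map_ofFn]
    congr 2
    funext b
    exact counitHom_S _ _ _
  rw [this, List.prod_ofFn]
  simp only [seriesOne, Finset.prod_ite_zero, Finset.prod_const_one, Finset.mem_univ, true_imp_iff]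
  congr 1
  simp [Finsupp.ext_iff, funext_iff, forall_and]

/-- The generating series of the values of a functional at the words in the generators. -/
def genSeries (n : ℕ) (F : WithConv (DualYangian N →ₗ[ℂ] ℂ)) :
    Matrix (Fin n → Fin N) (Fin n → Fin N) (MvPowerSeries (Fin n) ℂ) :=
  Matrix.of fun k l => fun s => F (word s k l)

theorem coeff_genSeries {n : ℕ} (F : WithConv (DualYangian N →ₗ[ℂ] ℂ)) (s : Fin n →₀ ℕ)
    (k l : Fin n → Fin N) : MvPowerSeries.coeff s (genSeries n F k l) = F (word s k l) := rfl

theorem genSeries_one (n : ℕ) : genSeries n (1 : WithConv (DualYangian N →ₗ[ℂ] ℂ)) = 1 := by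
  refine Matrix.ext fun k l => MvPowerSeries.ext fun s => ?_
  rw [coeff_genSeries, LinearMap.convOne_apply, counit_word]
  by_cases h : k = l <;> by_cases h' : s = 0 <;>
    simp [h, h', Matrix.one_apply, MvPowerSeries.coeff_one]

/-- The comultiplication of a word sums over intermediate index words and over splittings of the
exponents; these two sums are the matrix product and the Cauchy product of series. -/
theorem genSeries_mul (n : ℕ) (F G : WithConv (DualYangian N →ₗ[ℂ] ℂ)) :
    genSeries n (F * G) = genSeries n F * genSeries n G := by
  refine Matrix.ext fun k l => MvPowerSeries.ext fun s => ?_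
  rw [coeff_genSeries, LinearMap.convMul_apply, comul_word, Matrix.mul_apply, map_sum]
  simp only [map_sum, TensorProduct.map_tmul, LinearMap.mul'_apply, MvPowerSeries.coeff_mul,
    coeff_genSeries]

/-- Evaluation at words is multiplicative. -/
def genSeriesHom (N n : ℕ) : WithConv (DualYangian N →ₗ[ℂ] ℂ) →*
    Matrix (Fin n → Fin N) (Fin n → Fin N) (MvPowerSeries (Fin n) ℂ) where
  toFun := genSeries n
  map_one' := genSeries_one n
  map_mul' := genSeries_mul n

end DualYangian

section Grid

variable {m n : ℕ}

theorem coeff_invSub (a : Fin m) (b : Fin n) (r : Fin m →₀ ℕ) (s : Fin n →₀ ℕ) :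
    MvPowerSeries.coeff (r.sumElim s) (invSub a b)
      = if s = Finsupp.single b (s b) ∧ r = Finsupp.single a (s b + 1) then 1 else 0 := by
  classical
  -- The support of the candidate expansion ∑ u_a^(-t-1) v_bᵗ. The candidate is identified with
  -- `invSub a b` by multiplying by 1 - u_a⁻¹ v_b.
  let P : (Fin m ⊕ Fin n →₀ ℕ) → Prop := fun e =>
    ∃ t, e = Finsupp.single (Sum.inl a) (t + 1) + Finsupp.single (Sum.inr b) t
  let D : MvPowerSeries (Fin m ⊕ Fin n) ℂ := fun e => if P e then 1 else 0
  have hD : ∀ e, MvPowerSeries.coeff e D = if P e then 1 else 0 := fun e => rfl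
  have hXX : (MvPowerSeries.X (Sum.inl a) * MvPowerSeries.X (Sum.inr b)
      : MvPowerSeries (Fin m ⊕ Fin n) ℂ)
      = MvPowerSeries.monomial (Finsupp.single (Sum.inl a) 1 + Finsupp.single (Sum.inr b) 1) 1 := by
    rw [MvPowerSeries.X, MvPowerSeries.X, MvPowerSeries.monomial_mul_monomial, one_mul]
  have hinv : invSub a b = D := by
    symm
    rw [invSub, MvPowerSeries.eq_mul_inv_iff_mul_eq (by simp), mul_sub, mul_one, hXX]
    ext e
    rw [map_sub, MvPowerSeries.coeff_mul_monomial, MvPowerSeries.coeff_X, hD, hD, mul_one]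
    by_cases h1 : e = Finsupp.single (Sum.inl a) 1
    · have hP : P e := ⟨0, by simp [h1]⟩
      rw [if_pos hP, if_pos h1, if_neg, sub_zero]
      intro hle
      have := hle (Sum.inr b)
      simp [h1] at this
    · rw [if_neg h1, sub_eq_zero]
      by_cases hP : P e
      · obtain ⟨t, ht⟩ := hP
        obtain ⟨t, rfl⟩ : ∃ t', t = t' + 1 := by
          rcases t with _ | t
          · exact absurd (by simpa using ht) h1
          · exact ⟨t, rfl⟩
        have he : e = Finsupp.single (Sum.inl a) (t + 1) + Finsupp.single (Sum.inr b) t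
            + (Finsupp.single (Sum.inl a) 1 + Finsupp.single (Sum.inr b) 1) := by
          rw [ht, Finsupp.single_add, Finsupp.single_add (Sum.inr b)]
          abel
        rw [if_pos ⟨_, ht⟩, if_pos (he ▸ le_add_self), if_pos]
        exact ⟨t, by rw [he, add_tsub_cancel_right]⟩
      · rw [if_neg hP]
        split_ifs with hle hP'
        · exfalso
          obtain ⟨t, ht⟩ := hP'
          apply hP
          refine ⟨t + 1, ?_⟩
          rw [← tsub_add_cancel_of_le hle, ht, Finsupp.single_add _ (t + 1),
            Finsupp.single_add (Sum.inr b)]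
          abel
        · rfl
        · rfl
  rw [hinv, hD]
  refine if_congr ?_ rfl rfl
  constructor
  · rintro ⟨t, ht⟩
    rw [← Finsupp.sumElim_single_single] at ht
    have hr : r = Finsupp.single a (t + 1) := by
      ext c
      exact DFunLike.congr_fun ht (Sum.inl c)
    have hs : s = Finsupp.single b t := by
      ext c
      exact DFunLike.congr_fun ht (Sum.inr c)
    have : s b = t := by rw [hs]; simp
    rw [this]
    exact ⟨hs, hr⟩
  · rintro ⟨hs, hr⟩
    refine ⟨s b, ?_⟩
    rw [← Finsupp.sumElim_single_single, ← hr, ← hs]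

/-- The vector representation in the variable `u_a⁻¹` at the series in `v_b`. -/
def gridMatrix (N : ℕ) (a : Fin m) (b : Fin n) (k l : Fin N) :
    Matrix (Fin N) (Fin N) (MvPowerSeries (Fin m ⊕ Fin n) ℂ) :=
  Matrix.of fun i j => (if i = j ∧ k = l then 1 else 0) - if i = l ∧ k = j then invSub a b else 0

/-- The block form of a matrix. -/
def blockEquiv (N m n : ℕ) : TensorSeries N m n ≃+* Matrix (Fin m → Fin N) (Fin m → Fin N)
    (Matrix (Fin n → Fin N) (Fin n → Fin N) (MvPowerSeries (Fin m ⊕ Fin n) ℂ)) :=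
  (Matrix.reindexAlgEquiv ℂ _ (Equiv.sumArrowEquivProdArrow (Fin m) (Fin n) (Fin N))).toRingEquiv.trans
    (Matrix.compRingEquiv _ _ _).symm

theorem blockEquiv_apply (M : TensorSeries N m n) (i j : Fin m → Fin N) (k l : Fin n → Fin N) :
    blockEquiv N m n M i j k l = M (Sum.elim i k) (Sum.elim j l) := rfl

/-- Exchange of the roles of two tensor factors. -/
def flipEquiv (I J K : Type*) [Fintype I] [Fintype J] [DecidableEq I] [DecidableEq J] [CommRing K] :
    Matrix I I (Matrix J J K) ≃+* Matrix J J (Matrix I I K) :=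
  (Matrix.compRingEquiv I J K).trans
    ((Matrix.reindexAlgEquiv K _ (Equiv.prodComm I J)).toRingEquiv.trans
    (Matrix.compRingEquiv J I K).symm)

/-- Seen from the left site a, the entries of R are operators on the right sites, which in turn act
on site b only. The flip is needed because `gridMatrix` is indexed by the right site first. -/
theorem blockEquiv_yangR (a : Fin m) (b : Fin n) :
    blockEquiv N m n (yangR N a b)
      = siteHom a ((flipEquiv _ _ _).symm (siteHom b (Matrix.of (gridMatrix N a b)))) := by
  refine Matrix.ext fun i j => Matrix.ext fun k l => ?_
  rw [blockEquiv_apply]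
  have e1 : siteHom a ((flipEquiv _ _ _).symm (siteHom b (Matrix.of (gridMatrix N a b)))) i j k l
      = if (∀ c, c ≠ a → i c = j c) ∧ ∀ c, c ≠ b → k c = l c
        then gridMatrix N a b (k b) (l b) (i a) (j a) else 0 := by
    rw [siteHom_apply]
    by_cases h1 : ∀ c, c ≠ a → i c = j c
    · rw [if_pos h1]
      change (siteHom b (Matrix.of (gridMatrix N a b)) k l) (i a) (j a) = _
      rw [siteHom_apply]
      by_cases h2 : ∀ c, c ≠ b → k c = l c
      · rw [if_pos h2, if_pos ⟨h1, h2⟩]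
        rfl
      · rw [if_neg h2, if_neg fun h => h2 h.2]
        rfl
    · rw [if_neg h1, if_neg fun h => h1 h.1]
      rfl
  refine Eq.trans ?_ e1.symm
  have h1 : (1 : TensorSeries N m n) (Sum.elim i k) (Sum.elim j l)
      = if (∀ c, c ≠ a → i c = j c) ∧ ∀ c, c ≠ b → k c = l c then
        (if i a = j a ∧ k b = l b then 1 else 0) else 0 := by
    rw [Matrix.one_apply, ← ite_and]
    refine if_congr ?_ rfl rfl
    rw [Sum.elim_eq_iff, funext_iff, funext_iff]
    constructor
    · rintro ⟨h1, h2⟩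
      exact ⟨⟨fun c _ => h1 c, fun c _ => h2 c⟩, h1 a, h2 b⟩
    · rintro ⟨⟨h1, h2⟩, h3, h4⟩
      refine ⟨fun c => ?_, fun c => ?_⟩
      · by_cases hc : c = a
        · rw [hc, h3]
        · exact h1 c hc
      · by_cases hc : c = b
        · rw [hc, h4]
        · exact h2 c hc
  have h2 : permOp N a b (Sum.elim i k) (Sum.elim j l)
      = if (∀ c, c ≠ a → i c = j c) ∧ ∀ c, c ≠ b → k c = l c then
        (if i a = l b ∧ k b = j a then 1 else 0) else 0 := by
    rw [permOp, Matrix.of_apply, ← ite_and]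
    refine if_congr ?_ rfl rfl
    rw [funext_iff, Sum.forall]
    constructor
    · rintro ⟨h1, h2⟩
      refine ⟨⟨fun c hc => ?_, fun c hc => ?_⟩, ?_, ?_⟩
      · simpa [Equiv.swap_apply_of_ne_of_ne, hc] using h1 c
      · simpa [Equiv.swap_apply_of_ne_of_ne, hc] using h2 c
      · simpa using h1 a
      · simpa using h2 b
    · rintro ⟨⟨h1, h2⟩, h3, h4⟩
      refine ⟨fun c => ?_, fun c => ?_⟩
      · by_cases hc : c = a
        · subst hc; simpa using h3
        · simpa [Equiv.swap_apply_of_ne_of_ne, hc] using h1 c hc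
      · by_cases hc : c = b
        · subst hc; simpa using h4
        · simpa [Equiv.swap_apply_of_ne_of_ne, hc] using h2 c hc
  rw [yangR, Matrix.sub_apply, Matrix.smul_apply, h1, h2, gridMatrix, Matrix.of_apply]
  by_cases h : (∀ c, c ≠ a → i c = j c) ∧ ∀ c, c ≠ b → k c = l c
  · simp only [if_pos h]
    by_cases h' : i a = l b ∧ k b = j a
    · simp only [if_pos h', smul_eq_mul, mul_one]
    · simp only [if_neg h', smul_zero]
  · simp only [if_neg h, smul_zero, sub_zero]

/-- For fixed a, the product over b stays on the left site a. The inner product thus runs over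
distinct right sites and the outer one over distinct left sites, so `prod_ofFn_siteHom_apply`
applies twice, over two different non-commutative coefficient rings. -/
theorem yangRProd_apply (i j : Fin m → Fin N) (k l : Fin n → Fin N) :
    yangRProd N m n (Sum.elim i k) (Sum.elim j l)
      = (List.ofFn fun a : Fin m => (Matrix.of fun k l : Fin n → Fin N =>
          (List.ofFn fun b : Fin n => gridMatrix N a b (k b) (l b)).prod (i a) (j a))).prod k l := by
  refine (blockEquiv_apply (yangRProd N m n) i j k l).symm.trans ?_
  rw [yangRProd, map_list_prod, List.map_ofFn]
  have h : ∀ a : Fin m, (blockEquiv N m n) (List.ofFn fun b : Fin n => yangR N a b).prod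
      = siteHom a (Matrix.of fun i j => Matrix.of fun k l : Fin n → Fin N =>
          (List.ofFn fun b : Fin n => gridMatrix N a b (k b) (l b)).prod i j) := by
    intro a
    rw [map_list_prod, List.map_ofFn]
    have : (⇑(blockEquiv N m n) ∘ fun b => yangR N a b)
        = (siteHom a).comp (flipEquiv (Fin N) (Fin n → Fin N)
          (MvPowerSeries (Fin m ⊕ Fin n) ℂ)).symm.toRingHom ∘
          fun b => siteHom b (Matrix.of (gridMatrix N a b)) :=
      funext fun b => blockEquiv_yangR a b
    rw [this, ← List.map_ofFn, ← map_list_prod, RingHom.comp_apply]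
    congr 1
    refine Matrix.ext fun i j => Matrix.ext fun k l => ?_
    have h := prod_ofFn_siteHom_apply
      (B := Matrix (Fin N) (Fin N) (MvPowerSeries (Fin m ⊕ Fin n) ℂ))
      (fun b : Fin n => Matrix.of (gridMatrix N a b)) k l
    exact congrArg (fun M : Matrix (Fin N) (Fin N) (MvPowerSeries (Fin m ⊕ Fin n) ℂ) => M i j) h
  have h' : (⇑(blockEquiv N m n) ∘ fun a : Fin m => (List.ofFn fun b : Fin n => yangR N a b).prod)
      = fun a => siteHom a (Matrix.of fun i j => Matrix.of fun k l : Fin n → Fin N =>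
          (List.ofFn fun b : Fin n => gridMatrix N a b (k b) (l b)).prod i j) := funext h
  rw [h']
  exact congrArg (fun M : Matrix (Fin n → Fin N) (Fin n → Fin N)
    (MvPowerSeries (Fin m ⊕ Fin n) ℂ) => M k l) (prod_ofFn_siteHom_apply
      (B := Matrix (Fin n → Fin N) (Fin n → Fin N) (MvPowerSeries (Fin m ⊕ Fin n) ℂ)) _ i j)

/-- The coefficients at a monomial in the second set of variables. -/
def coeffRight {I : Type*} (s : Fin n →₀ ℕ)
    (M : Matrix I I (MvPowerSeries (Fin m ⊕ Fin n) ℂ)) : Matrix I I (MvPowerSeries (Fin m) ℂ) :=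
  Matrix.of fun i j => fun r => MvPowerSeries.coeff (r.sumElim s) (M i j)

/-- The coefficients at a monomial in the first set of variables. -/
def coeffLeft {I : Type*} (r : Fin m →₀ ℕ)
    (M : Matrix I I (MvPowerSeries (Fin m ⊕ Fin n) ℂ)) : Matrix I I (MvPowerSeries (Fin n) ℂ) :=
  Matrix.of fun i j => fun s => MvPowerSeries.coeff (r.sumElim s) (M i j)

theorem coeff_coeffRight {I : Type*} (r : Fin m →₀ ℕ) (s : Fin n →₀ ℕ)
    (M : Matrix I I (MvPowerSeries (Fin m ⊕ Fin n) ℂ)) (i j : I) :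
    MvPowerSeries.coeff r (coeffRight s M i j) = MvPowerSeries.coeff (r.sumElim s) (M i j) := rfl

theorem coeff_coeffLeft {I : Type*} (r : Fin m →₀ ℕ) (s : Fin n →₀ ℕ)
    (M : Matrix I I (MvPowerSeries (Fin m ⊕ Fin n) ℂ)) (i j : I) :
    MvPowerSeries.coeff s (coeffLeft r M i j) = MvPowerSeries.coeff (r.sumElim s) (M i j) := rfl

theorem sumElim_eq_zero_iff (r : Fin m →₀ ℕ) (s : Fin n →₀ ℕ) :
    r.sumElim s = 0 ↔ r = 0 ∧ s = 0 := by
  simp [Finsupp.ext_iff]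

theorem coeffRight_one {I : Type*} [Fintype I] [DecidableEq I] (s : Fin n →₀ ℕ) :
    coeffRight (m := m) s (1 : Matrix I I _) = if s = 0 then 1 else 0 := by
  refine Matrix.ext fun i j => MvPowerSeries.ext fun r => ?_
  rw [coeff_coeffRight]
  by_cases h : i = j <;> by_cases hs : s = 0 <;>
    simp [h, hs, MvPowerSeries.coeff_one, sumElim_eq_zero_iff, Matrix.one_apply]

theorem coeffLeft_one {I : Type*} [Fintype I] [DecidableEq I] (r : Fin m →₀ ℕ) :
    coeffLeft (n := n) r (1 : Matrix I I _) = if r = 0 then 1 else 0 := by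
  refine Matrix.ext fun i j => MvPowerSeries.ext fun s => ?_
  rw [coeff_coeffLeft]
  by_cases h : i = j <;> by_cases hs : r = 0 <;>
    simp [h, hs, MvPowerSeries.coeff_one, sumElim_eq_zero_iff, Matrix.one_apply]

theorem coeffRight_mul {I : Type*} [Fintype I] [DecidableEq I] (s : Fin n →₀ ℕ)
    (M M' : Matrix I I (MvPowerSeries (Fin m ⊕ Fin n) ℂ)) : coeffRight s (M * M')
      = ∑ p ∈ Finset.HasAntidiagonal.antidiagonal s, coeffRight p.1 M * coeffRight p.2 M' := by
  refine Matrix.ext fun i j => MvPowerSeries.ext fun r => ?_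
  rw [coeff_coeffRight, Matrix.mul_apply, Matrix.sum_apply, map_sum, map_sum]
  simp only [Matrix.mul_apply, map_sum, MvPowerSeries.coeff_mul, coeff_coeffRight]
  refine Eq.trans ?_ Finset.sum_comm
  refine Finset.sum_congr rfl fun h _ => ?_
  refine Eq.trans ?_ Finset.sum_comm
  exact sum_antidiagonal_sumElim r s
    fun x y => MvPowerSeries.coeff x (M i h) * MvPowerSeries.coeff y (M' h j)

theorem coeffLeft_mul {I : Type*} [Fintype I] [DecidableEq I] (r : Fin m →₀ ℕ)
    (M M' : Matrix I I (MvPowerSeries (Fin m ⊕ Fin n) ℂ)) : coeffLeft r (M * M')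
      = ∑ p ∈ Finset.HasAntidiagonal.antidiagonal r, coeffLeft p.1 M * coeffLeft p.2 M' := by
  refine Matrix.ext fun i j => MvPowerSeries.ext fun s => ?_
  rw [coeff_coeffLeft, Matrix.mul_apply, Matrix.sum_apply, map_sum, map_sum]
  simp only [Matrix.mul_apply, map_sum, MvPowerSeries.coeff_mul, coeff_coeffLeft]
  refine Eq.trans ?_ Finset.sum_comm
  refine Finset.sum_congr rfl fun h _ => ?_
  exact sum_antidiagonal_sumElim r s
    fun x y => MvPowerSeries.coeff x (M i h) * MvPowerSeries.coeff y (M' h j)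

theorem coeff_aeval_X {σ : Type*} [DecidableEq σ] (a : σ) (p : Polynomial ℂ) (r : σ →₀ ℕ) :
    MvPowerSeries.coeff r (Polynomial.aeval (MvPowerSeries.X a : MvPowerSeries σ ℂ) p)
      = if r = Finsupp.single a (r a) then p.coeff (r a) else 0 := by
  induction p using Polynomial.induction_on' with
  | add p q hp hq =>
    rw [map_add, map_add, hp, hq, Polynomial.coeff_add]
    split_ifs <;> simp
  | monomial k c =>
    rw [Polynomial.aeval_monomial, ← Algebra.smul_def, map_smul, MvPowerSeries.coeff_X_pow,
      Polynomial.coeff_monomial]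
    by_cases h : r = Finsupp.single a k
    · have : r a = k := by rw [h]; simp
      simp [this, ← h]
    · rw [if_neg h, smul_zero]
      split_ifs with h1 h2
      · exact absurd (h2 ▸ h1) h
      · rfl
      · rfl

open DualYangian in
theorem coeffRight_gridMatrix (a : Fin m) (b : Fin n) (k l : Fin N) (s : Fin n →₀ ℕ) :
    coeffRight s (gridMatrix N a b k l) = if s = Finsupp.single b (s b) then
      (Polynomial.aeval (MvPowerSeries.X a : MvPowerSeries (Fin m) ℂ)).mapMatrix
        (vecRep N (S (s b) k l)) else 0 := by
  refine Matrix.ext fun i j => MvPowerSeries.ext fun r => ?_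
  have e : MvPowerSeries.coeff r ((if s = Finsupp.single b (s b) then
      (Polynomial.aeval (MvPowerSeries.X a : MvPowerSeries (Fin m) ℂ)).mapMatrix
        (vecRep N (S (s b) k l)) else 0 : Matrix (Fin N) (Fin N) (MvPowerSeries (Fin m) ℂ)) i j)
      = if s = Finsupp.single b (s b) then
        (if s b = 0 ∧ k = l ∧ i = j then (if r = 0 then 1 else 0) else 0)
        - if i = l ∧ j = k then (if r = Finsupp.single a (s b + 1) then 1 else 0) else 0 else 0 := by
    by_cases h : s = Finsupp.single b (s b)
    · simp only [if_pos h]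
      rw [AlgHom.mapMatrix_apply, Matrix.map_apply, vecRep_S_apply]
      simp only [map_sub, apply_ite (Polynomial.aeval (MvPowerSeries.X a : MvPowerSeries (Fin m) ℂ)),
        map_one, map_zero, map_pow, Polynomial.aeval_X, apply_ite (MvPowerSeries.coeff r),
        MvPowerSeries.coeff_X_pow, MvPowerSeries.coeff_one]
    · simp only [if_neg h]
      simp
  rw [e, coeff_coeffRight, gridMatrix, Matrix.of_apply, map_sub,
    apply_ite (MvPowerSeries.coeff (r.sumElim s)), apply_ite (MvPowerSeries.coeff (r.sumElim s)),
    coeff_invSub, MvPowerSeries.coeff_one, map_zero]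
  simp only [sumElim_eq_zero_iff]
  have h0 : s = 0 ↔ s = Finsupp.single b (s b) ∧ s b = 0 := by
    constructor
    · rintro rfl
      simp
    · rintro ⟨h1, h2⟩
      rw [h1, h2, Finsupp.single_zero]
  by_cases h : s = Finsupp.single b (s b)
  swap
  · have : s ≠ 0 := fun e => h (h0.1 e).1
    simp [h, this]
  have h0' : s = 0 ↔ s b = 0 := h0.trans (and_iff_right h)
  simp only [h0', if_pos h, and_iff_right h]
  clear h h0 h0' e
  by_cases h2 : s b = 0 <;> by_cases h3 : i = j <;>
    by_cases h4 : k = l <;> by_cases h5 : i = l <;> by_cases h6 : k = j <;>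
    simp [h2, h3, h4, h5, h6, eq_comm]

open DualYangian in
-- For fixed a the factors are the images of the series T*(v_b) under one homomorphism, the vector
-- representation at u_a. Their product is the image of a word, and its coefficients in u_a⁻¹ are
-- values of `vecCoeff`.
theorem coeffLeft_of_gridMatrix (a : Fin m) (i j : Fin N) (r : Fin m →₀ ℕ) :
    coeffLeft r (Matrix.of fun k l : Fin n → Fin N =>
          (List.ofFn fun b : Fin n => gridMatrix N a b (k b) (l b)).prod i j)
      = if r = Finsupp.single a (r a) then genSeries n (vecCoeff (r a) i j) else 0 := by
  refine Matrix.ext fun k l => MvPowerSeries.ext fun s => ?_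
  rw [coeff_coeffLeft, Matrix.of_apply, ← coeff_coeffRight,
    coeff_prod_ofFn_separated coeffRight coeffRight_one coeffRight_mul
      (fun b : Fin n => gridMatrix N a b (k b) (l b))
      (fun b s => (Polynomial.aeval (MvPowerSeries.X a : MvPowerSeries (Fin m) ℂ)).mapMatrix
        (vecRep N (S s (k b) (l b)))) (fun b s => coeffRight_gridMatrix a b (k b) (l b) s)]
  have : (List.ofFn fun b => (Polynomial.aeval
        (MvPowerSeries.X a : MvPowerSeries (Fin m) ℂ)).mapMatrix (vecRep N (S (s b) (k b) (l b)))).prod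
      = (Polynomial.aeval (MvPowerSeries.X a : MvPowerSeries (Fin m) ℂ)).mapMatrix
        (vecRep N (word s k l)) := by
    rw [word, map_list_prod, map_list_prod, List.map_ofFn, List.map_ofFn]
    rfl
  rw [this, AlgHom.mapMatrix_apply, Matrix.map_apply, coeff_aeval_X]
  split_ifs <;> rfl

open DualYangian in
theorem canonicalPairing_isCanonicalPairing : IsCanonicalPairing (canonicalPairing N) := by
  intro m n i j k l r s
  have e : Finsupp.equivFunOnFinite.symm (Sum.elim r s)
      = (Finsupp.equivFunOnFinite.symm r).sumElim (Finsupp.equivFunOnFinite.symm s) := by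
    ext (c | c) <;> rfl
  rw [e, yangRProd_apply, ← coeff_coeffLeft,
    coeff_prod_ofFn_separated coeffLeft coeffLeft_one coeffLeft_mul _
      (fun a r => genSeries n (vecCoeff r (i a) (j a)))
      (fun a r => coeffLeft_of_gridMatrix a (i a) (j a) r)]
  -- Evaluation at words and `convHom` are both multiplicative, so the product of generating series
  -- over a is the generating series of the functional defined by the whole Yangian monomial.
  have : (List.ofFn fun a => genSeries n (vecCoeff ((Finsupp.equivFunOnFinite.symm r) a)
      (i a) (j a))).prod = genSeriesHom N n (convHom N
        (List.ofFn fun a => Yangian.T (r a) (i a) (j a)).prod) := by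
    rw [map_list_prod, map_list_prod, List.map_ofFn, List.map_ofFn]
    congr 2
    funext a
    exact (congrArg (genSeries n) (convHom_T (r a) (i a) (j a))).symm
  rw [this]
  rfl

theorem exists_prod_ofFn_of_mem_closure {M α : Type*} [Monoid M] {f : α → M} {x : M}
    (hx : x ∈ Submonoid.closure (Set.range f)) :
    ∃ (m : ℕ) (a : Fin m → α), (List.ofFn fun c => f (a c)).prod = x := by
  obtain ⟨l, hl, rfl⟩ := Submonoid.exists_list_of_mem_closure hx
  have : ∀ c : Fin l.length, ∃ a, f a = l[c] := fun c => hl _ (List.getElem_mem _)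
  choose g hg using this
  refine ⟨l.length, g, ?_⟩
  simp only [hg, Fin.getElem_fin, List.ofFn_getElem]

theorem IsCanonicalPairing.eq {β β' : Yangian N →ₗ[ℂ] DualYangian N →ₗ[ℂ] ℂ}
    (h : IsCanonicalPairing β) (h' : IsCanonicalPairing β') : β = β' := by
  have hY : Submodule.span ℂ (Submonoid.closure (Set.range fun g : ℕ × Fin N × Fin N =>
      Yangian.T g.1 g.2.1 g.2.2) : Set (Yangian N)) = ⊤ := by
    rw [← Algebra.adjoin_eq_span, Yangian.adjoin_T, Algebra.top_toSubmodule]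
  have hZ : Submodule.span ℂ (Submonoid.closure (Set.range fun g : ℕ × Fin N × Fin N =>
      DualYangian.S g.1 g.2.1 g.2.2) : Set (DualYangian N)) = ⊤ := by
    rw [← Algebra.adjoin_eq_span, DualYangian.adjoin_S, Algebra.top_toSubmodule]
  refine LinearMap.ext_on hY fun x hx => LinearMap.ext_on hZ fun z hz => ?_
  obtain ⟨m, f, rfl⟩ := exists_prod_ofFn_of_mem_closure hx
  obtain ⟨n, g, rfl⟩ := exists_prod_ofFn_of_mem_closure hz
  exact (h m n _ _ _ _ _ _).trans (h' m n _ _ _ _ _ _).symm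

end Grid

/-! ### Degrees of words and the pairing with a single generator -/

@[simp]
theorem wordDegree_nil : wordDegree ([] : List (GenIndex N)) = 0 := rfl

@[simp]
theorem wordDegree_cons (g : GenIndex N) (w : List (GenIndex N)) :
    wordDegree (g :: w) = g.1 + wordDegree w := by
  simp [wordDegree]

@[simp]
theorem wordDegree_append (w w' : List (GenIndex N)) :
    wordDegree (w ++ w') = wordDegree w + wordDegree w' := by
  simp [wordDegree]

theorem wordDegree_perm {w w' : List (GenIndex N)} (h : w.Perm w') :
    wordDegree w = wordDegree w' :=
  (h.map _).sum_eq

theorem length_le_wordDegree (w : List (GenIndex N)) : w.length ≤ wordDegree w := by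
  induction w with
  | nil => simp
  | cons g w ih =>
    have := g.1.pos
    simp only [List.length_cons, wordDegree_cons]
    omega

namespace DualYangian

@[simp]
theorem monomial_nil : monomial ([] : List (GenIndex N)) = 1 := rfl

@[simp]
theorem monomial_cons (g : GenIndex N) (w : List (GenIndex N)) :
    monomial (g :: w) = T g.1 g.2.1 g.2.2 * monomial w := by
  simp [monomial]

theorem monomial_append (w w' : List (GenIndex N)) :
    monomial (w ++ w') = monomial w * monomial w' := by
  simp [monomial]

theorem counit_T (r : ℕ+) (i j : Fin N) : Coalgebra.counit (R := ℂ) (T r i j) = 0 := by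
  obtain ⟨r, rfl⟩ : ∃ q : ℕ, r = q.succPNat := ⟨r.natPred, (PNat.succPNat_natPred r).symm⟩
  change counitHom N _ = 0
  have h := counitHom_S (N := N) r i j
  rw [S, map_add, seriesOne] at h
  have h2 : counitHom N (if r = 0 ∧ i = j then 1 else 0) = if r = 0 ∧ i = j then 1 else 0 := by
    split_ifs <;> simp
  rw [h2] at h
  simpa using h

/-- Each T^(-r) acts by a multiple of a matrix unit times u⁻ʳ, so the degree of a word is exactly
the exponent of u⁻¹. This is why T^(r) pairs only with words of degree r. -/
theorem vecRep_monomial_apply (z : List (GenIndex N)) (i j : Fin N) :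
    ∃ c : ℂ, vecRep N (monomial z) i j = Polynomial.monomial (wordDegree z) c := by
  induction z generalizing i with
  | nil =>
    refine ⟨(1 : Matrix (Fin N) (Fin N) ℂ) i j, ?_⟩
    rw [monomial_nil, map_one, Matrix.one_apply, Matrix.one_apply]
    split_ifs <;> simp
  | cons g z ih =>
    rw [monomial_cons, map_mul, vecRep_T, neg_mul, Matrix.neg_apply]
    by_cases h : i = g.2.2
    · obtain ⟨c, hc⟩ := ih g.2.1
      refine ⟨-c, ?_⟩
      rw [h, Matrix.single_mul_apply_same, hc, wordDegree_cons, ← Polynomial.monomial_one_right_eq_X_pow,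
        Polynomial.monomial_mul_monomial, one_mul, Polynomial.monomial_neg]
    · refine ⟨0, ?_⟩
      rw [Matrix.single_mul_apply_of_ne _ _ _ _ _ h]
      simp

end DualYangian

namespace Yangian

@[simp]
theorem monomial_nil : monomial ([] : List (GenIndex N)) = 1 := rfl

@[simp]
theorem monomial_cons (g : GenIndex N) (w : List (GenIndex N)) :
    monomial (g :: w) = T g.1 g.2.1 g.2.2 * monomial w := by
  simp [monomial]

theorem monomial_append (w w' : List (GenIndex N)) :
    monomial (w ++ w') = monomial w * monomial w' := by
  simp [monomial]

end Yangian

theorem canonicalPairing_T_monomial_eq_zero {r : ℕ} {z : List (GenIndex N)} (h : wordDegree z ≠ r)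
    (i j : Fin N) : canonicalPairing N (Yangian.T r i j) (DualYangian.monomial z) = 0 := by
  obtain ⟨c, hc⟩ := DualYangian.vecRep_monomial_apply z i j
  rw [canonicalPairing_T, hc, Polynomial.coeff_monomial, if_neg h]

theorem canonicalPairing_T_T (r s : ℕ+) (i j k l : Fin N) :
    canonicalPairing N (Yangian.T r i j) (DualYangian.T s k l)
      = if (s, k, l) = (r, j, i) then -1 else 0 := by
  rw [canonicalPairing_T, DualYangian.vecRep_T, Matrix.neg_apply, Matrix.single_apply,
    Polynomial.coeff_neg]
  by_cases h : l = i ∧ k = j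
  · rw [if_pos h, Polynomial.coeff_X_pow]
    by_cases hr : (r : ℕ) = s
    · rw [if_pos hr, if_pos]
      rw [h.1, h.2, PNat.coe_injective hr]
    · rw [if_neg hr, if_neg, neg_zero]
      intro e
      simp only [Prod.mk.injEq] at e
      exact hr (by rw [e.1])
  · rw [if_neg h, if_neg]
    · simp
    · intro e
      simp only [Prod.mk.injEq] at e
      exact h ⟨e.2.2, e.2.1⟩

/-! ### Leading terms of the comultiplication -/

/-- The ways to distribute the letters of a word over two subwords. -/
def splits {α : Type*} : List α → List (List α × List α)
  | [] => [([], [])]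
  | g :: z => (splits z).map (fun x => (g :: x.1, x.2)) ++ (splits z).map (fun x => (x.1, g :: x.2))

theorem perm_of_mem_splits {α : Type*} {z : List α} {x : List α × List α} (h : x ∈ splits z) :
    (x.1 ++ x.2).Perm z := by
  induction z generalizing x with
  | nil =>
    simp only [splits, List.mem_singleton] at h
    simp [h]
  | cons g z ih =>
    simp only [splits, List.mem_append, List.mem_map] at h
    rcases h with ⟨y, hy, rfl⟩ | ⟨y, hy, rfl⟩
    · exact (ih hy).cons g
    · exact List.perm_middle.trans ((ih hy).cons g)

theorem nil_mem_splits {α : Type*} (z : List α) : ([], z) ∈ splits z := by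
  induction z with
  | nil => simp [splits]
  | cons g z ih =>
    simp only [splits, List.mem_append, List.mem_map]
    exact Or.inr ⟨_, ih, rfl⟩

theorem singleton_erase_mem_splits {α : Type*} [BEq α] [LawfulBEq α] {z : List α} {g : α} (h : g ∈ z) :
    ([g], z.erase g) ∈ splits z := by
  induction z with
  | nil => simp at h
  | cons a z ih =>
    simp only [splits, List.mem_append, List.mem_map]
    by_cases e : a = g
    · subst e
      exact Or.inl ⟨_, nil_mem_splits z, by simp⟩
    · refine Or.inr ⟨_, ih ((List.mem_cons.1 h).resolve_left (Ne.symm e)), ?_⟩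
      rw [List.erase_cons_tail (by simpa using e)]

namespace DualYangian

/-- The descending filtration of the tensor square. -/
def tensorFil (N d : ℕ) : Submodule ℂ (DualYangian N ⊗[ℂ] DualYangian N) :=
  Submodule.span ℂ ((fun x : List (GenIndex N) × List (GenIndex N) =>
    monomial x.1 ⊗ₜ[ℂ] monomial x.2) '' {x | d ≤ wordDegree x.1 + wordDegree x.2})

theorem tmul_mem_tensorFil {d : ℕ} {p q : List (GenIndex N)} (h : d ≤ wordDegree p + wordDegree q) :
    monomial p ⊗ₜ[ℂ] monomial q ∈ tensorFil N d :=
  Submodule.subset_span ⟨(p, q), h, rfl⟩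

theorem tensorFil_anti {d e : ℕ} (h : d ≤ e) : tensorFil N e ≤ tensorFil N d :=
  Submodule.span_mono (Set.image_mono fun _ hx => h.trans hx)

theorem mul_mem_tensorFil {d e : ℕ} {x y : DualYangian N ⊗[ℂ] DualYangian N}
    (hx : x ∈ tensorFil N d) (hy : y ∈ tensorFil N e) : x * y ∈ tensorFil N (d + e) := by
  have h := Submodule.mul_mem_mul hx hy
  rw [tensorFil, tensorFil, Submodule.span_mul_span] at h
  refine Submodule.span_le.2 ?_ h
  rintro _ ⟨_, ⟨p, hp, rfl⟩, _, ⟨q, hq, rfl⟩, rfl⟩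
  simp only [Algebra.TensorProduct.tmul_mul_tmul, ← monomial_append, SetLike.mem_coe]
  apply tmul_mem_tensorFil
  simp only [wordDegree_append, Set.mem_ofPred_eq] at hp hq ⊢
  omega

theorem seriesMul_one_add {A : Type*} [Ring A] (a b : ℕ → Fin N → Fin N → A) (r : ℕ) (i j : Fin N) :
    seriesMul (fun r i j => seriesOne r i j + a r i j) (fun r i j => seriesOne r i j + b r i j) r i j
      = seriesOne r i j + a r i j + b r i j + seriesMul a b r i j := by
  have h1 := congrFun (congrFun (congrFun (seriesMul_one (seriesOne (N := N) (A := A))) r) i) j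
  have h2 := congrFun (congrFun (congrFun (seriesMul_one a) r) i) j
  have h3 := congrFun (congrFun (congrFun (one_seriesMul b) r) i) j
  rw [← h2, ← h3]
  refine Eq.trans ?_ (congrArg (fun x => x + seriesMul a seriesOne r i j
    + seriesMul seriesOne b r i j + seriesMul a b r i j) h1)
  simp only [seriesMul, add_mul, mul_add, Finset.sum_add_distrib]
  abel

/-- The correction is a sum of T^(-p) ⊗ T^(-q) with p + q = r + 1: since T^(-1) is attached to v⁰,
multiplying two series raises the degree by one. -/
theorem comul_T_sub_mem (r : ℕ+) (i j : Fin N) :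
    Coalgebra.comul (R := ℂ) (T r i j) - (T r i j ⊗ₜ 1 + 1 ⊗ₜ T r i j) ∈ tensorFil N (r + 1) := by
  obtain ⟨r, rfl⟩ : ∃ q : ℕ, r = q.succPNat := ⟨r.natPred, (PNat.succPNat_natPred r).symm⟩
  have hT : T r.succPNat i j = S r i j - if r = 0 ∧ i = j then 1 else 0 := by simp [S]
  have key : Coalgebra.comul (R := ℂ) (T r.succPNat i j)
      - (T r.succPNat i j ⊗ₜ 1 + 1 ⊗ₜ T r.succPNat i j)
      = ∑ k, ∑ p ∈ Finset.HasAntidiagonal.antidiagonal r,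
        T p.1.succPNat i k ⊗ₜ[ℂ] T p.2.succPNat k j := by
    have hS : ∀ r i j, (S r i j : DualYangian N) = seriesOne r i j + T r.succPNat i j := by
      intro r i j
      simp [S, seriesOne]
    have e := comulHom_S (N := N) r i j
    have e1 : ∀ r i j, (S r i j : DualYangian N) ⊗ₜ[ℂ] (1 : DualYangian N)
        = seriesOne r i j + T r.succPNat i j ⊗ₜ[ℂ] 1 := by
      intro r i j
      rw [hS, TensorProduct.add_tmul]
      unfold seriesOne
      split_ifs <;> simp [Algebra.TensorProduct.one_def]
    have e2 : ∀ r i j, (1 : DualYangian N) ⊗ₜ[ℂ] (S r i j : DualYangian N)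
        = seriesOne r i j + 1 ⊗ₜ[ℂ] T r.succPNat i j := by
      intro r i j
      rw [hS, TensorProduct.tmul_add]
      unfold seriesOne
      split_ifs <;> simp [Algebra.TensorProduct.one_def]
    simp only [e1, e2] at e
    rw [seriesMul_one_add, hS, map_add] at e
    have e3 : comulHom N (seriesOne r i j) = seriesOne r i j := by
      unfold seriesOne
      split_ifs <;> simp
    rw [e3, add_assoc, add_assoc, add_right_inj] at e
    change comulHom N _ - _ = _
    rw [e, ← add_assoc, add_sub_cancel_left]
    simp [seriesMul]
  rw [key]
  refine Submodule.sum_mem _ fun k _ => Submodule.sum_mem _ fun p hp => ?_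
  have := tmul_mem_tensorFil (N := N) (d := r + 1 + 1)
    (p := [(p.1.succPNat, i, k)]) (q := [(p.2.succPNat, k, j)]) (by
      rw [Finset.HasAntidiagonal.mem_antidiagonal] at hp
      simp
      omega)
  simpa using this

/-- The generators are primitive modulo higher degree, and the product of primitive leading terms
expands into the unshuffles of the word. -/
theorem comul_monomial_sub_mem (z : List (GenIndex N)) :
    Coalgebra.comul (R := ℂ) (monomial z)
      - ((splits z).map fun x => monomial x.1 ⊗ₜ[ℂ] monomial x.2).sum
      ∈ tensorFil N (wordDegree z + 1) := by
  induction z with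
  | nil =>
    simp [splits, Bialgebra.comul_one, Algebra.TensorProduct.one_def]
  | cons g z ih =>
    have h1 := comul_T_sub_mem g.1 g.2.1 g.2.2
    set D := Coalgebra.comul (R := ℂ) (T g.1 g.2.1 g.2.2)
    set D' := Coalgebra.comul (R := ℂ) (monomial z)
    set A := T g.1 g.2.1 g.2.2 ⊗ₜ[ℂ] 1 + 1 ⊗ₜ[ℂ] T g.1 g.2.1 g.2.2
    set B := ((splits z).map fun x => monomial x.1 ⊗ₜ[ℂ] monomial x.2).sum
    have hA : A ∈ tensorFil N g.1 := by
      refine Submodule.add_mem _ ?_ ?_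
      · simpa using tmul_mem_tensorFil (d := g.1) (p := [g]) (q := []) (by simp)
      · simpa using tmul_mem_tensorFil (d := g.1) (p := []) (q := [g]) (by simp)
    have hB : B ∈ tensorFil N (wordDegree z) := by
      refine list_sum_mem fun x hx => ?_
      obtain ⟨y, hy, rfl⟩ := List.mem_map.1 hx
      apply tmul_mem_tensorFil
      rw [← wordDegree_append, wordDegree_perm (perm_of_mem_splits hy)]
    have hAB : ((splits (g :: z)).map fun x => monomial x.1 ⊗ₜ[ℂ] monomial x.2).sum = A * B := by
      simp only [splits, List.map_append, List.map_map, List.sum_append, A, B, add_mul,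
        ← List.sum_map_mul_left, List.sum_map_add]
      congr 3 <;> funext x <;> simp
    rw [monomial_cons, Bialgebra.comul_mul, hAB, wordDegree_cons]
    have : D * D' - A * B = (D - A) * (D' - B) + (D - A) * B + A * (D' - B) := by noncomm_ring
    change D * D' - A * B ∈ _
    rw [this]
    refine Submodule.add_mem _ (Submodule.add_mem _ ?_ ?_) ?_
    · exact tensorFil_anti (by omega) (mul_mem_tensorFil h1 ih)
    · exact tensorFil_anti (by omega) (mul_mem_tensorFil h1 hB)
    · exact tensorFil_anti (by omega) (mul_mem_tensorFil hA ih)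

theorem comul_monomial_mem (z : List (GenIndex N)) :
    Coalgebra.comul (R := ℂ) (monomial z) ∈ tensorFil N (wordDegree z) := by
  rw [← sub_add_cancel (Coalgebra.comul (R := ℂ) (monomial z))
    ((splits z).map fun x => monomial x.1 ⊗ₜ[ℂ] monomial x.2).sum]
  refine Submodule.add_mem _ (tensorFil_anti (by omega) (comul_monomial_sub_mem z)) ?_
  refine list_sum_mem fun x hx => ?_
  obtain ⟨y, hy, rfl⟩ := List.mem_map.1 hx
  apply tmul_mem_tensorFil
  rw [← wordDegree_append, wordDegree_perm (perm_of_mem_splits hy)]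

end DualYangian

/-! ### The pairing of monomials -/

theorem tensorPairing_eq_zero_of_mem {g : GenIndex N} {x : Yangian N} {d e : ℕ}
    (hx : ∀ q : List (GenIndex N), e < wordDegree q →
      canonicalPairing N x (DualYangian.monomial q) = 0) (hd : g.1 + e < d)
    {y : DualYangian N ⊗[ℂ] DualYangian N} (hy : y ∈ DualYangian.tensorFil N d) :
    tensorPairing (canonicalPairing N) (Yangian.T g.1 g.2.1 g.2.2 ⊗ₜ x) y = 0 := by
  have : DualYangian.tensorFil N d
      ≤ LinearMap.ker (tensorPairing (canonicalPairing N) (Yangian.T g.1 g.2.1 g.2.2 ⊗ₜ x)) := by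
    refine Submodule.span_le.2 ?_
    rintro _ ⟨p, hp, rfl⟩
    rw [SetLike.mem_coe, LinearMap.mem_ker, tensorPairing_tmul]
    by_cases h : wordDegree p.1 = g.1
    · rw [hx, mul_zero]
      simp only [Set.mem_ofPred_eq] at hp
      omega
    · rw [canonicalPairing_T_monomial_eq_zero h, zero_mul]
  exact this hy

/-- The comultiplication does not lower the total degree. Peeling off one factor, which pairs only
in its own degree, leaves the same inequality for the remaining factors. -/
theorem canonicalPairing_monomial_eq_zero {w z : List (GenIndex N)}
    (h : wordDegree w < wordDegree z) :
    canonicalPairing N (Yangian.monomial w) (DualYangian.monomial z) = 0 := by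
  induction w generalizing z with
  | nil =>
    rw [Yangian.monomial_nil, canonicalPairing_one]
    cases z with
    | nil => simp at h
    | cons g z => rw [DualYangian.monomial_cons, Bialgebra.counit_mul, DualYangian.counit_T, zero_mul]
  | cons g w ih =>
    rw [Yangian.monomial_cons, canonicalPairing_mul]
    refine tensorPairing_eq_zero_of_mem (e := wordDegree w) (fun q hq => ih hq) ?_
      (DualYangian.comul_monomial_mem z)
    simpa using h

/-- The higher terms of the comultiplication pair to zero for reasons of degree, so only the
unshuffles remain. This recursion computes all graded matrix entries. -/
theorem canonicalPairing_monomial_cons {g : GenIndex N} {w z : List (GenIndex N)}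
    (h : wordDegree z = g.1 + wordDegree w) :
    canonicalPairing N (Yangian.monomial (g :: w)) (DualYangian.monomial z)
      = ((splits z).map fun x =>
        canonicalPairing N (Yangian.T g.1 g.2.1 g.2.2) (DualYangian.monomial x.1)
          * canonicalPairing N (Yangian.monomial w) (DualYangian.monomial x.2)).sum := by
  have h0 := tensorPairing_eq_zero_of_mem (g := g) (e := wordDegree w)
    (fun q hq => canonicalPairing_monomial_eq_zero hq) (by omega)
    (DualYangian.comul_monomial_sub_mem z)
  rw [map_sub, sub_eq_zero] at h0
  rw [Yangian.monomial_cons, canonicalPairing_mul, h0, map_list_sum, List.map_map]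
  congr 2

/-- The weight of a list of parts of a partition of `s`. -/
def partsWeight (s : ℕ) (l : List ℕ) : ℕ := (l.map fun x => (s + 1) ^ (s - x)).sum

theorem partsWeight_perm (s : ℕ) {l l' : List ℕ} (h : l.Perm l') :
    partsWeight s l = partsWeight s l' := (h.map _).sum_eq

theorem partsWeight_cons (s x : ℕ) (l : List ℕ) :
    partsWeight s (x :: l) = (s + 1) ^ (s - x) + partsWeight s l := by
  simp [partsWeight]

theorem partsWeight_append (s : ℕ) (l l' : List ℕ) :
    partsWeight s (l ++ l') = partsWeight s l + partsWeight s l' := by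
  simp [partsWeight]

/-- The weight turns the lexicographical ordering into a numerical one, reversed. At the first
difference b < a, the remaining parts of l' are at least a and at most s in number, so they weigh at
most s (s + 1)^(s - b - 1), less than the single summand (s + 1)^(s - b). -/
theorem partsWeight_lt_of_lt {s : ℕ} {l l' : List ℕ} (h : l < l') (hl : l.sum = l'.sum)
    (hs : l'.sum ≤ s) (hsort : l'.Pairwise (· ≤ ·)) (hpos : ∀ x ∈ l', 0 < x) :
    partsWeight s l' < partsWeight s l := by
  induction l generalizing l' with
  | nil =>
    cases l' with
    | nil => exact absurd h (lt_irrefl _)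
    | cons a l' =>
      have := hpos a (by simp)
      simp at hl
      omega
  | cons b l ih =>
    cases l' with
    | nil => exact absurd h (List.not_lt_nil _)
    | cons a l' =>
      rw [List.cons_lt_cons_iff] at h
      simp only [List.sum_cons] at hl hs
      rcases h with h | ⟨rfl, h⟩
      · have h1 : partsWeight s (a :: l') ≤ (a :: l').length • (s + 1) ^ (s - b - 1) := by
          rw [partsWeight, ← List.length_map (as := a :: l')]
          refine List.sum_le_card_nsmul _ _ fun y hy => ?_
          obtain ⟨x, hx, rfl⟩ := List.mem_map.1 hy
          have : a ≤ x := by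
            rcases List.mem_cons.1 hx with rfl | hx
            · exact le_rfl
            · exact (List.pairwise_cons.1 hsort).1 x hx
          exact Nat.pow_le_pow_right (by omega) (by omega)
        have h2 : (a :: l').length ≤ s := by
          have : (a :: l').length • 1 ≤ (a :: l').sum := List.card_nsmul_le_sum _ _ hpos
          simp only [smul_eq_mul, mul_one, List.sum_cons] at this
          omega
        have h3 : (s + 1) ^ (s - b) = (s + 1) * (s + 1) ^ (s - b - 1) := by
          rw [← pow_succ']
          congr 1
          omega
        have h4 : 0 < (s + 1) ^ (s - b - 1) := by positivity
        rw [partsWeight_cons s b, h3]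
        have h5 := Nat.mul_le_mul_right ((s + 1) ^ (s - b - 1)) h2
        simp only [smul_eq_mul] at h1
        nlinarith
      · rw [partsWeight_cons, partsWeight_cons]
        have := ih h (by omega) (by omega) (List.pairwise_cons.1 hsort).2
          fun x hx => hpos x (List.mem_cons_of_mem _ hx)
        omega

/-- The weight of the degrees of the letters of a word. -/
def wordWeight (s : ℕ) (w : List (GenIndex N)) : ℕ := partsWeight s (w.map fun g => (g.1 : ℕ))

theorem wordWeight_cons (s : ℕ) (g : GenIndex N) (w : List (GenIndex N)) :
    wordWeight s (g :: w) = (s + 1) ^ (s - g.1) + wordWeight s w := by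
  simp [wordWeight, partsWeight_cons]

theorem wordWeight_append (s : ℕ) (w w' : List (GenIndex N)) :
    wordWeight s (w ++ w') = wordWeight s w + wordWeight s w' := by
  simp [wordWeight, partsWeight_append]

theorem wordWeight_perm (s : ℕ) {w w' : List (GenIndex N)} (h : w.Perm w') :
    wordWeight s w = wordWeight s w' := partsWeight_perm s (h.map _)

/-- A word of positive degree `r` weighs at least as much as a letter of degree `r`, with
equality only for letters. -/
theorem le_wordWeight (s : ℕ) {r : ℕ+} {p : List (GenIndex N)} (h : wordDegree p = r) :
    (s + 1) ^ (s - r) ≤ wordWeight s p ∧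
      ((s + 1) ^ (s - r) = wordWeight s p → ∃ i j, p = [(r, i, j)]) := by
  have hr := r.pos
  match p with
  | [] => simp at h; omega
  | [g] =>
    simp only [wordDegree_cons, wordDegree_nil, add_zero] at h
    refine ⟨by simp [wordWeight, partsWeight, h], fun _ => ⟨g.2.1, g.2.2, ?_⟩⟩
    rw [← PNat.coe_injective h]
  | g :: g' :: p =>
    simp only [wordDegree_cons] at h
    have h1 : (s + 1) ^ (s - r) ≤ (s + 1) ^ (s - g.1) :=
      Nat.pow_le_pow_right (by omega) (by omega)
    have h2 : 0 < (s + 1) ^ (s - g'.1) := by positivity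
    rw [wordWeight_cons, wordWeight_cons]
    exact ⟨by omega, fun _ => by omega⟩

theorem transposeWord_cons (g : GenIndex N) (w : List (GenIndex N)) :
    transposeWord (g :: w) = (g.1, g.2.2, g.2.1) :: transposeWord w := by
  simp [transposeWord]

/-- A non-zero term assigns to each factor of w a block of letters of z of the same total degree.
Breaking a letter into several raises the weight, so equal weights mean that every block is a single
letter, which must then be the transposed one. -/
theorem wordWeight_le_of_canonicalPairing_ne_zero (s : ℕ) {w z : List (GenIndex N)}
    (h : wordDegree z = wordDegree w)
    (h0 : canonicalPairing N (Yangian.monomial w) (DualYangian.monomial z) ≠ 0) :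
    wordWeight s w ≤ wordWeight s z ∧
      (wordWeight s w = wordWeight s z → z.Perm (transposeWord w)) := by
  induction w generalizing z with
  | nil =>
    have := length_le_wordDegree z
    rw [h, wordDegree_nil, Nat.le_zero, List.length_eq_zero_iff] at this
    simp [this, transposeWord]
  | cons g w ih =>
    rw [wordDegree_cons] at h
    rw [canonicalPairing_monomial_cons h] at h0
    obtain ⟨y, hy, hy0⟩ := List.exists_mem_ne_zero_of_sum_ne_zero h0
    obtain ⟨x, hx, rfl⟩ := List.mem_map.1 hy
    have h1 := left_ne_zero_of_mul hy0
    have h2 := right_ne_zero_of_mul hy0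
    have hp := perm_of_mem_splits hx
    have hp1 : wordDegree x.1 = g.1 := by
      by_contra hne
      exact h1 (canonicalPairing_T_monomial_eq_zero hne _ _)
    have hdeg := wordDegree_perm hp
    rw [wordDegree_append] at hdeg
    have hw := wordWeight_perm s hp
    rw [wordWeight_append] at hw
    obtain ⟨ih1, ih2⟩ := ih (by omega) h2
    obtain ⟨l1, l2⟩ := le_wordWeight s hp1
    rw [wordWeight_cons]
    refine ⟨by omega, fun e => ?_⟩
    obtain ⟨i, j, hij⟩ := l2 (by omega)
    have ih3 := ih2 (by omega)
    rw [hij, DualYangian.monomial_cons, DualYangian.monomial_nil, mul_one,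
      canonicalPairing_T_T] at h1
    have e1 := (ne_eq _ _ ▸ h1 : ¬ _ = _)
    rw [ite_eq_right_iff, Classical.not_imp] at e1
    rw [transposeWord_cons, ← e1.1]
    rw [hij] at hp
    exact hp.symm.trans (ih3.cons _)

/-- All terms are natural multiples of the same c, so they cannot cancel: one strictly positive
multiple makes the total multiple positive. -/
theorem exists_sum_eq_mul {α : Type*} (c : ℂ) (f : α → ℂ) (P : α → Prop) (Q : Prop) (L : List α)
    (h : ∀ x ∈ L, ∃ n : ℕ, f x = c * n ∧ (Q → n = 0) ∧ (P x → 0 < n)) :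
    ∃ n : ℕ, (L.map f).sum = c * n ∧ (Q → n = 0) ∧ ((∃ x ∈ L, P x) → 0 < n) := by
  induction L with
  | nil => exact ⟨0, by simp⟩
  | cons a L ih =>
    obtain ⟨n, hn, hQ, hn'⟩ := ih fun x hx => h x (List.mem_cons_of_mem _ hx)
    obtain ⟨k, hk, hQ', hk'⟩ := h a (by simp)
    refine ⟨k + n, by rw [List.map_cons, List.sum_cons, hn, hk]; push_cast; ring,
      fun q => by simp [hQ q, hQ' q], ?_⟩
    rintro ⟨x, hx, hP⟩
    rcases List.mem_cons.1 hx with rfl | hx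
    · have := hk' hP
      omega
    · have := hn' ⟨x, hx, hP⟩
      omega

/-- Blocks cannot be empty, since letters have positive degree. If z is no longer than w,
contributing blocks are therefore single letters, each with value -1; the natural number counts the
matchings. -/
theorem canonicalPairing_monomial_of_length_le {w z : List (GenIndex N)}
    (h : wordDegree z = wordDegree w) (hl : z.length ≤ w.length) :
    ∃ n : ℕ, canonicalPairing N (Yangian.monomial w) (DualYangian.monomial z) = (-1) ^ w.length * n
      ∧ (z.length < w.length → n = 0) ∧ (z.Perm (transposeWord w) → 0 < n) := by
  induction w generalizing z with
  | nil =>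
    have : z = [] := by simpa using hl
    subst this
    refine ⟨1, ?_, by simp, by simp⟩
    simp [canonicalPairing_one, Bialgebra.counit_one]
  | cons g w ih =>
    rw [wordDegree_cons] at h
    rw [canonicalPairing_monomial_cons h]
    obtain ⟨n, hn, hQ, hP⟩ := exists_sum_eq_mul ((-1) ^ (g :: w).length) (fun x =>
        canonicalPairing N (Yangian.T g.1 g.2.1 g.2.2) (DualYangian.monomial x.1)
          * canonicalPairing N (Yangian.monomial w) (DualYangian.monomial x.2))
      (fun x => x.1 = [(g.1, g.2.2, g.2.1)] ∧ x.2.Perm (transposeWord w))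
      (z.length < (g :: w).length) (splits z) (fun x hx => by
        have hp := perm_of_mem_splits hx
        have hd := wordDegree_perm hp
        have hlen := hp.length_eq
        rw [wordDegree_append] at hd
        rw [List.length_append] at hlen
        rw [List.length_cons] at hl ⊢
        by_cases h1 : wordDegree x.1 = g.1
        · have hg := g.1.pos
          match hx1 : x.1 with
          | [] => rw [hx1] at h1; simp at h1; omega
          | [k] =>
            rw [hx1, List.length_singleton] at hlen
            obtain ⟨n, hn, hn1, hn2⟩ := ih (z := x.2) (by omega) (by omega)
            rw [hn, DualYangian.monomial_cons, DualYangian.monomial_nil, mul_one,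
              canonicalPairing_T_T]
            by_cases hk : (k.1, k.2.1, k.2.2) = (g.1, g.2.2, g.2.1)
            · rw [if_pos hk]
              exact ⟨n, by ring, fun _ => hn1 (by omega), fun h => hn2 h.2⟩
            · rw [if_neg hk]
              refine ⟨0, by simp, fun _ => rfl, fun h => absurd ?_ hk⟩
              simpa using h.1
          | k :: k' :: p =>
            -- A block of two or more letters leaves fewer letters than the remaining factors need,
            -- so the induction hypothesis gives zero.
            rw [hx1] at hlen
            simp only [List.length_cons] at hlen
            obtain ⟨n, hn, hn1, hn2⟩ := ih (z := x.2) (by omega) (by omega)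
            rw [hn, hn1 (by omega)]
            exact ⟨0, by simp, fun _ => rfl, fun h => by simp at h⟩
        · rw [canonicalPairing_T_monomial_eq_zero h1]
          refine ⟨0, by simp, fun _ => rfl, fun h => absurd ?_ h1⟩
          rw [h.1]
          simp)
    refine ⟨n, hn, hQ, fun hz => hP ?_⟩
    rw [transposeWord_cons] at hz
    have hmem : (g.1, g.2.2, g.2.1) ∈ z := hz.symm.subset (by simp)
    refine ⟨_, singleton_erase_mem_splits hmem, rfl, ?_⟩
    exact (List.perm_cons (g.1, g.2.2, g.2.1)).1 ((List.perm_cons_erase hmem).symm.trans hz)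

theorem canonicalPairing_monomial_transposeWord_ne_zero (w z : List (GenIndex N))
    (h : z.Perm (transposeWord w)) :
    canonicalPairing N (Yangian.monomial w) (DualYangian.monomial z) ≠ 0 := by
  obtain ⟨n, hn, -, hn'⟩ := canonicalPairing_monomial_of_length_le
    ((wordDegree_perm h).trans (wordDegree_transposeWord w)) (by rw [h.length_eq]; simp [transposeWord])
  rw [hn]
  have := hn' h
  simp
  omega

/-- Reordering the factors of a product up to a family of submodules containing the corrections. -/
theorem prod_sub_prod_mem_of_perm {α R : Type*} [Ring R] [Module ℂ R] (f : α → R)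
    (J : List α → Submodule ℂ R) (hJ : ∀ w w', w.Perm w' → J w = J w')
    (hcons : ∀ g w x, x ∈ J w → f g * x ∈ J (g :: w))
    (hswap : ∀ g h w, ⁅f g, f h⁆ * (w.map f).prod ∈ J (g :: h :: w)) {w w' : List α}
    (h : w.Perm w') : (w.map f).prod - (w'.map f).prod ∈ J w := by
  induction h with
  | nil => simp
  | cons g _ ih => simpa [mul_sub] using hcons g _ _ ih
  | swap g h w =>
    have := hswap h g w
    rw [Ring.lie_def, sub_mul] at this
    simpa [mul_assoc] using this
  | trans h1 h2 ih1 ih2 =>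
    rw [← hJ _ _ h1] at ih2
    simpa using Submodule.add_mem _ ih1 ih2

/-! ### The Yangian -/

namespace Yangian

theorem fil_mono {s t : ℕ} (h : s ≤ t) : fil N s ≤ fil N t :=
  Submodule.span_mono (Set.image_mono fun _ hw => le_trans hw h)

theorem filLT_succ (s : ℕ) : filLT N (s + 1) = fil N s := by
  unfold filLT fil
  simp only [Nat.lt_succ_iff]

theorem mul_mem_fil {s t : ℕ} {x y : Yangian N} (hx : x ∈ fil N s) (hy : y ∈ fil N t) :
    x * y ∈ fil N (s + t) := by
  have h := Submodule.mul_mem_mul hx hy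
  rw [fil, fil, Submodule.span_mul_span] at h
  refine Submodule.span_le.2 ?_ h
  rintro _ ⟨_, ⟨p, hp, rfl⟩, _, ⟨q, hq, rfl⟩, rfl⟩
  simp only [← monomial_append, SetLike.mem_coe]
  exact monomial_mem (by rw [wordDegree_append]; exact add_le_add hp hq)

theorem mul_mem_filLT {s t : ℕ} {x y : Yangian N} (hx : x ∈ filLT N s) (hy : y ∈ fil N t) :
    x * y ∈ filLT N (s + t) := by
  cases s with
  | zero =>
    have : x = 0 := by simpa [filLT] using hx
    simp [this]
  | succ s =>
    rw [filLT_succ] at hx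
    rw [add_right_comm, filLT_succ]
    exact mul_mem_fil hx hy

theorem mul_mem_filLT' {s t : ℕ} {x y : Yangian N} (hx : x ∈ fil N s) (hy : y ∈ filLT N t) :
    x * y ∈ filLT N (s + t) := by
  cases t with
  | zero =>
    have : y = 0 := by simpa [filLT] using hy
    simp [this]
  | succ t =>
    rw [filLT_succ] at hy
    rw [← add_assoc, filLT_succ]
    exact mul_mem_fil hx hy

theorem one_mem_fil : (1 : Yangian N) ∈ fil N 0 := monomial_mem (w := []) le_rfl

theorem T_mem_fil (r : ℕ) (i j : Fin N) : T r i j ∈ fil N r := by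
  cases r with
  | zero =>
    rw [T_zero]
    split_ifs
    · exact one_mem_fil
    · exact Submodule.zero_mem _
  | succ r => simpa using monomial_mem (N := N) (s := r + 1) (w := [(r.succPNat, i, j)]) (by simp)

/-- Modulo lower degree the defining relation moves one unit between the indices: [T^(r+1), T^(s)] ≡
[T^(r), T^(s+1)]. The chain ends at T^(0), which is scalar. -/
theorem lie_T_T_mem (r s : ℕ) (i j k l : Fin N) : ⁅T r i j, T s k l⁆ ∈ filLT N (r + s) := by
  induction r generalizing s with
  | zero =>
    rw [T_zero]
    split_ifs <;> simp [Ring.lie_def]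
  | succ r ih =>
    have h := T_isYangianSeries (N := N) r s i j k l
    rw [sub_eq_iff_eq_add] at h
    rw [h]
    refine Submodule.add_mem _ ?_ ?_
    · rw [show r + 1 + s = r + s + 1 by omega, filLT_succ]
      refine Submodule.sub_mem _ (mul_mem_fil (T_mem_fil _ _ _) (T_mem_fil _ _ _)) ?_
      rw [add_comm]
      exact mul_mem_fil (T_mem_fil _ _ _) (T_mem_fil _ _ _)
    · rw [show r + 1 + s = r + (s + 1) by omega]
      exact ih (s + 1)

theorem monomial_sub_monomial_mem {w w' : List (GenIndex N)} (h : w.Perm w') :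
    monomial w - monomial w' ∈ filLT N (wordDegree w) := by
  refine prod_sub_prod_mem_of_perm (fun g : GenIndex N => T g.1 g.2.1 g.2.2)
    (fun w => filLT N (wordDegree w)) (fun w w' h => by rw [wordDegree_perm h]) ?_ ?_ h
  · intro g w x hx
    rw [wordDegree_cons]
    exact mul_mem_filLT' (T_mem_fil _ _ _) hx
  · intro g h w
    rw [wordDegree_cons, wordDegree_cons, ← add_assoc]
    exact mul_mem_filLT (lie_T_T_mem _ _ _ _ _ _) (monomial_mem le_rfl)

theorem iSup_fil (x : Yangian N) : ∃ s, x ∈ fil N s := by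
  induction x using induction_on with
  | algebraMap c =>
    rw [Algebra.algebraMap_eq_smul_one]
    exact ⟨0, Submodule.smul_mem _ _ one_mem_fil⟩
  | T r i j => exact ⟨r, T_mem_fil r i j⟩
  | mul x y hx hy =>
    obtain ⟨s, hs⟩ := hx
    obtain ⟨t, ht⟩ := hy
    exact ⟨s + t, mul_mem_fil hs ht⟩
  | add x y hx hy =>
    obtain ⟨s, hs⟩ := hx
    obtain ⟨t, ht⟩ := hy
    exact ⟨s + t, Submodule.add_mem _ (fil_mono (by omega) hs) (fil_mono (by omega) ht)⟩

theorem toGr_eq_zero_iff {s : ℕ} (x : fil N s) : toGr s x = 0 ↔ (x : Yangian N) ∈ filLT N s := by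
  rw [toGr, Submodule.mkQ_apply, Submodule.Quotient.mk_eq_zero]
  exact Iff.rfl

theorem toGr_surjective (s : ℕ) : Function.Surjective (toGr (N := N) s) :=
  Submodule.mkQ_surjective _

theorem span_range_vec {s : ℕ} (L : Listing N s) : ⊤ ≤ Submodule.span ℂ (Set.range L.vec) := by
  rintro x -
  obtain ⟨⟨x, hx⟩, rfl⟩ := toGr_surjective s x
  induction hx using Submodule.span_induction with
  | zero =>
    rw [show toGr s ⟨0, _⟩ = 0 from (toGr s).map_zero]
    exact Submodule.zero_mem _
  | add x y hx hy ihx ihy => exact Submodule.add_mem _ ihx ihy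
  | smul c x hx ih => exact Submodule.smul_mem _ c ih
  | mem x hx =>
    obtain ⟨w, hw, rfl⟩ := hx
    rcases (show wordDegree w ≤ s from hw).lt_or_eq with h | h
    · rw [(toGr_eq_zero_iff _).2 (Submodule.subset_span ⟨w, h, rfl⟩)]
      exact Submodule.zero_mem _
    · have hs : (((w : Multiset (GenIndex N))).map fun g => (g.1 : ℕ)).sum = s := by
        rw [Multiset.map_coe, Multiset.sum_coe]
        exact h
      refine Submodule.subset_span ⟨⟨w, hs⟩, ?_⟩
      have hp : (L.word ⟨w, hs⟩).Perm w := Multiset.coe_eq_coe.1 (L.coe_word ⟨w, hs⟩)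
      refine (sub_eq_zero.1 ?_)
      rw [Listing.vec, grMonomial, ← map_sub, toGr_eq_zero_iff]
      have := monomial_sub_monomial_mem hp
      rwa [L.wordDegree_word] at this

end Yangian

/-! ### The dual Yangian -/

namespace DualYangian

theorem fil_anti {s t : ℕ} (h : s ≤ t) : fil N t ≤ fil N s :=
  Submodule.span_mono (Set.image_mono fun _ hw => h.trans hw)

/-- The span of the monomials of degree `d` with less than `n` factors and the monomials of degree
more than `d`. -/
def shortFil (N d n : ℕ) : Submodule ℂ (DualYangian N) :=
  Submodule.span ℂ (monomial '' {w | d < wordDegree w ∨ wordDegree w = d ∧ w.length < n})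

theorem fil_le_shortFil {d e : ℕ} (h : d < e) (n : ℕ) : fil N e ≤ shortFil N d n :=
  Submodule.span_mono (Set.image_mono fun _ hw => Or.inl (lt_of_lt_of_le h hw))

theorem monomial_mem_shortFil {d n : ℕ} {w : List (GenIndex N)} (h : wordDegree w = d)
    (h' : w.length < n) : monomial w ∈ shortFil N d n :=
  Submodule.subset_span ⟨w, Or.inr ⟨h, h'⟩, rfl⟩

theorem mul_mem_fil {s t : ℕ} {x y : DualYangian N} (hx : x ∈ fil N s) (hy : y ∈ fil N t) :
    x * y ∈ fil N (s + t) := by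
  have h := Submodule.mul_mem_mul hx hy
  rw [fil, fil, Submodule.span_mul_span] at h
  refine Submodule.span_le.2 ?_ h
  rintro _ ⟨_, ⟨p, hp, rfl⟩, _, ⟨q, hq, rfl⟩, rfl⟩
  simp only [← monomial_append, SetLike.mem_coe]
  exact monomial_mem (by rw [wordDegree_append]; exact add_le_add hp hq)

theorem mul_monomial_mem_shortFil {d n : ℕ} {x : DualYangian N} (hx : x ∈ shortFil N d n)
    (w : List (GenIndex N)) : x * monomial w ∈ shortFil N (d + wordDegree w) (n + w.length) := by
  have : shortFil N d n ≤ (shortFil N (d + wordDegree w) (n + w.length)).comap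
      (LinearMap.mulRight ℂ (monomial w)) := by
    refine Submodule.span_le.2 ?_
    rintro _ ⟨p, hp, rfl⟩
    rw [SetLike.mem_coe, Submodule.mem_comap, LinearMap.mulRight_apply, ← monomial_append]
    refine Submodule.subset_span ⟨_, ?_, rfl⟩
    simp only [Set.mem_ofPred_eq, wordDegree_append, List.length_append] at hp ⊢
    omega
  exact this hx

theorem monomial_mul_mem_shortFil {d n : ℕ} {x : DualYangian N} (hx : x ∈ shortFil N d n)
    (w : List (GenIndex N)) : monomial w * x ∈ shortFil N (wordDegree w + d) (w.length + n) := by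
  have : shortFil N d n ≤ (shortFil N (wordDegree w + d) (w.length + n)).comap
      (LinearMap.mulLeft ℂ (monomial w)) := by
    refine Submodule.span_le.2 ?_
    rintro _ ⟨p, hp, rfl⟩
    rw [SetLike.mem_coe, Submodule.mem_comap, LinearMap.mulLeft_apply, ← monomial_append]
    refine Submodule.subset_span ⟨_, ?_, rfl⟩
    simp only [Set.mem_ofPred_eq, wordDegree_append, List.length_append] at hp ⊢
    omega
  exact this hx

theorem T_mem_fil (r : ℕ+) (i j : Fin N) : T r i j ∈ fil N r := by
  simpa using monomial_mem (N := N) (s := r) (w := [(r, i, j)]) (by simp)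

theorem mem_fil_zero (z : DualYangian N) : z ∈ fil N 0 := by
  have h1 : (1 : DualYangian N) ∈ fil N 0 := monomial_mem (w := []) le_rfl
  induction z using induction_on with
  | algebraMap c =>
    rw [Algebra.algebraMap_eq_smul_one]
    exact Submodule.smul_mem _ _ h1
  | S r i j =>
    refine Submodule.add_mem _ ?_ (fil_anti (Nat.zero_le _) (T_mem_fil _ _ _))
    split_ifs
    · exact h1
    · exact Submodule.zero_mem _
  | mul x y hx hy =>
    have := mul_mem_fil hx hy
    rwa [add_zero] at this
  | add x y hx hy => exact Submodule.add_mem _ hx hy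

theorem S_zero (i j : Fin N) : S 0 i j = (if i = j then 1 else 0) + T 1 i j := by
  simp [S]
  rfl

theorem S_succ (r : ℕ) (i j : Fin N) : S (r + 1) i j = T (r + 1).succPNat i j := by
  simp [S]

theorem lie_S_S (r s : ℕ) (i j k l : Fin N) :
    ⁅(S r i j : DualYangian N), S s k l⁆ = ⁅T r.succPNat i j, T s.succPNat k l⁆ := by
  simp only [S, Ring.lie_def]
  split_ifs <;> noncomm_ring

/-- Modulo higher degree the relation again shifts one unit between the indices. The chain now ends
at v⁰, where the summand δ_ij of T*(v) leaves single generators of the same degree. Commutators thus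
need not rise in degree, but then they are shorter, which is why `shortFil` also records length. -/
theorem lie_T_T_mem (r s : ℕ) (i j k l : Fin N) :
    ⁅(T r.succPNat i j : DualYangian N), T s.succPNat k l⁆ ∈ shortFil N (r + s + 2) 2 := by
  have hT : ∀ (p q : ℕ+) (i j k l : Fin N), r + s + 2 < p + q →
      T p i j * T q k l ∈ shortFil N (r + s + 2) 2 := fun p q i j k l h =>
    fil_le_shortFil h _ (mul_mem_fil (T_mem_fil _ _ _) (T_mem_fil _ _ _))
  induction r generalizing s with
  | zero =>
    -- The relation at u⁰ v^(s+1): multiplication by u leaves no constant term, so only one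
    -- commutator survives.
    have h := S_isDualYangianSeries (N := N) 0 (s + 1) i j k l
    have hT1 : ∀ i j : Fin N, T (s + 1).succPNat i j ∈ shortFil N (0 + s + 2) 2 := by
      intro i j
      simpa using monomial_mem_shortFil (w := [((s + 1).succPNat, i, j)]) (d := 0 + s + 2) (n := 2)
        (by simp) (by simp)
    have h0 : ⁅(seriesShift S 0 i j : DualYangian N), S (s + 1) k l⁆ = 0 := by
      simp [seriesShift, Ring.lie_def]
    rw [h0,
      show seriesShift S (s + 1) k l = (S s k l : DualYangian N) from rfl, lie_S_S,
      zero_sub, S_zero, S_zero, S_succ, S_succ, neg_eq_iff_eq_neg] at h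
    change ⁅T 1 i j, _⁆ ∈ _
    rw [show Nat.succPNat 0 = 1 from rfl] at h
    rw [h]
    refine Submodule.neg_mem _ ?_
    rw [add_mul, mul_add]
    refine Submodule.sub_mem _ (Submodule.add_mem _ ?_ ?_) (Submodule.add_mem _ ?_ ?_)
    · split_ifs
      · simpa using hT1 _ _
      · simp
    · exact hT _ _ _ _ _ _ (by simp)
    · split_ifs
      · simpa using hT1 _ _
      · simp
    · exact hT _ _ _ _ _ _ (by simp)
  | succ r ih =>
    have h := S_isDualYangianSeries (N := N) (r + 1) (s + 1) i j k l
    rw [show seriesShift S (r + 1) i j = (S r i j : DualYangian N) from rfl,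
      show seriesShift S (s + 1) k l = (S s k l : DualYangian N) from rfl, lie_S_S, lie_S_S,
      S_succ, S_succ, S_succ, S_succ, sub_eq_iff_eq_add, ← sub_eq_iff_eq_add'] at h
    rw [← h]
    have e : r + 1 + s + 2 = r + (s + 1) + 2 := by omega
    refine Submodule.sub_mem _ ?_ (Submodule.sub_mem _ ?_ ?_)
    · rw [e]
      exact ih (s + 1) (by rwa [e] at hT)
    · exact hT _ _ _ _ _ _ (by simp; omega)
    · exact hT _ _ _ _ _ _ (by simp; omega)

theorem monomial_sub_monomial_mem {w w' : List (GenIndex N)} (h : w.Perm w') :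
    monomial w - monomial w' ∈ shortFil N (wordDegree w) w.length := by
  refine prod_sub_prod_mem_of_perm (fun g : GenIndex N => T g.1 g.2.1 g.2.2)
    (fun w => shortFil N (wordDegree w) w.length)
    (fun w w' h => by rw [wordDegree_perm h, h.length_eq]) ?_ ?_ h
  · intro g w x hx
    rw [wordDegree_cons, List.length_cons, add_comm w.length]
    simpa using monomial_mul_mem_shortFil hx [g]
  · rintro ⟨r, i, j⟩ ⟨s, k, l⟩ w
    obtain ⟨r, rfl⟩ : ∃ q : ℕ, r = q.succPNat := ⟨r.natPred, (PNat.succPNat_natPred r).symm⟩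
    obtain ⟨s, rfl⟩ : ∃ q : ℕ, s = q.succPNat := ⟨s.natPred, (PNat.succPNat_natPred s).symm⟩
    have := mul_monomial_mem_shortFil (lie_T_T_mem r s i j k l) w
    rw [wordDegree_cons, wordDegree_cons, ← add_assoc]
    convert this using 2
    · simp
      omega
    · simp
      omega
    · rfl

theorem toGr_eq_zero_iff {s : ℕ} (x : fil N s) :
    toGr s x = 0 ↔ (x : DualYangian N) ∈ fil N (s + 1) := by
  rw [toGr, Submodule.mkQ_apply, Submodule.Quotient.mk_eq_zero]
  exact Iff.rfl

theorem toGr_surjective (s : ℕ) : Function.Surjective (toGr (N := N) s) :=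
  Submodule.mkQ_surjective _

theorem transposeWord_transposeWord (w : List (GenIndex N)) :
    transposeWord (transposeWord w) = w := by
  simp [transposeWord, Function.comp_def]

theorem toGr_mem_span_of_mem_shortFil {s n : ℕ} (M : Submodule ℂ (Gr N s))
    (hM : ∀ w (h : wordDegree w = s), w.length < n → grMonomial s w h ∈ M)
    {x : DualYangian N} (hx : x ∈ shortFil N s n) (hx' : x ∈ fil N s) : toGr s ⟨x, hx'⟩ ∈ M := by
  induction hx using Submodule.span_induction with
  | zero =>
    rw [show toGr s ⟨0, _⟩ = 0 from (toGr s).map_zero]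
    exact Submodule.zero_mem _
  | add x y hx hy ihx ihy =>
    have hle : shortFil N s n ≤ fil N s := Submodule.span_mono (Set.image_mono fun w hw => by
      rcases hw with h | h
      · exact le_of_lt h
      · exact h.1.ge)
    exact Submodule.add_mem _ (ihx (hle hx)) (ihy (hle hy))
  | smul c x hx ih =>
    have hle : shortFil N s n ≤ fil N s := Submodule.span_mono (Set.image_mono fun w hw => by
      rcases hw with h | h
      · exact le_of_lt h
      · exact h.1.ge)
    exact Submodule.smul_mem _ c (ih (hle hx))
  | mem x hx =>
    obtain ⟨w, hw | hw, rfl⟩ := hx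
    · rw [(toGr_eq_zero_iff _).2 (Submodule.subset_span ⟨w, hw, rfl⟩)]
      exact Submodule.zero_mem _
    · exact hM w hw.1 hw.2

/-- Reordering a monomial into the listed one costs shorter monomials of the same degree, to which
induction applies, and terms of higher degree, which vanish in the graded component. -/
theorem grMonomial_mem_span_range_dualVec {s : ℕ} (L : Listing N s) (n : ℕ)
    (w : List (GenIndex N)) (h : wordDegree w = s) (hn : w.length < n) :
    grMonomial s w h ∈ Submodule.span ℂ (Set.range L.dualVec) := by
  induction n generalizing w with
  | zero => omega
  | succ n ih =>
    have hs : (((transposeWord w : List _) : Multiset (GenIndex N)).map fun g => (g.1 : ℕ)).sum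
        = s := by
      rw [Multiset.map_coe, Multiset.sum_coe]
      exact (wordDegree_transposeWord w).trans h
    have hp : w.Perm (transposeWord (L.word ⟨transposeWord w, hs⟩)) := by
      have : (L.word ⟨transposeWord w, hs⟩).Perm (transposeWord w) :=
        Multiset.coe_eq_coe.1 (L.coe_word ⟨transposeWord w, hs⟩)
      have := this.map fun g : GenIndex N => ((g.1, g.2.2, g.2.1) : GenIndex N)
      refine List.Perm.symm (this.trans ?_)
      exact List.Perm.of_eq (transposeWord_transposeWord w)
    have hd := monomial_sub_monomial_mem hp
    rw [h] at hd
    have hv : L.dualVec ⟨transposeWord w, hs⟩ ∈ Submodule.span ℂ (Set.range L.dualVec) :=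
      Submodule.subset_span ⟨_, rfl⟩
    have := toGr_mem_span_of_mem_shortFil _ (fun w h hw => ih w h (by omega)) hd
      (Submodule.sub_mem _ (monomial_mem h.ge)
        (monomial_mem (h.symm.trans (wordDegree_perm hp)).le))
    have := Submodule.add_mem _ this hv
    rw [Listing.dualVec, grMonomial, ← map_add] at this
    rw [grMonomial]
    convert this using 2
    ext
    simp

theorem span_range_dualVec {s : ℕ} (L : Listing N s) :
    ⊤ ≤ Submodule.span ℂ (Set.range L.dualVec) := by
  rintro x -
  obtain ⟨⟨x, hx⟩, rfl⟩ := toGr_surjective s x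
  induction hx using Submodule.span_induction with
  | zero =>
    rw [show toGr s ⟨0, _⟩ = 0 from (toGr s).map_zero]
    exact Submodule.zero_mem _
  | add x y hx hy ihx ihy => exact Submodule.add_mem _ ihx ihy
  | smul c x hx ih => exact Submodule.smul_mem _ c ih
  | mem x hx =>
    obtain ⟨w, hw, rfl⟩ := hx
    rcases (show s ≤ wordDegree w from hw).lt_or_eq with h | h
    · rw [(toGr_eq_zero_iff _).2 (Submodule.subset_span ⟨w, h, rfl⟩)]
      exact Submodule.zero_mem _
    · exact grMonomial_mem_span_range_dualVec L (w.length + 1) w h.symm (by omega)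

end DualYangian

/-! ### The graded pairing -/

/-- A family of pairs of vectors on which a bilinear form is triangular with non-zero diagonal. -/
theorem exists_ne_zero_of_triangular {V U ι α : Type*} [AddCommGroup V] [Module ℂ V]
    [AddCommGroup U] [Module ℂ U] [LinearOrder α] (γ : V →ₗ[ℂ] U →ₗ[ℂ] ℂ) (v : ι → V) (u : ι → U)
    (W : ι → α) (hd : ∀ μ, γ (v μ) (u μ) ≠ 0)
    (ht : ∀ μ ν, γ (v μ) (u ν) ≠ 0 → W μ < W ν ∨ μ = ν) (c : ι →₀ ℂ) (hc : c ≠ 0) :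
    ∃ ν, γ (Finsupp.linearCombination ℂ v c) (u ν) ≠ 0 := by
  -- For ν of least weight in the support, triangularity kills every other term of the combination
  -- against `u ν`.
  obtain ⟨ν, hν, hmin⟩ := c.support.exists_min_image W (Finsupp.support_nonempty_iff.2 hc)
  refine ⟨ν, ?_⟩
  rw [Finsupp.linearCombination_apply, Finsupp.sum, map_sum, LinearMap.sum_apply,
    Finset.sum_eq_single ν]
  · rw [map_smul, LinearMap.smul_apply, smul_eq_mul]
    exact mul_ne_zero (Finsupp.mem_support_iff.1 hν) (hd ν)
  · intro μ hμ hne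
    by_contra h
    rw [map_smul, LinearMap.smul_apply, smul_eq_mul] at h
    rcases ht μ ν (right_ne_zero_of_mul h) with h | h
    · exact absurd h (not_lt.2 (hmin μ hμ))
    · exact hne h
  · exact fun h => absurd hν h

/-- Spanning and triangularity suffice for both conclusions, so linear independence of the ordered
monomials is obtained from the pairing and not assumed. -/
theorem linearIndependent_and_separatingLeft_of_triangular {V U ι α : Type*} [AddCommGroup V]
    [Module ℂ V] [AddCommGroup U] [Module ℂ U] [LinearOrder α] (γ : V →ₗ[ℂ] U →ₗ[ℂ] ℂ)
    (v : ι → V) (u : ι → U) (W : ι → α) (hd : ∀ μ, γ (v μ) (u μ) ≠ 0)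
    (ht : ∀ μ ν, γ (v μ) (u ν) ≠ 0 → W μ < W ν ∨ μ = ν)
    (hspan : ⊤ ≤ Submodule.span ℂ (Set.range v)) : LinearIndependent ℂ v ∧ γ.SeparatingLeft := by
  constructor
  · rw [linearIndependent_iff]
    intro c h0
    by_contra hc
    obtain ⟨ν, hν⟩ := exists_ne_zero_of_triangular γ v u W hd ht c hc
    rw [h0] at hν
    simp at hν
  · intro x hx
    obtain ⟨c, rfl⟩ := (Finsupp.mem_span_range_iff_exists_finsupp).1 (hspan (Submodule.mem_top (x := x)))
    by_contra hne
    obtain ⟨ν, hν⟩ := exists_ne_zero_of_triangular γ v u W hd ht c (by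
      rintro rfl
      simp at hne)
    exact hν (hx _)

theorem canonicalPairing_eq_zero_of_mem_filLT {s : ℕ} {x : Yangian N} {z : DualYangian N}
    (hx : x ∈ Yangian.filLT N s) (hz : z ∈ DualYangian.fil N s) : canonicalPairing N x z = 0 := by
  induction hx, hz using Submodule.span_induction₂ with
  | mem_mem x z hx hz =>
    obtain ⟨w, hw, rfl⟩ := hx
    obtain ⟨w', hw', rfl⟩ := hz
    exact canonicalPairing_monomial_eq_zero (lt_of_lt_of_le hw hw')
  | zero_left z _ => simp
  | zero_right x _ => simp
  | add_left x y z _ _ _ h1 h2 => simp [h1, h2]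
  | add_right x y z _ _ _ h1 h2 => simp [h1, h2]
  | smul_left c x z _ _ h => simp [h]
  | smul_right c x z _ _ h => simp [h]

/-- The pairing of graded components induced by the canonical pairing. -/
def grPairing (N s : ℕ) : Yangian.Gr N s →ₗ[ℂ] DualYangian.Gr N s →ₗ[ℂ] ℂ :=
  Submodule.liftQ _ (LinearMap.flip (Submodule.liftQ _
      ((canonicalPairing N).compl₁₂ (Yangian.fil N s).subtype (DualYangian.fil N s).subtype).flip
      (fun z hz => LinearMap.ext fun x => by
        -- Degree at most s is the same as degree less than s + 1, so vanishing on the next step of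
        -- the descending filtration is the same lemma one degree higher.
        refine canonicalPairing_eq_zero_of_mem_filLT (s := s + 1) ?_ hz
        rw [Yangian.filLT_succ]
        exact x.2)))
    (fun x hx => LinearMap.ext fun z => by
      obtain ⟨z, rfl⟩ := DualYangian.toGr_surjective s z
      exact canonicalPairing_eq_zero_of_mem_filLT hx z.2)

theorem grPairing_isGrPairing (s : ℕ) : IsGrPairing (canonicalPairing N) s (grPairing N s) :=
  fun _ _ => rfl

theorem IsGrPairing.eq {β : Yangian N →ₗ[ℂ] DualYangian N →ₗ[ℂ] ℂ} {s : ℕ}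
    {γ γ' : Yangian.Gr N s →ₗ[ℂ] DualYangian.Gr N s →ₗ[ℂ] ℂ} (h : IsGrPairing β s γ)
    (h' : IsGrPairing β s γ') : γ = γ' := by
  refine LinearMap.ext fun x => LinearMap.ext fun z => ?_
  obtain ⟨x, rfl⟩ := Yangian.toGr_surjective s x
  obtain ⟨z, rfl⟩ := DualYangian.toGr_surjective s z
  rw [h, h']

theorem Listing.ext_of_perm {s : ℕ} (L : Listing N s) {μ ν : GrIndex N s}
    (h : (L.word μ).Perm (L.word ν)) : μ = ν := by
  apply Subtype.ext
  rw [← L.coe_word, ← L.coe_word]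
  exact Multiset.coe_eq_coe.2 h

theorem grPairing_vec_dualVec {s : ℕ} (L : Listing N s) (μ ν : GrIndex N s) :
    grPairing N s (L.vec μ) (L.dualVec ν)
      = canonicalPairing N (Yangian.monomial (L.word μ))
        (DualYangian.monomial (transposeWord (L.word ν))) := rfl

theorem wordWeight_transposeWord (s : ℕ) (w : List (GenIndex N)) :
    wordWeight s (transposeWord w) = wordWeight s w := by
  simp [wordWeight, transposeWord, Function.comp_def]

theorem grPairing_vec_dualVec_self {s : ℕ} (L : Listing N s) (μ : GrIndex N s) :
    grPairing N s (L.vec μ) (L.dualVec μ) ≠ 0 := by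
  rw [grPairing_vec_dualVec]
  exact canonicalPairing_monomial_transposeWord_ne_zero _ _ (List.Perm.refl _)

theorem lt_or_eq_of_grPairing_ne_zero {s : ℕ} (L : Listing N s) (μ ν : GrIndex N s)
    (h : grPairing N s (L.vec μ) (L.dualVec ν) ≠ 0) :
    wordWeight s (L.word μ) < wordWeight s (L.word ν) ∨ μ = ν := by
  rw [grPairing_vec_dualVec] at h
  obtain ⟨h1, h2⟩ := wordWeight_le_of_canonicalPairing_ne_zero s (by
    rw [wordDegree_transposeWord, L.wordDegree_word, L.wordDegree_word]) h
  rw [wordWeight_transposeWord] at h1 h2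
  rcases h1.lt_or_eq with h | h
  · exact Or.inl h
  · right
    have := (h2 h).map fun g : GenIndex N => ((g.1, g.2.2, g.2.1) : GenIndex N)
    change (transposeWord _).Perm (transposeWord _) at this
    rw [DualYangian.transposeWord_transposeWord, DualYangian.transposeWord_transposeWord] at this
    exact (L.ext_of_perm this).symm

theorem wordWeight_eq_partsWeight_parts {s : ℕ} (L : Listing N s) (μ : GrIndex N s) :
    wordWeight s (L.word μ) = partsWeight s μ.parts := by
  apply partsWeight_perm
  rw [← Multiset.coe_eq_coe, GrIndex.parts, Multiset.sort_eq, ← Multiset.map_coe, L.coe_word]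

theorem GrIndex.sum_parts {s : ℕ} (μ : GrIndex N s) : μ.parts.sum = s := by
  rw [← Multiset.sum_coe, GrIndex.parts, Multiset.sort_eq]
  exact μ.2

theorem wordWeight_lt_of_parts_lt {s : ℕ} (L : Listing N s) {μ ν : GrIndex N s}
    (h : μ.parts < ν.parts) : wordWeight s (L.word ν) < wordWeight s (L.word μ) := by
  rw [wordWeight_eq_partsWeight_parts, wordWeight_eq_partsWeight_parts]
  refine partsWeight_lt_of_lt h (by rw [GrIndex.sum_parts, GrIndex.sum_parts])
    (GrIndex.sum_parts ν).le (Multiset.pairwise_sort _ _) fun x hx => ?_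
  rw [GrIndex.parts, Multiset.mem_sort, Multiset.mem_map] at hx
  obtain ⟨g, -, rfl⟩ := hx
  exact g.1.pos

/-- A non-zero entry off the diagonal needs a strictly smaller weight for μ. Weight reverses the
ordering of partitions and is constant on each, so such an entry would put ν before μ in every
subordinate ordering. -/
theorem grPairing_eq_zero_of_lt {s : ℕ} (L : Listing N s) (ord : LinearOrder (GrIndex N s))
    (hord : ∀ μ ν : GrIndex N s, μ.parts < ν.parts → ord.lt μ ν) (μ ν : GrIndex N s)
    (h : ord.lt μ ν) : grPairing N s (L.vec μ) (L.dualVec ν) = 0 := by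
  by_contra h0
  rcases lt_or_eq_of_grPairing_ne_zero L μ ν h0 with h1 | rfl
  · rcases lt_trichotomy μ.parts ν.parts with h2 | h2 | h2
    · exact absurd h1 (wordWeight_lt_of_parts_lt L h2).not_gt
    · rw [wordWeight_eq_partsWeight_parts, wordWeight_eq_partsWeight_parts, h2] at h1
      exact lt_irrefl _ h1
    · exact absurd (hord _ _ h2) (@lt_asymm _ ord.toPreorder _ _ h)
  · exact @lt_irrefl _ ord.toPreorder _ h

theorem nonempty_listing (N s : ℕ) : Nonempty (Listing N s) := by
  have h : ∀ μ : GrIndex N s, ∃ w : List (GenIndex N), (w : Multiset (GenIndex N)) = μ.1 ∧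
      w.Pairwise fun g h => h.1 ≤ g.1 := by
    intro μ
    obtain ⟨w, hw⟩ := Quot.exists_rep μ.1
    refine ⟨w.mergeSort fun g h => decide (h.1 ≤ g.1), ?_, ?_⟩
    · rw [← hw]
      exact Multiset.coe_eq_coe.2 (List.mergeSort_perm _ _)
    · have := List.pairwise_mergeSort (le := fun g h : GenIndex N => decide (h.1 ≤ g.1))
        (fun a b c h1 h2 => by simp at *; exact h2.trans h1)
        (fun a b => by simpa using le_total _ _) w
      simpa using this
  choose f hf using h
  exact ⟨⟨f, fun μ => (hf μ).1, fun μ => (hf μ).2⟩⟩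

theorem linearIndependent_vec {s : ℕ} (L : Listing N s) : LinearIndependent ℂ L.vec :=
  (linearIndependent_and_separatingLeft_of_triangular (grPairing N s) L.vec L.dualVec
    (fun μ => wordWeight s (L.word μ)) (grPairing_vec_dualVec_self L)
    (lt_or_eq_of_grPairing_ne_zero L) (Yangian.span_range_vec L)).1

theorem linearIndependent_dualVec_and_separatingRight {s : ℕ} (L : Listing N s) :
    LinearIndependent ℂ L.dualVec ∧ (grPairing N s).flip.SeparatingLeft :=
  linearIndependent_and_separatingLeft_of_triangular (grPairing N s).flip L.dualVec L.vec
    -- Transposing the matrix exchanges upper and lower triangular, hence the reversed weight.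
    (fun μ => OrderDual.toDual (wordWeight s (L.word μ))) (grPairing_vec_dualVec_self L)
    (fun μ ν h => by
      rcases lt_or_eq_of_grPairing_ne_zero L ν μ h with h | h
      · exact Or.inl (OrderDual.toDual_lt_toDual.2 h)
      · exact Or.inr h.symm) (DualYangian.span_range_dualVec L)

theorem grPairing_nondegenerate (N s : ℕ) : (grPairing N s).Nondegenerate := by
  obtain ⟨L⟩ := nonempty_listing N s
  refine ⟨(linearIndependent_and_separatingLeft_of_triangular (grPairing N s) L.vec L.dualVec
    (fun μ => wordWeight s (L.word μ)) (grPairing_vec_dualVec_self L)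
    (lt_or_eq_of_grPairing_ne_zero L) (Yangian.span_range_vec L)).2, ?_⟩
  exact LinearMap.flip_separatingLeft.1 (linearIndependent_dualVec_and_separatingRight L).2

/-! ### Non-degeneracy, up to separatedness of the descending filtration -/

/-- A non-zero x has a least filtration degree s, where its class is non-zero; but that class pairs
to zero with the whole dual component. -/
theorem canonicalPairing_separatingLeft : (canonicalPairing N).SeparatingLeft := by
  intro x hx
  by_contra hne
  have h := Yangian.iSup_fil x
  classical
  have hmin := fun t ht => Nat.find_min h (m := t) ht
  obtain hs := Nat.find_spec h
  set s := Nat.find h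
  have hgr : Yangian.toGr s ⟨x, hs⟩ = 0 := by
    refine (grPairing_nondegenerate N s).1 _ fun z => ?_
    obtain ⟨z, rfl⟩ := DualYangian.toGr_surjective s z
    exact hx z
  replace hgr : x ∈ Yangian.filLT N s := (Yangian.toGr_eq_zero_iff _).1 hgr
  cases hs' : s with
  | zero =>
    rw [hs'] at hgr
    exact hne (by simpa [Yangian.filLT] using hgr)
  | succ t =>
    rw [hs', Yangian.filLT_succ] at hgr
    exact hmin t (by omega) hgr

/-- On the descending side the argument with graded classes never stops: it only pushes z into the
next step. Deducing z = 0 needs the representations below. -/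
theorem mem_fil_of_canonicalPairing_eq_zero {z : DualYangian N}
    (hz : ∀ x, canonicalPairing N x z = 0) (s : ℕ) : z ∈ DualYangian.fil N s := by
  induction s with
  | zero => exact DualYangian.mem_fil_zero z
  | succ s ih =>
    rw [← DualYangian.toGr_eq_zero_iff ⟨z, ih⟩]
    refine (grPairing_nondegenerate N s).2 _ fun x => ?_
    obtain ⟨x, rfl⟩ := Yangian.toGr_surjective s x
    exact hz x

/-! ### Tensor products of matrix representations -/

namespace DualYangian

section TensorRep

variable {K I J : Type*} [CommRing K] [Algebra ℂ K] [Fintype I] [DecidableEq I] [Fintype J]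
  [DecidableEq J]

open scoped Kronecker in
/-- The action on the first of two tensor factors. -/
def kroneckerLeft (K I J : Type*) [CommRing K] [Algebra ℂ K] [Fintype I] [DecidableEq I] [Fintype J]
    [DecidableEq J] : Matrix I I K →ₐ[ℂ] Matrix (I × J) (I × J) K where
  toFun M := M ⊗ₖ (1 : Matrix J J K)
  map_one' := Matrix.one_kronecker_one
  map_mul' a b := by rw [← Matrix.mul_kronecker_mul, one_mul]
  map_zero' := Matrix.zero_kronecker _
  map_add' a b := Matrix.add_kronecker _ _ _
  commutes' c := by
    rw [Algebra.algebraMap_eq_smul_one, Algebra.algebraMap_eq_smul_one, Matrix.smul_kronecker,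
      Matrix.one_kronecker_one]

open scoped Kronecker in
/-- The action on the second of two tensor factors. -/
def kroneckerRight (K I J : Type*) [CommRing K] [Algebra ℂ K] [Fintype I] [DecidableEq I]
    [Fintype J] [DecidableEq J] : Matrix J J K →ₐ[ℂ] Matrix (I × J) (I × J) K where
  toFun M := (1 : Matrix I I K) ⊗ₖ M
  map_one' := Matrix.one_kronecker_one
  map_mul' a b := by rw [← Matrix.mul_kronecker_mul, one_mul]
  map_zero' := Matrix.kronecker_zero _
  map_add' a b := Matrix.kronecker_add _ _ _
  commutes' c := by
    rw [Algebra.algebraMap_eq_smul_one, Algebra.algebraMap_eq_smul_one, Matrix.kronecker_smul,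
      Matrix.one_kronecker_one]

open scoped Kronecker in
theorem kroneckerLeft_mul_kroneckerRight (a : Matrix I I K) (b : Matrix J J K) :
    kroneckerLeft K I J a * kroneckerRight K I J b = a ⊗ₖ b := by
  change (a ⊗ₖ (1 : Matrix J J K)) * ((1 : Matrix I I K) ⊗ₖ b) = _
  rw [← Matrix.mul_kronecker_mul, one_mul, mul_one]

open scoped Kronecker in
theorem kroneckerLeft_commute_kroneckerRight (a : Matrix I I K) (b : Matrix J J K) :
    Commute (kroneckerLeft K I J a) (kroneckerRight K I J b) := by
  refine (kroneckerLeft_mul_kroneckerRight a b).trans ?_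
  change _ = ((1 : Matrix I I K) ⊗ₖ b) * (a ⊗ₖ (1 : Matrix J J K))
  rw [← Matrix.mul_kronecker_mul, one_mul, mul_one]

theorem commute_kronecker_comp (ρ : DualYangian N →ₐ[ℂ] Matrix I I K)
    (σ : DualYangian N →ₐ[ℂ] Matrix J J K) (x y : DualYangian N) :
    Commute ((kroneckerLeft K I J).comp ρ x) ((kroneckerRight K I J).comp σ y) :=
  kroneckerLeft_commute_kroneckerRight _ _

/-- The tensor product of two matrix representations of the dual Yangian. -/
def tensorRep (ρ : DualYangian N →ₐ[ℂ] Matrix I I K) (σ : DualYangian N →ₐ[ℂ] Matrix J J K) :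
    DualYangian N →ₐ[ℂ] Matrix (I × J) (I × J) K :=
  (Algebra.TensorProduct.lift ((kroneckerLeft K I J).comp ρ) ((kroneckerRight K I J).comp σ)
    (commute_kronecker_comp ρ σ)).comp (comulHom N)

theorem tensorRep_S (ρ : DualYangian N →ₐ[ℂ] Matrix I I K) (σ : DualYangian N →ₐ[ℂ] Matrix J J K)
    (r : ℕ) (i j : Fin N) (x y : I × J) :
    tensorRep ρ σ (S r i j) x y = seriesMul (fun r i j => ρ (S r i j) x.1 y.1)
      (fun r i j => σ (S r i j) x.2 y.2) r i j := by
  rw [tensorRep, AlgHom.comp_apply, comulHom_S, seriesMul, seriesMul]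
  simp only [map_sum, Matrix.sum_apply]
  refine Finset.sum_congr rfl fun k _ => Finset.sum_congr rfl fun p _ => ?_
  rw [Algebra.TensorProduct.tmul_mul_tmul, one_mul, mul_one, Algebra.TensorProduct.lift_tmul,
    AlgHom.comp_apply, AlgHom.comp_apply, kroneckerLeft_mul_kroneckerRight]
  rfl

end TensorRep

/-- Products of series of matrices, one for each pair of entries of two vectors. -/
def pathSeries {R : Type*} [Ring R] (a : Fin N → Fin N → ℕ → Fin N → Fin N → R) :
    (m : ℕ) → (Fin m → Fin N) → (Fin m → Fin N) → ℕ → Fin N → Fin N → R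
  | 0, _, _ => seriesOne
  | m + 1, f, g => seriesMul (a (f 0) (g 0)) (pathSeries a m (Fin.tail f) (Fin.tail g))

theorem pathSeries_map {R R' : Type*} [Ring R] [Ring R'] (φ : R →+* R')
    (a : Fin N → Fin N → ℕ → Fin N → Fin N → R) (m : ℕ) (f g : Fin m → Fin N) (r : ℕ)
    (i j : Fin N) : φ (pathSeries a m f g r i j)
      = pathSeries (fun p q r i j => φ (a p q r i j)) m f g r i j := by
  induction m generalizing r i j with
  | zero =>
    simp only [pathSeries, seriesOne]
    split_ifs <;> simp
  | succ m ih =>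
    rw [pathSeries, seriesMul_map, pathSeries]
    simp only [ih]

/-- A scalar series of matrices. -/
def scalarSeries {R : Type*} [Ring R] (h : ℕ → R) : ℕ → Fin N → Fin N → R :=
  fun r i j => if i = j then h r else 0

theorem isDualYangianSeries_scalarSeries {K : Type*} [CommRing K] (h : ℕ → K) :
    IsDualYangianSeries (scalarSeries h : ℕ → Fin N → Fin N → K) := by
  intro r s i j k l
  rw [Ring.lie_def, Ring.lie_def, mul_comm (scalarSeries h s k l),
    mul_comm (seriesShift (scalarSeries h) s k l), sub_self, sub_self, sub_self]
  unfold scalarSeries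
  split_ifs <;> ring

/-- The one-dimensional representation given by a scalar series. -/
def scalarRep {K : Type*} [CommRing K] [Algebra ℂ K] (h : ℕ → K) : DualYangian N →ₐ[ℂ] K :=
  lift (scalarSeries h) (isDualYangianSeries_scalarSeries h)

/-- The tensor product of copies of an `N`-dimensional representation and a one-dimensional one. -/
def pathRep {K : Type*} [CommRing K] [Algebra ℂ K] (ρ : DualYangian N →ₐ[ℂ] Matrix (Fin N) (Fin N) K)
    (h : ℕ → K) : (m : ℕ) → DualYangian N →ₐ[ℂ] Matrix (Fin m → Fin N) (Fin m → Fin N) K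
  | 0 => ((Algebra.ofId K (Matrix (Fin 0 → Fin N) (Fin 0 → Fin N) K)).restrictScalars ℂ).comp
      (scalarRep h)
  | m + 1 => (Matrix.reindexAlgEquiv ℂ K (Fin.consEquiv fun _ : Fin (m + 1) => Fin N)).toAlgHom.comp
      (tensorRep ρ (pathRep ρ h m))

theorem pathRep_S {K : Type*} [CommRing K] [Algebra ℂ K]
    (ρ : DualYangian N →ₐ[ℂ] Matrix (Fin N) (Fin N) K) (h : ℕ → K) (m : ℕ) (r : ℕ) (i j : Fin N)
    (f g : Fin m → Fin N) : pathRep ρ h m (S r i j) f g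
      = seriesMul (pathSeries (fun p q r i j => ρ (S r i j) p q) m f g) (scalarSeries h) r i j := by
  induction m generalizing r i j with
  | zero =>
    rw [pathSeries, one_seriesMul, pathRep, AlgHom.comp_apply, scalarRep, lift_S, Subsingleton.elim f g]
    simp [Algebra.ofId_apply, Matrix.algebraMap_matrix_apply]
  | succ m ih =>
    rw [pathSeries, seriesMul_assoc, pathRep, AlgHom.comp_apply]
    refine (tensorRep_S ρ (pathRep ρ h m) r i j _ _).trans ?_
    have : (fun r i j => pathRep ρ h m (S r i j) (Fin.tail f) (Fin.tail g)) = seriesMul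
        (pathSeries (fun p q r i j => ρ (S r i j) p q) m (Fin.tail f) (Fin.tail g))
        (scalarSeries h) := by
      funext r i j
      exact ih _ _ _ _ _
    rw [← this]
    rfl

/-! ### A deformation of the counit -/

/-- The coefficients `a r` are divisible by `t ^ r`, and `a 0` is `e` times the identity matrix
modulo `t`. -/
def IsDeformation {K : Type*} [CommRing K] (t e : K) (a : ℕ → Fin N → Fin N → K) : Prop :=
  (∀ r i j, t ^ r ∣ a r i j) ∧ ∀ i j, t ∣ a 0 i j - if i = j then e else 0

theorem IsDeformation.seriesMul {K : Type*} [CommRing K] {t e e' : K} {a b : ℕ → Fin N → Fin N → K}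
    (ha : IsDeformation t e a) (hb : IsDeformation t e' b) :
    IsDeformation t (e * e') (seriesMul a b) := by
  constructor
  · intro r i j
    refine Finset.dvd_sum fun k _ => Finset.dvd_sum fun p hp => ?_
    rw [← Finset.HasAntidiagonal.mem_antidiagonal.1 hp, pow_add]
    exact mul_dvd_mul (ha.1 _ _ _) (hb.1 _ _ _)
  · intro i j
    have h : (if i = j then e * e' else 0)
        = ∑ k, (if i = k then e else 0) * (if k = j then e' else 0) := by
      simp
    rw [h, _root_.seriesMul, ← Finset.sum_sub_distrib]
    refine Finset.dvd_sum fun k _ => ?_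
    simp only [Finset.HasAntidiagonal.antidiagonal_zero, Finset.sum_singleton]
    have := dvd_add ((ha.2 i k).mul_right (b 0 k j)) ((hb.2 k j).mul_left (if i = k then e else 0))
    convert this using 1
    ring

/-- The polynomials in the deformation parameter `X` with coefficients in the polynomials in
the coefficients of a scalar series. -/
abbrev DeformRing : Type := Polynomial (MvPolynomial ℕ ℂ)

/-- The representation `(1 - t) + t (v + P)`, where `t` is the deformation parameter. -/
def deformRep (N : ℕ) : DualYangian N →ₐ[ℂ] Matrix (Fin N) (Fin N) DeformRing :=
  lift _ (isDualYangianSeries_vector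
    (fun r => if r = 0 then 1 - Polynomial.X else if r = 1 then Polynomial.X else 0)
    (fun r => if r = 0 then -Polynomial.X else 0) (by
      rintro (_ | _ | r) (_ | _ | s) <;> simp <;> ring))

/-- The scalar series `(1 - t) + t X_0 + ∑ r ≥ 1, (t v) ^ r X_r`. -/
def deformScalar (r : ℕ) : DeformRing :=
  if r = 0 then 1 - Polynomial.X + Polynomial.X * Polynomial.C (MvPolynomial.X 0)
  else Polynomial.X ^ r * Polynomial.C (MvPolynomial.X r)

/-- The entries of the tensor product of copies of `deformRep` and a scalar series. -/
abbrev deformPathRep (N m : ℕ) :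
    DualYangian N →ₐ[ℂ] Matrix (Fin m → Fin N) (Fin m → Fin N) DeformRing :=
  pathRep (deformRep N) deformScalar m

theorem deformRep_S_apply (r : ℕ) (i j p q : Fin N) : deformRep N (S r i j) p q
    = (if i = j ∧ p = q then (if r = 0 then 1 - Polynomial.X else if r = 1 then Polynomial.X else 0)
      else 0) + if r = 0 ∧ j = p ∧ i = q then Polynomial.X else 0 := by
  rw [deformRep, lift_S, Matrix.sub_apply, Matrix.smul_apply, Matrix.single_apply, Matrix.one_apply]
  by_cases h4 : r = 0
  · simp only [h4, true_and, if_true]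
    by_cases h3 : j = p ∧ i = q
    · rw [if_pos h3, if_pos h3]
      by_cases h1 : i = j <;> by_cases h2 : p = q <;> simp [h1, h2]
    · rw [if_neg h3, if_neg h3]
      by_cases h1 : i = j <;> by_cases h2 : p = q <;> simp [h1, h2]
  · by_cases h1 : i = j <;> by_cases h2 : p = q <;> simp [h4, h1, h2]

theorem isDeformation_pathSeries (m : ℕ) (f g : Fin m → Fin N) :
    IsDeformation (Polynomial.X : DeformRing) (if f = g then 1 else 0)
      (pathSeries (fun p q r i j => deformRep N (S r i j) p q) m f g) := by
  induction m with
  | zero =>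
    rw [Subsingleton.elim f g, if_pos rfl, pathSeries]
    constructor
    · intro r i j
      unfold seriesOne
      split_ifs with h
      · simp [h.1]
      · exact dvd_zero _
    · intro i j
      simp [seriesOne]
  | succ m ih =>
    have h0 : IsDeformation (Polynomial.X : DeformRing) (if f 0 = g 0 then 1 else 0)
        (fun r i j => deformRep N (S r i j) (f 0) (g 0)) := by
      constructor
      · intro r i j
        change _ ∣ deformRep N (S r i j) (f 0) (g 0)
        rw [deformRep_S_apply]
        match r with
        | 0 => simp
        | 1 => simp; split_ifs <;> simp
        | r + 2 => simp
      · intro i j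
        change _ ∣ deformRep N (S 0 i j) (f 0) (g 0) - _
        rw [deformRep_S_apply]
        simp only [if_true, true_and]
        by_cases h3 : j = f 0 ∧ i = g 0
        · rw [if_pos h3]
          by_cases h1 : i = j <;> by_cases h2 : f 0 = g 0 <;> simp [h1, h2]
        · rw [if_neg h3]
          by_cases h1 : i = j <;> by_cases h2 : f 0 = g 0 <;> simp [h1, h2]
          exact (dvd_neg (α := DeformRing)).2 dvd_rfl
    have := h0.seriesMul (ih (Fin.tail f) (Fin.tail g))
    refine (?_ : (if f 0 = g 0 then (1 : DeformRing) else 0) *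
      (if Fin.tail f = Fin.tail g then 1 else 0) = if f = g then 1 else 0) ▸ this
    have : f = g ↔ f 0 = g 0 ∧ Fin.tail f = Fin.tail g := by
      constructor
      · rintro rfl
        exact ⟨rfl, rfl⟩
      · rintro ⟨h1, h2⟩
        rw [← Fin.cons_self_tail f, ← Fin.cons_self_tail g, h1, h2]
    by_cases h1 : f 0 = g 0 <;> by_cases h2 : Fin.tail f = Fin.tail g <;> simp [this, h1, h2]

theorem isDeformation_deformPathRep (m : ℕ) (f g : Fin m → Fin N) :
    IsDeformation (Polynomial.X : DeformRing) (if f = g then 1 else 0)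
      (fun r i j => deformPathRep N m (S r i j) f g) := by
  have h : IsDeformation (Polynomial.X : DeformRing) 1
      (scalarSeries deformScalar : ℕ → Fin N → Fin N → DeformRing) := by
    constructor
    · intro r i j
      rw [scalarSeries, deformScalar]
      split_ifs with h1 h2
      · simp [h2]
      · exact dvd_mul_right _ _
      · exact dvd_zero _
    · intro i j
      rw [scalarSeries, deformScalar]
      split_ifs with h1 h2
      · refine ⟨Polynomial.C (MvPolynomial.X 0) - 1, by ring⟩
      · simp at h2
      · simp
  have := (isDeformation_pathSeries m f g).seriesMul h
  rw [mul_one] at this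
  convert this using 1
  funext r i j
  exact pathRep_S _ _ _ _ _ _ _ _

/-- The coefficient at v^(r-1) is divisible by t^(r-1), and for r = 1 subtracting δ_ij leaves a
factor t. Since r = 2 also gives only one factor, half the degree is the rate that holds for every
generator and adds up over monomials. -/
theorem X_pow_dvd_deformPathRep_T (m : ℕ) (r : ℕ+) (i j : Fin N) (f g : Fin m → Fin N) :
    (Polynomial.X : DeformRing) ^ (((r : ℕ) + 1) / 2) ∣ deformPathRep N m (T r i j) f g := by
  obtain ⟨r, rfl⟩ : ∃ q : ℕ, r = q.succPNat := ⟨r.natPred, (PNat.succPNat_natPred r).symm⟩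
  have hT : T r.succPNat i j = S r i j - if r = 0 ∧ i = j then 1 else 0 := by simp [S]
  obtain ⟨h1, h2⟩ := isDeformation_deformPathRep (N := N) m f g
  rw [hT, map_sub, Matrix.sub_apply]
  cases r with
  | zero =>
    have := h2 i j
    simp only [Nat.succPNat_coe]
    rw [show (Nat.succ 0 + 1) / 2 = 1 from rfl, pow_one]
    convert this using 2
    by_cases h3 : i = j <;> simp [h3, Matrix.one_apply]
  | succ r =>
    rw [if_neg (by simp), map_zero, Matrix.zero_apply, sub_zero]
    refine (pow_dvd_pow _ ?_).trans (h1 (r + 1) i j)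
    simp
    omega

theorem X_pow_dvd_deformPathRep_monomial (m : ℕ) (w : List (GenIndex N)) (f g : Fin m → Fin N)
    (k : ℕ) (hk : 2 * k ≤ wordDegree w) :
    (Polynomial.X : DeformRing) ^ k ∣ deformPathRep N m (monomial w) f g := by
  induction w generalizing f k with
  | nil =>
    have : k = 0 := by simpa using hk
    simp [this]
  | cons a w ih =>
    rw [monomial_cons, map_mul, Matrix.mul_apply]
    refine Finset.dvd_sum fun h _ => ?_
    have := mul_dvd_mul (X_pow_dvd_deformPathRep_T m a.1 a.2.1 a.2.2 f h)
      (ih h (wordDegree w / 2) (by omega))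
    rw [← pow_add] at this
    refine (pow_dvd_pow _ ?_).trans this
    rw [wordDegree_cons] at hk
    omega

/-- An entry lying in all powers of t is divisible by every power, and a polynomial in t with this
property is zero. -/
theorem deformPathRep_eq_zero {z : DualYangian N} (hz : ∀ s, z ∈ fil N s) (m : ℕ) :
    deformPathRep N m z = 0 := by
  refine Matrix.ext fun f g => ?_
  have h : ∀ k, (Polynomial.X : DeformRing) ^ k ∣ deformPathRep N m z f g := by
    intro k
    have hk := hz (2 * k)
    clear hz
    induction hk using Submodule.span_induction with
    | mem x hx =>
      obtain ⟨w, hw, rfl⟩ := hx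
      exact X_pow_dvd_deformPathRep_monomial m w f g k hw
    | zero => simp
    | add x y _ _ hx hy =>
      rw [map_add, Matrix.add_apply]
      exact dvd_add hx hy
    | smul c x _ hx =>
      rw [map_smul, Matrix.smul_apply, Algebra.smul_def]
      exact hx.mul_left _
  refine Polynomial.ext fun k => ?_
  rw [Matrix.zero_apply, Polynomial.coeff_zero]
  exact Polynomial.X_pow_dvd_iff.1 (h (k + 1)) k (Nat.lt_succ_self k)

end DualYangian

/-! ### Words filtered by their total exponent in v -/

namespace DualYangian

/-- The product of the `S r i j` with given exponents and given pairs of indices. -/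
def sWord : List ℕ → List (Fin N × Fin N) → DualYangian N
  | r :: σ, p :: π => S r p.1 p.2 * sWord σ π
  | [], _ => 1
  | _ :: _, [] => 1

theorem sWord_nil (π : List (Fin N × Fin N)) : sWord [] π = 1 := by
  cases π <;> rfl

theorem sWord_append {σ σ' : List ℕ} {π π' : List (Fin N × Fin N)} (h : σ.length = π.length) :
    sWord (σ ++ σ') (π ++ π') = sWord σ π * sWord σ' π' := by
  induction σ generalizing π with
  | nil =>
    have : π = [] := by simpa using h.symm
    subst this
    simp [sWord_nil]
  | cons r σ ih =>
    cases π with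
    | nil => simp at h
    | cons p π =>
      rw [List.cons_append, List.cons_append, sWord, sWord, ih (by simpa using h), mul_assoc]

/-- The span of the words of total exponent less than `d`. -/
def sFil (N d : ℕ) : Submodule ℂ (DualYangian N) :=
  Submodule.span ℂ ((fun x : List ℕ × List (Fin N × Fin N) => sWord x.1 x.2) ''
    {x | x.1.length = x.2.length ∧ x.1.sum < d})

theorem sWord_mem_sFil {d : ℕ} {σ : List ℕ} {π : List (Fin N × Fin N)} (h : σ.length = π.length)
    (hd : σ.sum < d) : sWord σ π ∈ sFil N d :=
  Submodule.subset_span ⟨(σ, π), ⟨h, hd⟩, rfl⟩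

theorem sFil_mono {d e : ℕ} (h : d ≤ e) : sFil N d ≤ sFil N e :=
  Submodule.span_mono (Set.image_mono fun _ hx => ⟨hx.1, hx.2.trans_le h⟩)

/-- Membership in `sFil N d` means total exponents at most d - 1, so the product has exponents at
most d + e - 2; hence the slack of one. -/
theorem mul_mem_sFil {d e f : ℕ} (h : d + e ≤ f + 1) {x y : DualYangian N} (hx : x ∈ sFil N d)
    (hy : y ∈ sFil N e) : x * y ∈ sFil N f := by
  have hxy := Submodule.mul_mem_mul hx hy
  rw [sFil, sFil, Submodule.span_mul_span] at hxy
  refine Submodule.span_le.2 ?_ hxy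
  rintro _ ⟨_, ⟨p, hp, rfl⟩, _, ⟨q, hq, rfl⟩, rfl⟩
  simp only [SetLike.mem_coe]
  rw [← sWord_append hp.1]
  refine sWord_mem_sFil ?_ ?_
  · rw [List.length_append, List.length_append, hp.1, hq.1]
  · have h1 := hp.2
    have h2 := hq.2
    rw [List.sum_append]
    omega

theorem S_mem_sFil {d r : ℕ} (h : r < d) (i j : Fin N) : S r i j ∈ sFil N d := by
  simpa [sWord] using sWord_mem_sFil (N := N) (σ := [r]) (π := [(i, j)]) rfl (by simpa using h)

theorem exists_mem_sFil (z : DualYangian N) : ∃ d, z ∈ sFil N d := by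
  induction z using induction_on with
  | algebraMap c =>
    rw [Algebra.algebraMap_eq_smul_one]
    exact ⟨1, Submodule.smul_mem _ _ (sWord_mem_sFil (σ := []) (π := []) rfl (by simp))⟩
  | S r i j => exact ⟨r + 1, S_mem_sFil (Nat.lt_succ_self r) i j⟩
  | mul x y hx hy =>
    obtain ⟨s, hs⟩ := hx
    obtain ⟨t, ht⟩ := hy
    exact ⟨s + t, mul_mem_sFil (by omega) hs ht⟩
  | add x y hx hy =>
    obtain ⟨s, hs⟩ := hx
    obtain ⟨t, ht⟩ := hy
    exact ⟨s + t, Submodule.add_mem _ (sFil_mono (by omega) hs) (sFil_mono (by omega) ht)⟩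

/-- The defining relation read from right to left: exchanging two exponents while the index pairs
stay in place costs commutators of total exponent r + s - 1. Modulo lower exponent a word therefore
depends only on the multiset of its exponents and the list of its index pairs. -/
theorem S_mul_S_sub_mem (r s : ℕ) (i j k l : Fin N) :
    S r i l * S s k j - S s i l * S r k j ∈ sFil N (r + s) := by
  rw [← S_isDualYangianSeries r s i j k l]
  have h : ∀ p q i j k l, p + q < r + s → ⁅(S p i j : DualYangian N), S q k l⁆ ∈ sFil N (r + s) := by
    intro p q i j k l hpq
    rw [Ring.lie_def]
    refine Submodule.sub_mem _ ?_ ?_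
    · exact mul_mem_sFil (d := p + 1) (e := q + 1) (by omega) (S_mem_sFil (by omega) _ _)
        (S_mem_sFil (by omega) _ _)
    · exact mul_mem_sFil (d := q + 1) (e := p + 1) (by omega) (S_mem_sFil (by omega) _ _)
        (S_mem_sFil (by omega) _ _)
  refine Submodule.sub_mem _ ?_ ?_
  · cases r with
    | zero => simp [seriesShift, Ring.lie_def]
    | succ r => exact h r s _ _ _ _ (by omega)
  · cases s with
    | zero => simp [seriesShift, Ring.lie_def]
    | succ s => exact h r s _ _ _ _ (by omega)

theorem sWord_sub_sWord_mem {σ σ' : List ℕ} (h : σ.Perm σ') {π : List (Fin N × Fin N)}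
    (hπ : σ.length = π.length) : sWord σ π - sWord σ' π ∈ sFil N σ.sum := by
  induction h generalizing π with
  | nil => simp
  | @cons r σ σ' h ih =>
    cases π with
    | nil => simp at hπ
    | cons p π =>
      rw [sWord, sWord, ← mul_sub]
      refine mul_mem_sFil (d := r + 1) (e := σ.sum) (by simp; omega) (S_mem_sFil (by omega) _ _)
        (ih (by simpa using hπ))
  | swap r s σ =>
    match π with
    | [] => simp at hπ
    | [p] => simp at hπ
    | p :: q :: π =>
      rw [sWord, sWord, sWord, sWord, ← mul_assoc, ← mul_assoc, ← sub_mul]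
      refine mul_mem_sFil (d := s + r) (e := σ.sum + 1) (by simp; omega)
        (S_mul_S_sub_mem _ _ _ _ _ _) (sWord_mem_sFil (by simpa using hπ) (by omega))
  | trans h1 h2 ih1 ih2 =>
    have := Submodule.add_mem _ (ih1 hπ) (h1.sum_eq ▸ ih2 (h1.length_eq ▸ hπ))
    simpa using this

/-! ### Values of the specialized deformation at words -/

/-- The entries of `deformPathRep` at the value `1` of the deformation parameter. -/
def scalarPathRep (N m : ℕ) :
    DualYangian N →ₐ[ℂ] Matrix (Fin m → Fin N) (Fin m → Fin N) (MvPolynomial ℕ ℂ) :=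
  (((Polynomial.aeval (1 : MvPolynomial ℕ ℂ)).restrictScalars ℂ).mapMatrix).comp (deformPathRep N m)

theorem scalarPathRep_apply (m : ℕ) (z : DualYangian N) (f g : Fin m → Fin N) :
    scalarPathRep N m z f g = Polynomial.evalRingHom 1 (deformPathRep N m z f g) := rfl

/-- The entries of `v + P`. -/
def shiftEntry (p q : Fin N) (r : ℕ) (i j : Fin N) : ℂ :=
  (if i = j ∧ p = q then (if r = 1 then 1 else 0) else 0) + if r = 0 ∧ j = p ∧ i = q then 1 else 0

theorem scalarPathRep_S (m r : ℕ) (i j : Fin N) (f g : Fin m → Fin N) :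
    scalarPathRep N m (S r i j) f g = ∑ p ∈ Finset.HasAntidiagonal.antidiagonal r,
      MvPolynomial.C (pathSeries shiftEntry m f g p.1 i j) * MvPolynomial.X p.2 := by
  rw [scalarPathRep_apply, pathRep_S, seriesMul_map, seriesMul, Finset.sum_comm]
  refine Finset.sum_congr rfl fun p _ => ?_
  have h2 : ∀ k, Polynomial.evalRingHom 1 (scalarSeries deformScalar p.2 k j)
      = if k = j then (MvPolynomial.X p.2 : MvPolynomial ℕ ℂ) else 0 := by
    intro k
    rw [scalarSeries, deformScalar]
    split_ifs with h1 h2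
    · simp [h2]
    · simp
    · simp
  have h1 : ∀ k, Polynomial.evalRingHom 1
      (pathSeries (fun p q r i j => deformRep N (S r i j) p q) m f g p.1 i k)
      = MvPolynomial.C (pathSeries shiftEntry m f g p.1 i k) := by
    intro k
    rw [pathSeries_map, pathSeries_map]
    congr 1
    funext p q r i j
    rw [deformRep_S_apply, shiftEntry, map_add, map_add]
    congr 1
    · by_cases h1 : i = j ∧ p = q
      · rw [if_pos h1, if_pos h1]
        by_cases h2 : r = 0
        · simp [h2]
        · by_cases h3 : r = 1 <;> simp [h2, h3]
      · rw [if_neg h1, if_neg h1, map_zero, map_zero]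
    · by_cases h1 : r = 0 ∧ j = p ∧ i = q
      · rw [if_pos h1, if_pos h1]
        simp
      · rw [if_neg h1, if_neg h1, map_zero, map_zero]
  simp only [h1, h2, mul_ite, mul_zero, Finset.sum_ite_eq', Finset.mem_univ, if_true]

/-- At v = 0 only the permutations P remain. Their product is a cyclic shift: i enters the row of
sites at one end and j leaves at the other. -/
theorem pathSeries_shiftEntry_zero (m : ℕ) (i j : Fin N) (f g : Fin m → Fin N) :
    pathSeries shiftEntry m f g 0 i j
      = if List.ofFn g ++ [j] = i :: List.ofFn f then 1 else 0 := by
  induction m generalizing i with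
  | zero => simp [pathSeries, seriesOne, eq_comm]
  | succ m ih =>
    rw [pathSeries, seriesMul]
    simp only [Finset.HasAntidiagonal.antidiagonal_zero, Finset.sum_singleton, ih]
    rw [Finset.sum_eq_single (f 0)]
    · rw [List.ofFn_succ, List.ofFn_succ (f := f)]
      simp only [List.cons_append, List.cons.injEq]
      by_cases h : g 0 = i
      · simp [shiftEntry, h]
        rfl
      · simp [shiftEntry, h, Ne.symm h]
    · intro k _ hk
      simp [shiftEntry, hk]
    · simp

/-- Every power of v taken from a factor v + P lowers the sum of the indices of the X_r. As the sum
of μ is at least the total exponent, only the constant terms contribute; they give the monomial of σ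
and a succession of shifts that pushes the index pairs through the row. -/
theorem coeff_scalarPathRep_sWord (m : ℕ) (σ : List ℕ) (π : List (Fin N × Fin N))
    (h : σ.length = π.length) (μ : Multiset ℕ) (hμ : σ.sum ≤ μ.sum) (f g : Fin m → Fin N) :
    MvPolynomial.coeff (Multiset.toFinsupp μ) (scalarPathRep N m (sWord σ π) f g)
      = if μ = σ ∧ List.ofFn g ++ (π.map Prod.snd).reverse = (π.map Prod.fst).reverse ++ List.ofFn f
        then 1 else 0 := by
  induction σ generalizing π μ f with
  | nil =>
    have : π = [] := by simpa using h.symm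
    subst this
    rw [sWord_nil, map_one, Matrix.one_apply]
    have hfg : f = g ↔ List.ofFn g = List.ofFn f := by
      rw [List.ofFn_inj, eq_comm]
    by_cases h1 : f = g
    · rw [if_pos h1, MvPolynomial.coeff_one]
      refine if_congr ?_ rfl rfl
      rw [h1, eq_comm, map_eq_zero_iff _ Multiset.toFinsupp.injective]
      simp
    · rw [if_neg h1, if_neg, MvPolynomial.coeff_zero]
      rintro ⟨-, h2⟩
      exact h1 (hfg.2 (by simpa using h2))
  | cons r σ ih =>
    match π with
    | [] => simp at h
    | (k, l) :: π =>
      rw [List.length_cons, List.length_cons, add_left_inj] at h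
      rw [List.sum_cons] at hμ
      have hX : ∀ (a b : ℕ) (t : Fin m → Fin N), a + b = r → MvPolynomial.coeff (Multiset.toFinsupp μ)
          (MvPolynomial.X b * scalarPathRep N m (sWord σ π) t g)
          = if a = 0 ∧ μ = r ::ₘ (σ : Multiset ℕ) ∧ List.ofFn g ++ (π.map Prod.snd).reverse
            = (π.map Prod.fst).reverse ++ List.ofFn t then 1 else 0 := by
        intro a b t hab
        by_cases hb : b ∈ μ
        · obtain ⟨μ, rfl⟩ := Multiset.exists_cons_of_mem hb
          rw [← Multiset.singleton_add, map_add, Multiset.toFinsupp_singleton,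
            MvPolynomial.coeff_X_mul, ih π h μ (by rw [Multiset.sum_cons] at hμ; omega) t]
          refine if_congr ?_ rfl rfl
          rw [Multiset.singleton_add]
          constructor
          · rintro ⟨h1, h2⟩
            have : a = 0 := by
              rw [Multiset.sum_cons, h1, Multiset.sum_coe] at hμ
              omega
            refine ⟨this, ?_, h2⟩
            rw [h1, ← hab, this, zero_add]
          · rintro ⟨h1, h2, h3⟩
            rw [h1, zero_add] at hab
            rw [hab] at h2
            exact ⟨(Multiset.cons_inj_right r).1 h2, h3⟩
        · rw [MvPolynomial.coeff_X_mul', if_neg (by simpa using hb), if_neg]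
          rintro ⟨h1, h2, -⟩
          rw [h1, zero_add] at hab
          exact hb (by rw [h2, hab]; exact Multiset.mem_cons_self _ _)
      rw [sWord, map_mul, Matrix.mul_apply, MvPolynomial.coeff_sum]
      have hterm : ∀ t : Fin m → Fin N, MvPolynomial.coeff (Multiset.toFinsupp μ)
          (scalarPathRep N m (S r k l) f t * scalarPathRep N m (sWord σ π) t g)
          = if (List.ofFn t ++ [l] = k :: List.ofFn f) ∧ μ = r ::ₘ (σ : Multiset ℕ) ∧
            List.ofFn g ++ (π.map Prod.snd).reverse = (π.map Prod.fst).reverse ++ List.ofFn t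
            then 1 else 0 := by
        intro t
        rw [scalarPathRep_S, Finset.sum_mul, MvPolynomial.coeff_sum, Finset.sum_eq_single (0, r)]
        · rw [mul_assoc, MvPolynomial.coeff_C_mul, hX 0 r t (zero_add r),
            pathSeries_shiftEntry_zero]
          by_cases h1 : List.ofFn t ++ [l] = k :: List.ofFn f
          · rw [if_pos h1, one_mul]
            exact if_congr (by simp only [h1, true_and]) rfl rfl
          · rw [if_neg h1, zero_mul, if_neg fun h2 => h1 h2.1]
        · rintro ⟨a, b⟩ hab hne
          rw [Finset.HasAntidiagonal.mem_antidiagonal] at hab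
          rw [mul_assoc, MvPolynomial.coeff_C_mul, hX a b t hab, if_neg, mul_zero]
          rintro ⟨rfl, -⟩
          exact hne (by rw [← hab, zero_add])
        · simp
      simp only [hterm, List.map_cons, List.reverse_cons]
      by_cases hc : μ = ((r :: σ : List ℕ) : Multiset ℕ) ∧
          List.ofFn g ++ ((π.map Prod.snd).reverse ++ [l])
            = (π.map Prod.fst).reverse ++ [k] ++ List.ofFn f
      · rw [if_pos hc]
        obtain ⟨h1, h2⟩ := hc
        -- The shift is deterministic: the only possible intermediate row arises from f by putting k
        -- in front and dropping the last entry.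
        obtain ⟨t, l', ht⟩ : ∃ (t : Fin m → Fin N) (l' : Fin N),
            k :: List.ofFn f = List.ofFn t ++ [l'] :=
          ⟨_, _, by rw [← List.ofFn_cons, List.ofFn_succ', List.concat_eq_append]⟩
        rw [List.append_assoc, List.singleton_append, ht, ← List.append_assoc,
          ← List.append_assoc] at h2
        obtain ⟨h3, h4⟩ := List.append_inj' h2 rfl
        obtain rfl : l = l' := by simpa using h4
        rw [Finset.sum_eq_single t]
        · rw [if_pos ⟨ht.symm, h1, h3⟩]
        · intro t' _ hne
          refine if_neg fun h5 => hne ?_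
          exact List.ofFn_injective (List.append_inj' (h5.1.trans ht) rfl).1
        · simp
      · rw [if_neg hc]
        refine Finset.sum_eq_zero fun t _ => if_neg ?_
        rintro ⟨h1, h2, h3⟩
        refine hc ⟨h2, ?_⟩
        rw [← List.append_assoc, h3, List.append_assoc, List.append_assoc, h1]
        simp

theorem exists_ofFn_eq {α : Type*} {m : ℕ} {l : List α} (h : l.length = m) :
    ∃ f : Fin m → α, List.ofFn f = l := by
  subst h
  exact ⟨l.get, List.ofFn_get l⟩

/-- Modulo lower exponent, z is a combination of words with sorted exponents. The entries of
`scalarPathRep` isolate each coefficient of top exponent, so all of these vanish. -/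
theorem mem_sFil_of_scalarPathRep_eq_zero {z : DualYangian N} (hz : ∀ m, scalarPathRep N m z = 0)
    {d : ℕ} (hd : z ∈ sFil N (d + 1)) : z ∈ sFil N d := by
  classical
  rw [sFil, Finsupp.mem_span_image_iff_linearCombination] at hd
  obtain ⟨c, hc, rfl⟩ := hd
  rw [Finsupp.mem_supported] at hc
  -- Words with the same key agree modulo lower exponent, so their coefficients are added up by
  -- `Finsupp.mapDomain`.
  set key : List ℕ × List (Fin N × Fin N) → Multiset ℕ × List (Fin N × Fin N) :=
    fun x => (x.1, x.2)
  set rep : Multiset ℕ × List (Fin N × Fin N) → DualYangian N :=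
    fun κ => sWord (κ.1.sort (· ≤ ·)) κ.2
  have h1 : Finsupp.linearCombination ℂ (fun x : List ℕ × List (Fin N × Fin N) => sWord x.1 x.2) c
      - Finsupp.linearCombination ℂ rep (c.mapDomain key) ∈ sFil N d := by
    rw [Finsupp.linearCombination_mapDomain, Finsupp.linearCombination_apply,
      Finsupp.linearCombination_apply, Finsupp.sum, Finsupp.sum, ← Finset.sum_sub_distrib]
    refine Submodule.sum_mem _ fun x hx => ?_
    rw [← smul_sub]
    refine Submodule.smul_mem _ _ ?_
    have hx' := hc hx
    refine sFil_mono (Nat.lt_succ_iff.1 hx'.2) (sWord_sub_sWord_mem ?_ hx'.1)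
    rw [← Multiset.coe_eq_coe, Multiset.sort_eq]
  have h2 : ∀ κ : Multiset ℕ × List (Fin N × Fin N), κ.1.sum = d →
      κ.1.card = κ.2.length → c.mapDomain key κ = 0 := by
    intro κ hκ hcard
    -- With as many sites as letters, the row f carries all second indices and g all first indices.
    -- The shift condition then compares lists of equal length and recovers the index pairs.
    obtain ⟨f, hf⟩ := exists_ofFn_eq (l := (κ.2.map Prod.snd).reverse) (m := κ.2.length) (by simp)
    obtain ⟨g, hg⟩ := exists_ofFn_eq (l := (κ.2.map Prod.fst).reverse) (m := κ.2.length) (by simp)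
    have h3 := congrArg (fun M => MvPolynomial.coeff (Multiset.toFinsupp κ.1) (M f g))
      (hz κ.2.length)
    simp only [Matrix.zero_apply, MvPolynomial.coeff_zero] at h3
    rw [Finsupp.linearCombination_apply, Finsupp.sum, map_sum, Matrix.sum_apply,
      MvPolynomial.coeff_sum] at h3
    rw [Finsupp.mapDomain, Finsupp.sum_apply, Finsupp.sum, ← h3]
    refine Finset.sum_congr rfl fun x hx => ?_
    have hx' := hc hx
    rw [map_smul, Matrix.smul_apply, MvPolynomial.coeff_smul, coeff_scalarPathRep_sWord _ _ _ hx'.1 _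
      (by rw [hκ]; exact Nat.lt_succ_iff.1 hx'.2), Finsupp.single_apply, smul_eq_mul, mul_ite,
      mul_one, mul_zero]
    refine if_congr ?_ rfl rfl
    rw [hf, hg]
    constructor
    · intro h
      rw [← h]
      exact ⟨rfl, rfl⟩
    · rintro ⟨h4, h5⟩
      have hlen : x.2.length = κ.2.length := by
        rw [← hcard, h4, Multiset.coe_card, hx'.1]
      obtain ⟨h6, h7⟩ := List.append_inj h5 (by simp [hlen])
      refine Prod.ext h4.symm ?_
      rw [List.zip_of_prod (List.reverse_injective h6).symm (List.reverse_injective h7)]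
      exact (List.zip_of_prod rfl rfl).symm
  have h3 : Finsupp.linearCombination ℂ rep (c.mapDomain key) ∈ sFil N d := by
    rw [Finsupp.linearCombination_apply]
    refine Submodule.sum_mem _ fun κ hκ => Submodule.smul_mem _ _ ?_
    have hne := Finsupp.mem_support_iff.1 hκ
    obtain ⟨x, hx, rfl⟩ := Finset.mem_image.1 (Finsupp.mapDomain_support hκ)
    have hx' := hc hx
    have hsum : (x.1 : Multiset ℕ).sum = x.1.sum := Multiset.sum_coe _
    refine sWord_mem_sFil ?_ ?_
    · rw [Multiset.length_sort]
      exact hx'.1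
    · rw [← Multiset.sum_coe, Multiset.sort_eq]
      refine lt_of_le_of_ne ?_ fun e => hne (h2 _ e hx'.1)
      exact (Multiset.sum_coe _).trans_le (Nat.lt_succ_iff.1 hx'.2)
  simpa using Submodule.add_mem _ h1 h3

theorem eq_zero_of_mem_fil {z : DualYangian N} (hz : ∀ s, z ∈ fil N s) : z = 0 := by
  have h0 : ∀ m, scalarPathRep N m z = 0 := by
    intro m
    rw [scalarPathRep, AlgHom.comp_apply, deformPathRep_eq_zero hz, map_zero]
  obtain ⟨d, hd⟩ := exists_mem_sFil z
  induction d with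
  | zero => simpa [sFil] using hd
  | succ d ih => exact ih (mem_sFil_of_scalarPathRep_eq_zero h0 hd)

end DualYangian

/-! ### Assembly of the theorem -/

theorem canonicalPairing_nondegenerate : (canonicalPairing N).Nondegenerate :=
  ⟨canonicalPairing_separatingLeft, fun _ hz =>
    DualYangian.eq_zero_of_mem_fil (mem_fil_of_canonicalPairing_eq_zero hz)⟩

theorem mainTheorem5 (N : ℕ) :
    (∃! β : Yangian N →ₗ[ℂ] DualYangian N →ₗ[ℂ] ℂ, IsCanonicalPairing β) ∧
    ∀ β : Yangian N →ₗ[ℂ] DualYangian N →ₗ[ℂ] ℂ, IsCanonicalPairing β →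
      β.Nondegenerate ∧
      IsBialgebraPairing β ∧
      ∀ s : ℕ,
        (∃! γ : Yangian.Gr N s →ₗ[ℂ] DualYangian.Gr N s →ₗ[ℂ] ℂ, IsGrPairing β s γ) ∧
        ∀ γ : Yangian.Gr N s →ₗ[ℂ] DualYangian.Gr N s →ₗ[ℂ] ℂ, IsGrPairing β s γ →
          γ.Nondegenerate ∧
          ∀ L : Listing N s,
            (∃ b : Module.Basis (GrIndex N s) ℂ (Yangian.Gr N s), ∀ μ, b μ = L.vec μ) ∧
            (∃ b : Module.Basis (GrIndex N s) ℂ (DualYangian.Gr N s), ∀ μ, b μ = L.dualVec μ) ∧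
            (∀ μ, γ (L.vec μ) (L.dualVec μ) ≠ 0) ∧
            (∀ ord : LinearOrder (GrIndex N s),
              (∀ μ ν : GrIndex N s, μ.parts < ν.parts → ord.lt μ ν) →
              ∀ μ ν : GrIndex N s, ord.lt μ ν → γ (L.vec μ) (L.dualVec ν) = 0) := by
  refine ⟨⟨canonicalPairing N, canonicalPairing_isCanonicalPairing,
    fun β h => h.eq canonicalPairing_isCanonicalPairing⟩, fun β hβ => ?_⟩
  obtain rfl := hβ.eq canonicalPairing_isCanonicalPairing
  refine ⟨canonicalPairing_nondegenerate, canonicalPairing_isBialgebraPairing, fun s =>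
    ⟨⟨grPairing N s, grPairing_isGrPairing s, fun γ h => h.eq (grPairing_isGrPairing s)⟩,
      fun γ hγ => ?_⟩⟩
  obtain rfl := hγ.eq (grPairing_isGrPairing s)
  refine ⟨grPairing_nondegenerate N s, fun L => ⟨?_, ?_, grPairing_vec_dualVec_self L,
    grPairing_eq_zero_of_lt L⟩⟩
  · exact ⟨Module.Basis.mk (linearIndependent_vec L) (Yangian.span_range_vec L),
      fun μ => Module.Basis.mk_apply _ _ _⟩
  · exact ⟨Module.Basis.mk (linearIndependent_dualVec_and_separatingRight L).1
      (DualYangian.span_range_dualVec L), fun μ => Module.Basis.mk_apply _ _ _⟩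
end
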